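/- **Setting.** Write $\mathbb R_+=(0,\infty)$, $\mathbb R^2_+=\mathbb R_+\times\mathbb R_+$. Let $BV(\mathbb R_+)$ be the space of bounded functions on $\mathbb R_+$ with finite total variation on $(0,T)$ for every $T>0$, always represented by their right continuous representative. Let $\mathcal U\subset\mathbb R^N$ be open and convex and let $f:\mathcal U\to\mathbb R^N$ be smooth. A convex (resp. strictly convex) entropy pair is a pair $(U,F)$ of $C^2$ functions $\mathcal U\to\mathbb R$ with $\nabla F^T=\nabla U^T\nabla f$ and $\nabla^2U\ge0$ (resp. $\nabla^2U$ positive definite) on $\mathcal U$. Assume that a strictly convex entropy pair exists. Let $u_I\in L^\infty(\mathbb R_+;\mathcal U)$ and let $u_B\in BV(\mathbb R_+)$ take values in $\mathcal U$. Let $\epsilon\to0+$ along a sequence; let $u_I^\epsilon$ be bounded in $L^\infty(\mathbb R_+)$ and $u_B^\epsilon$ be bounded in $L^\infty(\mathbb R_+)$ and in $BV(0,T)$ for every $T>0$, uniformly in $\epsilon$, with $u_I^\epsilon\to u_I$ and $u_B^\epsilon\to u_B$ almost everywhere. Let $u^\epsilon:[0,\infty)^2\to\mathcal U$ be classical solutions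 (continuous on $[0,\infty)^2$ and $C^2$ on $\{x\ge0,\ t>0\}$) of $$\partial_tu^\epsilon+\partial_xf(u^\epsilon)=\epsilon\,\partial_{xx}u^\epsilon\quad(x,t>0),\qquad u^\epsilon(x,0)=u^\epsilon_I(x)\ (x>0),\qquad u^\epsilon(0,t)=u_B^\epsilon(t)\ (t>0),$$ that are bounded uniformly in $\epsilon$, and set $v^\epsilon(y,t)=u^\epsilon(\epsilon y,t)$. Let $\nu=(\nu_{x,t})$ and $\mu=(\mu_{y,t})$ be Young measures associated with $u^\epsilon$ and $v^\epsilon$: measurable maps from $\mathbb R^2_+$ to the probability measures on $\mathcal U$ such that, for every continuous $g:\mathcal U\to\mathbb R$, $g(u^\epsilon)\rightharpoonup\langle\nu,g\rangle$ and $g(v^\epsilon)\rightharpoonup\langle\mu,g\rangle$ weakly-$\star$ in $L^\infty(\mathbb R^2_+)$. A *boundary Young measure* is a measurable family, indexed by $t>0$, of probability measures carried by one compact subset of $\mathcal U$. Limits of time averages as $y\to0+$ or $x\to0+$ are taken outside a null set, since these averages are defined for almost every $y$, $x$. **Theorem 2.1.** For a convex entropy pair $(U,F)$, $\theta\in BV(\mathbb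 R_+)$ and $0\le T_1<T_2<\infty$, consider the distribution on $\mathbb R_+$ $$G(y)=\int_{T_1}^{T_2}\langle\mu_{y,t},F\rangle\,\theta(t)\,dt-\frac{d}{dy}\int_{T_1}^{T_2}\langle\mu_{y,t},U\rangle\,\theta(t)\,dt .$$ 1) If $\theta\ge0$, or if $(U,F)=(u_j,f_j)$ for some $1\le j\le N$ and $\theta$ has arbitrary sign, then $G$ is a function in $BV(\mathbb R_+)$, hence defined pointwise as a right continuous function, and $x\mapsto\int_{T_1}^{T_2}\langle\nu_{x,t},F\rangle\theta(t)\,dt$ agrees almost everywhere with a function in $BV(\mathbb R_+)$. There is a boundary Young measure $\mu_{0,t}$ such that, for all convex entropy pairs $(U,F)$, all $\theta\in BV(\mathbb R_+)$ and all $0\le T_1<T_2$, $$\lim_{y\to0+}\int_{T_1}^{T_2}\langle\mu_{y,t},U\rangle\,\theta(t)\,dt=\int_{T_1}^{T_2}\langle\mu_{0,t},U\rangle\,\theta(t)\,dt,$$ and there is a boundary Young measure $\nu_{0,t}$ such that, for all such $(U,F)$, $\theta$, $T_1,T_2$, $$\lim_{x\to0+}\int_{T_1}^{T_2}\langle\nu_{x,t},F\rangle\,\theta(t)\,dt=\int_{T_1}^{T_2}\langle\nu_{0,t},F\rangle\,\theta(t)\,dt.$$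 2) For every such $\nu_{0,t}$, every convex entropy pair $(U,F)$ and all $0<y_1<y_2$, in the sense of distributions in $t\in\mathbb R_+$, $$F(u_B)+\nabla U(u_B)\bigl(\langle\nu_{0,t},f\rangle-f(u_B)\bigr)\ \ge\ \langle\mu_{y_1,t},F\rangle-\partial_y\langle\mu_{y_1,t},U\rangle\ \ge\ \langle\mu_{y_2,t},F\rangle-\partial_y\langle\mu_{y_2,t},U\rangle\ \ge\ \langle\nu_{0,t},F\rangle;$$ more strongly, for all $\theta\in BV(\mathbb R_+)$ with $\theta\ge0$, all $0\le T_1<T_2$ and all $0<y_1<y_2$, $$\int_{T_1}^{T_2}\Bigl(F(u_B)+\nabla U(u_B)\bigl(\langle\nu_{0,t},f\rangle-f(u_B)\bigr)\Bigr)\theta\,dt\ \ge\ G(y_1)\ \ge\ G(y_2)\ \ge\ \int_{T_1}^{T_2}\langle\nu_{0,t},F\rangle\,\theta\,dt .$$ 3) For every such $\mu_{0,t}$, $\mu_{0,t}=\delta_{u_B(t)}$ for almost every $t>0$. For every such $\nu_{0,t}$, every convex entropy pair, every $\theta\in BV(\mathbb R_+)$ with $\theta\ge0$ and all $0\le T_1<T_2$,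 the limit $\lim_{y\to\infty}G(y)$ exists, is finite, and satisfies $$\lim_{y\to\infty}G(y)\ \ge\ \int_{T_1}^{T_2}\langle\nu_{0,t},F\rangle\,\theta(t)\,dt .$$ -/

import Mathlib

open MeasureTheory ProbabilityTheory Filter Topology Set
open scoped ContDiff

noncomputable section

namespace BoundaryLayer

/-- The state space `ℝ^N` with its Euclidean norm. -/
abbrev State (N : ℕ) : Type := EuclideanSpace ℝ (Fin N)

/-- Lebesgue measure on the half line `ℝ₊ = (0, ∞)`. -/
abbrev volHalf : Measure ℝ := volume.restrict (Ioi 0)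

/-- Lebesgue measure on the quarter plane `ℝ²₊ = (0, ∞) × (0, ∞)`. -/
abbrev volQuarter : Measure (ℝ × ℝ) := volume.restrict (Ioi 0 ×ˢ Ioi 0)

/-- The space `BV(ℝ₊)`: bounded functions on `(0, ∞)` with finite total variation on every
interval `(0, T)`, normalized to be right continuous. (For the right continuous representative
the pointwise variation is the total mass of the distributional derivative.) Values on `(-∞, 0]`
are irrelevant. -/
structure IsBV {V : Type*} [NormedAddCommGroup V] (w : ℝ → V) : Prop where
  bounded : ∃ C : ℝ, ∀ t, 0 < t → ‖w t‖ ≤ C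
  variation : ∀ T : ℝ, BoundedVariationOn w (Ioo 0 T)
  right_continuous : ∀ t, 0 < t → ContinuousWithinAt w (Ici t) t

/-- `(U, F)` is an entropy pair of class `C²` for the flux `f` on `𝒰`: `∇Fᵀ = ∇Uᵀ ∇f`. -/
structure IsEntropyPair {N : ℕ} (𝒰 : Set (State N)) (f : State N → State N)
    (U F : State N → ℝ) : Prop where
  contDiffOn_entropy : ContDiffOn ℝ 2 U 𝒰
  contDiffOn_flux : ContDiffOn ℝ 2 F 𝒰
  compatible : ∀ u ∈ 𝒰, fderiv ℝ F u = (fderiv ℝ U u).comp (fderiv ℝ f u)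

/-- Entropy pair with non-negative Hessian `∇²U` on `𝒰`. -/
structure IsConvexEntropyPair {N : ℕ} (𝒰 : Set (State N)) (f : State N → State N)
    (U F : State N → ℝ) : Prop extends IsEntropyPair 𝒰 f U F where
  hessian_nonneg : ∀ u ∈ 𝒰, ∀ w : State N, 0 ≤ fderiv ℝ (fderiv ℝ U) u w w

/-- Entropy pair with positive definite Hessian `∇²U` on `𝒰`. -/
structure IsStrictlyConvexEntropyPair {N : ℕ} (𝒰 : Set (State N)) (f : State N → State N)
    (U F : State N → ℝ) : Prop extends IsEntropyPair 𝒰 f U F where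
  hessian_pos : ∀ u ∈ 𝒰, ∀ w : State N, w ≠ 0 → 0 < fderiv ℝ (fderiv ℝ U) u w w

/-- `u = u(x, t)` is a classical `𝒰`-valued solution of `u_t + f(u)_x = ε u_xx` in the quarter
plane with initial data `uI` and boundary data `uB`: continuous on the closed quarter plane and
of class `C²` up to the boundary `x = 0` for positive times. -/
structure IsViscousSolution {N : ℕ} (𝒰 : Set (State N)) (f : State N → State N) (ε : ℝ)
    (uI uB : ℝ → State N) (u : ℝ → ℝ → State N) : Prop where
  mem : ∀ x t, 0 ≤ x → 0 ≤ t → u x t ∈ 𝒰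
  continuousOn : ContinuousOn (fun p : ℝ × ℝ => u p.1 p.2) (Ici 0 ×ˢ Ici 0)
  contDiffOn : ContDiffOn ℝ 2 (fun p : ℝ × ℝ => u p.1 p.2) (Ici 0 ×ˢ Ioi 0)
  equation : ∀ x t, 0 < x → 0 < t →
    deriv (fun s => u x s) t + deriv (fun z => f (u z t)) x
      = ε • deriv (deriv (fun z => u z t)) x
  initial : ∀ x, 0 < x → u x 0 = uI x
  boundary : ∀ t, 0 < t → u 0 t = uB t

/-- The functions `h n` converge to `h'` weakly-`⋆` in `L^∞(ℝ²₊)`. -/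
structure WeakStarTendsto (h : ℕ → ℝ × ℝ → ℝ) (h' : ℝ × ℝ → ℝ) : Prop where
  memLp : ∀ n, MemLp (h n) ⊤ volQuarter
  memLp_limit : MemLp h' ⊤ volQuarter
  tendsto : ∀ φ : ℝ × ℝ → ℝ, Integrable φ volQuarter →
    Tendsto (fun n => ∫ p, h n p * φ p ∂volQuarter) atTop (𝓝 (∫ p, h' p * φ p ∂volQuarter))

/-- `κ` is a Young measure with values in `Prob(𝒰)` associated with the sequence `w n`:
`g(w n) ⇀ ⟨κ, g⟩` weakly-`⋆` in `L^∞(ℝ²₊)` for every continuous `g : 𝒰 → ℝ`. -/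
structure IsYoungMeasure {N : ℕ} (𝒰 : Set (State N)) (w : ℕ → ℝ × ℝ → State N)
    (κ : Kernel (ℝ × ℝ) (State N)) : Prop where
  markov : IsMarkovKernel κ
  concentrated : ∀ p ∈ (Ioi 0 ×ˢ Ioi 0 : Set (ℝ × ℝ)), κ p 𝒰ᶜ = 0
  weakStar : ∀ g : State N → ℝ, ContinuousOn g 𝒰 →
    WeakStarTendsto (fun n p => g (w n p)) (fun p => ∫ z, g z ∂(κ p))

/-- The time average `z ↦ ∫_{T₁}^{T₂} ⟨κ_{z,t}, g⟩ θ(t) dt`. -/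
def timeAvg {N : ℕ} (κ : Kernel (ℝ × ℝ) (State N)) (g : State N → ℝ) (θ : ℝ → ℝ)
    (T₁ T₂ : ℝ) (z : ℝ) : ℝ :=
  ∫ t in T₁..T₂, (∫ w, g w ∂(κ (z, t))) * θ t

/-- The distribution
`∫_{T₁}^{T₂} ⟨μ_{y,t}, F⟩ θ(t) dt - d/dy ∫_{T₁}^{T₂} ⟨μ_{y,t}, U⟩ θ(t) dt` on `(0, ∞)` is the
function `G`. -/
def IsLayerFlux {N : ℕ} (μ : Kernel (ℝ × ℝ) (State N)) (U F : State N → ℝ) (θ : ℝ → ℝ)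
    (T₁ T₂ : ℝ) (G : ℝ → ℝ) : Prop :=
  ∀ φ : ℝ → ℝ, ContDiff ℝ ∞ φ → HasCompactSupport φ → tsupport φ ⊆ Ioi 0 →
    ∫ y in Ioi 0, (timeAvg μ F θ T₁ T₂ y * φ y + timeAvg μ U θ T₁ T₂ y * deriv φ y)
      = ∫ y in Ioi 0, G y * φ y

/-- `κ₀` is a (bounded) Young measure on the boundary: a measurable family `κ₀ t`, `t > 0`, of
probability measures carried by one compact subset of `𝒰`. -/
structure IsBoundaryYoungMeasure {N : ℕ} (𝒰 : Set (State N)) (κ₀ : Kernel ℝ (State N)) :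
    Prop where
  markov : IsMarkovKernel κ₀
  support : ∃ K : Set (State N), IsCompact K ∧ K ⊆ 𝒰 ∧ ∀ t, 0 < t → κ₀ t Kᶜ = 0

/-- The time averages of `⟨κ_{z,t}, g⟩` against `θ` on `(T₁, T₂)`, which are defined for almost
every `z > 0`, tend to that of `⟨κ₀_t, g⟩` as `z → 0+` (limit outside a null set of `z`). -/
def HasTraceOn {N : ℕ} (κ : Kernel (ℝ × ℝ) (State N)) (κ₀ : Kernel ℝ (State N))
    (g : State N → ℝ) (θ : ℝ → ℝ) (T₁ T₂ : ℝ) : Prop :=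
  Tendsto (timeAvg κ g θ T₁ T₂) (𝓝[>] 0 ⊓ ae volume)
    (𝓝 (∫ t in T₁..T₂, (∫ w, g w ∂(κ₀ t)) * θ t))

/-- `μ₀` is a trace at `y = 0` of `μ`, tested on all convex entropies `U`. -/
structure IsEntropyTrace {N : ℕ} (𝒰 : Set (State N)) (f : State N → State N)
    (μ : Kernel (ℝ × ℝ) (State N)) (μ₀ : Kernel ℝ (State N)) : Prop
    extends IsBoundaryYoungMeasure 𝒰 μ₀ where
  trace : ∀ U F : State N → ℝ, IsConvexEntropyPair 𝒰 f U F → ∀ θ : ℝ → ℝ, IsBV θ →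
    ∀ T₁ T₂ : ℝ, 0 ≤ T₁ → T₁ < T₂ → HasTraceOn μ μ₀ U θ T₁ T₂

/-- `ν₀` is a trace at `x = 0` of `ν`, tested on the fluxes `F` of all convex entropies. -/
structure IsFluxTrace {N : ℕ} (𝒰 : Set (State N)) (f : State N → State N)
    (ν : Kernel (ℝ × ℝ) (State N)) (ν₀ : Kernel ℝ (State N)) : Prop
    extends IsBoundaryYoungMeasure 𝒰 ν₀ where
  trace : ∀ U F : State N → ℝ, IsConvexEntropyPair 𝒰 f U F → ∀ θ : ℝ → ℝ, IsBV θ →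
    ∀ T₁ T₂ : ℝ, 0 ≤ T₁ → T₁ < T₂ → HasTraceOn ν ν₀ F θ T₁ T₂

end BoundaryLayer

end

open scoped BoundedContinuousFunction

/-
The time average `H(x)` of the viscous entropy flux `F(u) - ε ∂ₓU(u)` against a weight `θ ≥ 0` of
bounded variation satisfies `H' ≤ c`: by the viscous entropy balance `H'` is
`-∫ θ ∂ₜU(u) - ε ∫ θ ∇²U(∂ₓu, ∂ₓu)`, where the second term is dissipative and the first is bounded
by the variation of `θ` and the sup norm of `U(u)`. Up to a linear term these averages are monotone
in `x`, and monotone functions converging as distributions converge at every continuity point of the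
limit, so no subsequence is needed. In the interior variable `x` the term `ε ∂ₓU(u)` disappears in
the limit, so `⟨ν, F⟩` averages to an almost antitone function. In the layer variable `y = x / ε`
the slope bound is `ε c → 0`, so the limit `G` is antitone, and it lies between the limit of `H` at
`x = 0` and the limits of `H` at `x > 0`, which gives the chain of boundary entropy inequalities.

At `x = 0` the viscous flux is
`F(u_B) - ∇U(u_B) f(u_B) + ∑ⱼ ∂ⱼU(u_B) (fⱼ - ε ∂ₓuⱼ)(0, t)`. The coordinates `(±uⱼ, ±fⱼ)` are
convex entropy pairs, so the last factor is monotone from both sides and its limit is `⟨ν₀, fⱼ⟩`;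
its coefficient `∂ⱼU(u_B)` is of bounded variation and may be absorbed in the weight.

The traces come from compactness of Young measures on a compact set. That of `μ` is determined by
`H = ⟨v, F⟩ - ∂_y ⟨v, U⟩` being bounded near `y = 0`: the average of `U(v)` differs by `O(y)` from
its boundary value `U(u_B)`. So `⟨μ₀, U⟩ = U(u_B)` for every convex entropy, in particular
`⟨μ₀, id⟩ = u_B`, and the equality case of Jensen's inequality for a strictly convex `U` gives
`μ₀ = δ_{u_B}`.
-/

namespace BoundaryLayer

section BoundedVariation

variable {ψ g g' : ℝ → ℝ} {a b A B C : ℝ}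

theorem abs_sum_mul_sub_le (p g : ℕ → ℝ) (m : ℕ) (hA : ∀ i ≤ m, |p i| ≤ A)
    (hB : ∀ i ≤ m, |g i| ≤ B) :
    |∑ i ∈ Finset.range m, p i * (g (i + 1) - g i)|
      ≤ 2 * A * B + B * ∑ i ∈ Finset.range m, |p (i + 1) - p i| := by
  have hA0 : 0 ≤ A := (abs_nonneg _).trans (hA 0 (Nat.zero_le _))
  have summation_by_parts : ∑ i ∈ Finset.range m, p i * (g (i + 1) - g i)
      = p m * g m - p 0 * g 0 - ∑ i ∈ Finset.range m, g (i + 1) * (p (i + 1) - p i) := by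
    rw [← Finset.sum_range_sub (fun i => p i * g i) m, ← Finset.sum_sub_distrib]
    exact Finset.sum_congr rfl fun i _ => by ring
  have boundary_le : ∀ i ≤ m, |p i * g i| ≤ A * B := fun i hi => by
    rw [abs_mul]
    exact mul_le_mul (hA i hi) (hB i hi) (abs_nonneg _) hA0
  have sum_le : |∑ i ∈ Finset.range m, g (i + 1) * (p (i + 1) - p i)|
      ≤ B * ∑ i ∈ Finset.range m, |p (i + 1) - p i| := by
    rw [Finset.mul_sum]
    refine (Finset.abs_sum_le_sum_abs _ _).trans (Finset.sum_le_sum fun i hi => ?_)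
    rw [abs_mul]
    exact mul_le_mul_of_nonneg_right (hB _ (Finset.mem_range.1 hi)) (abs_nonneg _)
  rw [summation_by_parts]
  linarith [abs_sub (p m * g m - p 0 * g 0) (∑ i ∈ Finset.range m, g (i + 1) * (p (i + 1) - p i)),
    abs_sub (p m * g m) (p 0 * g 0), boundary_le m le_rfl, boundary_le 0 (Nat.zero_le m)]

theorem aemeasurable_of_boundedVariationOn {s : Set ℝ} (hs : MeasurableSet s)
    (hψ : BoundedVariationOn ψ s) : AEMeasurable ψ (volume.restrict s) := by
  obtain ⟨p, q, hp, hq, rfl⟩ := hψ.locallyBoundedVariationOn.exists_monotoneOn_sub_monotoneOn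
  exact (aemeasurable_restrict_of_monotoneOn hs hp).sub (aemeasurable_restrict_of_monotoneOn hs hq)

theorem integrableOn_mul_of_boundedVariationOn {s : Set ℝ} (hs : MeasurableSet s)
    (hψ : BoundedVariationOn ψ s) (hg : IntegrableOn g s) :
    IntegrableOn (fun t => ψ t * g t) s := by
  rcases s.eq_empty_or_nonempty with rfl | ⟨c, hc⟩
  · exact integrableOn_empty
  refine Integrable.bdd_mul (c := |ψ c| + (eVariationOn ψ s).toReal) hg
    (aemeasurable_of_boundedVariationOn hs hψ).aestronglyMeasurable ?_
  filter_upwards [ae_restrict_mem hs] with t ht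
  have := hψ.dist_le ht hc
  rw [Real.dist_eq] at this
  rw [Real.norm_eq_abs]
  linarith [abs_sub_abs_le_abs_sub (ψ t) (ψ c)]

theorem abs_integral_mul_deriv_sub_le (hab : a ≤ b) (hψ : BoundedVariationOn ψ (Icc a b))
    (hg : ∀ t ∈ Icc a b, HasDerivAt g (g' t) t) (hg' : ContinuousOn g' (Icc a b))
    (hC : ∀ t ∈ Icc a b, |g' t| ≤ C) :
    |(∫ t in a..b, ψ t * g' t) - ψ a * (g b - g a)|
      ≤ (eVariationOn ψ (Icc a b)).toReal * C * (b - a) := by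
  have hg'i : IntervalIntegrable g' volume a b := hg'.intervalIntegrable_of_Icc hab
  have hψg' : IntervalIntegrable (fun t => ψ t * g' t) volume a b := by
    rw [intervalIntegrable_iff_integrableOn_Icc_of_le hab]
    exact integrableOn_mul_of_boundedVariationOn measurableSet_Icc hψ hg'.integrableOn_Icc
  have hFTC : ∫ t in a..b, g' t = g b - g a :=
    intervalIntegral.integral_eq_sub_of_hasDerivAt
      (fun t ht => hg t (by rwa [uIcc_of_le hab] at ht)) hg'i
  rw [← hFTC, ← intervalIntegral.integral_const_mul,
    ← intervalIntegral.integral_sub hψg' (hg'i.const_mul _), ← Real.norm_eq_abs,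
    ← abs_of_nonneg (sub_nonneg.2 hab)]
  refine intervalIntegral.norm_integral_le_of_norm_le_const fun t ht => ?_
  rw [uIoc_of_le hab] at ht
  have ht' := Ioc_subset_Icc_self ht
  rw [← sub_mul, norm_mul]
  exact mul_le_mul (hψ.dist_le ht' (left_mem_Icc.2 hab)) (hC t ht') (norm_nonneg _)
    ENNReal.toReal_nonneg

theorem abs_integral_mul_deriv_sub_sum_le {τ : ℕ → ℝ} (hτ : Monotone τ) {m : ℕ} {d : ℝ}
    (hd : ∀ i, τ (i + 1) - τ i ≤ d) (hψ : BoundedVariationOn ψ (Icc (τ 0) (τ m)))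
    (hg : ∀ t ∈ Icc (τ 0) (τ m), HasDerivAt g (g' t) t)
    (hg' : ContinuousOn g' (Icc (τ 0) (τ m))) (hC : ∀ t ∈ Icc (τ 0) (τ m), |g' t| ≤ C) :
    |(∫ t in τ 0..τ m, ψ t * g' t)
        - ∑ i ∈ Finset.range m, ψ (τ i) * (g (τ (i + 1)) - g (τ i))|
      ≤ (eVariationOn ψ (Icc (τ 0) (τ m))).toReal * C * d := by
  have hC0 : 0 ≤ C := (abs_nonneg _).trans (hC _ (left_mem_Icc.2 (hτ (Nat.zero_le m))))
  have hsub : ∀ i < m, Icc (τ i) (τ (i + 1)) ⊆ Icc (τ 0) (τ m) := fun i hi =>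
    Icc_subset_Icc (hτ (Nat.zero_le i)) (hτ hi)
  have hsplit : ∫ t in τ 0..τ m, ψ t * g' t
      = ∑ i ∈ Finset.range m, ∫ t in τ i..τ (i + 1), ψ t * g' t := by
    refine (intervalIntegral.sum_integral_adjacent_intervals fun i hi => ?_).symm
    rw [intervalIntegrable_iff_integrableOn_Icc_of_le (hτ i.le_succ)]
    exact integrableOn_mul_of_boundedVariationOn measurableSet_Icc (hψ.mono (hsub i hi))
      (hg'.mono (hsub i hi)).integrableOn_Icc
  have hvar : (eVariationOn ψ (Icc (τ 0) (τ m))).toReal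
      = ∑ i ∈ Finset.range m, (eVariationOn ψ (Icc (τ i) (τ (i + 1)))).toReal := by
    rw [← eVariationOn.sum' ψ hτ, ENNReal.toReal_sum]
    exact fun i hi => hψ.mono (hsub i (Finset.mem_range.1 hi))
  rw [hsplit, ← Finset.sum_sub_distrib, hvar, Finset.sum_mul, Finset.sum_mul]
  refine (Finset.abs_sum_le_sum_abs _ _).trans (Finset.sum_le_sum fun i hi => ?_)
  have hi' := hsub i (Finset.mem_range.1 hi)
  exact (abs_integral_mul_deriv_sub_le (hτ i.le_succ) (hψ.mono hi') (fun t ht => hg t (hi' ht))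
    (hg'.mono hi') fun t ht => hC t (hi' ht)).trans
      (mul_le_mul_of_nonneg_left (hd i) (mul_nonneg ENNReal.toReal_nonneg hC0))

theorem sum_abs_sub_le_eVariationOn {τ : ℕ → ℝ} (hτ : Monotone τ) {m : ℕ}
    (hψ : BoundedVariationOn ψ (Icc (τ 0) (τ m))) :
    ∑ i ∈ Finset.range m, |ψ (τ (i + 1)) - ψ (τ i)|
      ≤ (eVariationOn ψ (Icc (τ 0) (τ m))).toReal := by
  have hfin : ∀ i ∈ Finset.range m, BoundedVariationOn ψ (Icc (τ i) (τ (i + 1))) := fun i hi =>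
    hψ.mono (Icc_subset_Icc (hτ (Nat.zero_le i)) (hτ (Finset.mem_range.1 hi)))
  rw [← eVariationOn.sum' ψ hτ, ENNReal.toReal_sum hfin]
  exact Finset.sum_le_sum fun i hi => (hfin i hi).dist_le
    (right_mem_Icc.2 (hτ i.le_succ)) (left_mem_Icc.2 (hτ i.le_succ))

theorem abs_integral_mul_deriv_le (hab : a ≤ b) (hψ : BoundedVariationOn ψ (Icc a b))
    (hA : ∀ t ∈ Icc a b, |ψ t| ≤ A) (hg : ∀ t ∈ Icc a b, HasDerivAt g (g' t) t)
    (hg' : ContinuousOn g' (Icc a b)) (hB : ∀ t ∈ Icc a b, |g t| ≤ B) :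
    |∫ t in a..b, ψ t * g' t| ≤ (2 * A + (eVariationOn ψ (Icc a b)).toReal) * B := by
  set V := (eVariationOn ψ (Icc a b)).toReal with hV
  obtain ⟨C, hC⟩ := isCompact_Icc.exists_bound_of_continuousOn hg'
  have hB0 : 0 ≤ B := (abs_nonneg _).trans (hB a (left_mem_Icc.2 hab))
  have riemann_sum_le : ∀ m : ℕ, |∫ t in a..b, ψ t * g' t|
      ≤ (2 * A + V) * B + V * C * ((b - a) * (1 / ((m : ℝ) + 1))) := by
    intro m
    set d : ℝ := (b - a) * (1 / ((m : ℝ) + 1)) with hd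
    have hd0 : 0 ≤ d := mul_nonneg (sub_nonneg.2 hab) (by positivity)
    set τ : ℕ → ℝ := fun i => a + i * d with hτ
    have hτm : Monotone τ := fun i j hij =>
      add_le_add_right (mul_le_mul_of_nonneg_right (Nat.cast_le.2 hij) hd0) a
    have hτ0 : τ 0 = a := by simp [hτ]
    have hτe : τ (m + 1) = b := by simp only [hτ, hd]; push_cast; field_simp; ring
    have hmem : ∀ i ≤ m + 1, τ i ∈ Icc a b := fun i hi =>
      ⟨hτ0 ▸ hτm (Nat.zero_le i), hτe ▸ hτm hi⟩
    have hdiff := abs_integral_mul_deriv_sub_sum_le (ψ := ψ) (g := g) (C := C) hτm (m := m + 1)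
      (d := d) (fun i => by simp only [hτ]; push_cast; linarith)
      (by rwa [hτ0, hτe]) (by rwa [hτ0, hτe]) (by rwa [hτ0, hτe]) (by rwa [hτ0, hτe])
    have hvar : ∑ i ∈ Finset.range (m + 1), |ψ (τ (i + 1)) - ψ (τ i)| ≤ V := by
      rw [hV, ← hτe, ← hτ0]
      exact sum_abs_sub_le_eVariationOn hτm (by rwa [hτ0, hτe])
    have hsum := abs_sum_mul_sub_le (fun i => ψ (τ i)) (fun i => g (τ i)) (m + 1)
      (fun i hi => hA _ (hmem i hi)) (fun i hi => hB _ (hmem i hi))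
    rw [hτ0, hτe, ← hV] at hdiff
    have := mul_le_mul_of_nonneg_left hvar hB0
    linarith [abs_sub_abs_le_abs_sub (∫ t in a..b, ψ t * g' t)
      (∑ i ∈ Finset.range (m + 1), ψ (τ i) * (g (τ (i + 1)) - g (τ i)))]
  have hlim : Tendsto (fun m : ℕ => (2 * A + V) * B + V * C * ((b - a) * (1 / ((m : ℝ) + 1))))
      atTop (𝓝 ((2 * A + V) * B)) := by
    simpa using ((tendsto_one_div_add_atTop_nhds_zero_nat (𝕜 := ℝ)).const_mul (b - a)).const_mul
      (V * C) |>.const_add ((2 * A + V) * B)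
  exact ge_of_tendsto' hlim riemann_sum_le

end BoundedVariation

section TestFunctions

/-- Test functions on the open set `s`: smooth functions with compact support contained in `s`. -/
structure IsTest (s : Set ℝ) (φ : ℝ → ℝ) : Prop where
  smooth : ContDiff ℝ ∞ φ
  compact : HasCompactSupport φ
  supp : tsupport φ ⊆ s

variable {s t : Set ℝ} {φ p q m : ℝ → ℝ} {x y c : ℝ}

theorem IsTest.mono (h : IsTest s φ) (hst : s ⊆ t) : IsTest t φ :=
  ⟨h.smooth, h.compact, h.supp.trans hst⟩

theorem IsTest.eq_zero (h : IsTest s φ) (hx : x ∉ s) : φ x = 0 :=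
  image_eq_zero_of_notMem_tsupport fun h' => hx (h.supp h')

theorem IsTest.exists_Icc {α : ℝ} (h : IsTest (Ioi α) φ) :
    ∃ a b, α < a ∧ a < b ∧ tsupport φ ⊆ Icc a b := by
  rcases (tsupport φ).eq_empty_or_nonempty with he | hne
  · exact ⟨α + 1, α + 2, by linarith, by linarith, by simp [he]⟩
  · have hc : IsCompact (tsupport φ) := h.compact
    have hmem := hc.sInf_mem hne
    refine ⟨sInf (tsupport φ), sSup (tsupport φ) + 1, h.supp hmem, ?_, fun x hx =>
      ⟨csInf_le hc.bddBelow hx, (le_csSup hc.bddAbove hx).trans (by linarith)⟩⟩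
    linarith [le_csSup hc.bddAbove hmem]

theorem IsTest.integrableOn_mul (hφ : IsTest (Ioi 0) φ) (hp : LocallyIntegrableOn p (Ioi 0)) :
    IntegrableOn (fun y => p y * φ y) (Ioi 0) := by
  obtain ⟨a, b, ha, -, hab⟩ := hφ.exists_Icc
  have hIcc : IntegrableOn (fun x => p x * φ x) (Icc a b) :=
    (hp.integrableOn_compact_subset (fun x hx => ha.trans_le hx.1) isCompact_Icc).mul_continuousOn
      hφ.smooth.continuous.continuousOn isCompact_Icc
  refine IntegrableOn.of_forall_sdiff_eq_zero hIcc measurableSet_Ioi fun x hx => ?_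
  rw [image_eq_zero_of_notMem_tsupport fun h' => hx.2 (hab h'), mul_zero]

theorem IsTest.deriv (h : IsTest s φ) : IsTest s (deriv φ) where
  smooth := (contDiff_infty_iff_deriv.1 h.smooth).2
  compact := h.compact.deriv
  supp := (closure_mono support_deriv_subset).trans <| by
    rw [(isClosed_tsupport φ).closure_eq]; exact h.supp

theorem IsTest.integral_mul_deriv {p' : ℝ → ℝ} (hφ : IsTest (Ioi 0) φ)
    (hp : ∀ y, 0 < y → HasDerivAt p (p' y) y) (hp' : LocallyIntegrableOn p' (Ioi 0)) :
    ∫ y in Ioi 0, p y * _root_.deriv φ y = -∫ y in Ioi 0, p' y * φ y := by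
  obtain ⟨a, b, ha, -, hab⟩ := hφ.exists_Icc
  have hφ0 : ∀ y, y ∉ Icc a b → p y * φ y = 0 := fun y hy => by
    rw [image_eq_zero_of_notMem_tsupport fun h' => hy (hab h'), mul_zero]
  have near_zero : Tendsto (p * φ) (𝓝[>] 0) (𝓝 0) := by
    refine tendsto_const_nhds.congr' ?_
    filter_upwards [nhdsWithin_le_nhds (Iio_mem_nhds ha)] with y hy
    exact (hφ0 y fun h => h.1.not_gt hy).symm
  have near_top : Tendsto (p * φ) atTop (𝓝 0) := by
    refine tendsto_const_nhds.congr' ?_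
    filter_upwards [Ioi_mem_atTop b] with y hy
    exact (hφ0 y fun h => h.2.not_gt hy).symm
  have hpc : ContinuousOn p (Ioi 0) := fun y hy => (hp y hy).continuousAt.continuousWithinAt
  rw [integral_Ioi_mul_deriv_eq_deriv_mul hp
    (fun y _ => (hφ.smooth.differentiable (by simp) y).hasDerivAt)
    (hφ.deriv.integrableOn_mul (hpc.locallyIntegrableOn measurableSet_Ioi))
    (hφ.integrableOn_mul hp') near_zero near_top, sub_zero, zero_sub]

theorem locallyIntegrableOn_of_antitoneOn (hm : AntitoneOn m (Ioi 0)) :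
    LocallyIntegrableOn m (Ioi 0) :=
  (locallyIntegrableOn_iff isOpen_Ioi.isLocallyClosed).2 fun _ hk hkc =>
    (hm.mono hk).integrableOn_isCompact hkc

theorem ae_eq_of_forall_isTest (hp : LocallyIntegrableOn p (Ioi 0))
    (hq : LocallyIntegrableOn q (Ioi 0))
    (h : ∀ φ, IsTest (Ioi 0) φ → ∫ y in Ioi 0, p y * φ y = ∫ y in Ioi 0, q y * φ y) :
    p =ᵐ[volHalf] q := by
  have hsub : ∀ᵐ y, y ∈ Ioi (0 : ℝ) → (p - q) y = 0 := by
    refine isOpen_Ioi.ae_eq_zero_of_integral_contDiff_smul_eq_zero (hp.sub hq)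
      fun φ smooth compact supp => ?_
    have hφ : IsTest (Ioi 0) φ := ⟨smooth, compact, supp⟩
    calc ∫ y, φ y • (p - q) y = ∫ y in Ioi 0, φ y • (p - q) y :=
          (setIntegral_eq_integral_of_forall_compl_eq_zero fun x hx => by
            rw [hφ.eq_zero hx, zero_smul]).symm
      _ = ∫ y in Ioi 0, (p y * φ y - q y * φ y) :=
          integral_congr_ae (ae_of_all _ fun y => by
            simp only [Pi.sub_apply, smul_eq_mul]; ring)
      _ = 0 := by
          rw [integral_sub (hφ.integrableOn_mul hp) (hφ.integrableOn_mul hq), h φ hφ, sub_self]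
  rw [EventuallyEq, ae_restrict_iff' measurableSet_Ioi]
  filter_upwards [hsub] with y hy hy0 using sub_eq_zero.1 (hy hy0)

/-- Bumps: non-negative test functions of unit mass. -/
structure IsBump (s : Set ℝ) (φ : ℝ → ℝ) : Prop extends IsTest s φ where
  nonneg : ∀ x, 0 ≤ φ x
  integral_eq : ∫ x, φ x = 1

theorem IsBump.mono (h : IsBump s φ) (hst : s ⊆ t) : IsBump t φ :=
  ⟨h.toIsTest.mono hst, h.nonneg, h.integral_eq⟩

theorem IsBump.nonempty (h : IsBump s φ) : s.Nonempty := by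
  by_contra hs
  have hφ : φ = 0 := funext fun x => h.toIsTest.eq_zero fun hx => hs ⟨x, hx⟩
  simpa [hφ] using h.integral_eq

theorem exists_isBump (h : x < y) : ∃ φ, IsBump (Ioo x y) φ := by
  let f : ContDiffBump ((x + y) / 2) := ⟨(y - x) / 8, (y - x) / 4, by linarith, by linarith⟩
  refine ⟨f.normed volume, ⟨f.contDiff_normed, f.hasCompactSupport_normed, ?_⟩,
    f.nonneg_normed, f.integral_normed⟩
  rw [f.tsupport_normed_eq]
  intro z hz
  rw [Metric.mem_closedBall, Real.dist_eq, abs_le] at hz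
  have hr : f.rOut = (y - x) / 4 := rfl
  constructor <;> linarith [hz.1, hz.2]

theorem IsBump.setIntegral_eq (h : IsBump s φ) (hst : s ⊆ t) : ∫ x in t, φ x = 1 := by
  rw [← h.integral_eq]
  exact setIntegral_eq_integral_of_forall_compl_eq_zero fun x hx =>
    h.toIsTest.eq_zero fun h' => hx (hst h')

theorem IsBump.le_integral (hφ : IsBump s φ) (hs : s ⊆ Ioi 0)
    (hm : LocallyIntegrableOn m (Ioi 0)) (hc : ∀ x ∈ s, c ≤ m x) :
    c ≤ ∫ x in Ioi 0, m x * φ x := by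
  have hφ' : IsTest (Ioi 0) φ := hφ.toIsTest.mono hs
  calc c = ∫ x in Ioi 0, c * φ x := by rw [integral_const_mul, hφ.setIntegral_eq hs, mul_one]
    _ ≤ ∫ x in Ioi 0, m x * φ x := by
      refine setIntegral_mono_on (hφ'.integrableOn_mul (locallyIntegrableOn_const c))
        (hφ'.integrableOn_mul hm) measurableSet_Ioi fun x _ => ?_
      by_cases hx : x ∈ s
      · exact mul_le_mul_of_nonneg_right (hc x hx) (hφ.nonneg x)
      · simp only [hφ.toIsTest.eq_zero hx, mul_zero, le_refl]

theorem IsBump.integral_le (hφ : IsBump s φ) (hs : s ⊆ Ioi 0)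
    (hm : LocallyIntegrableOn m (Ioi 0)) (hc : ∀ x ∈ s, m x ≤ c) :
    ∫ x in Ioi 0, m x * φ x ≤ c := by
  have := hφ.le_integral hs hm.neg (c := -c) fun x hx => neg_le_neg (hc x hx)
  simp only [Pi.neg_apply, neg_mul, integral_neg] at this
  linarith

theorem IsBump.integral_le_apply (hφ : IsBump (Ioi y) φ) (hy : 0 < y)
    (hm : AntitoneOn m (Ioi 0)) : ∫ x in Ioi 0, m x * φ x ≤ m y :=
  hφ.integral_le (Ioi_subset_Ioi hy.le) (locallyIntegrableOn_of_antitoneOn hm) fun _ hx =>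
    hm hy (hy.trans hx) (le_of_lt hx)

theorem IsBump.apply_le_integral (hφ : IsBump (Ioo x y) φ) (hx : 0 < x)
    (hm : AntitoneOn m (Ioi 0)) : m y ≤ ∫ x in Ioi 0, m x * φ x :=
  hφ.le_integral (fun _ hz => hx.trans hz.1) (locallyIntegrableOn_of_antitoneOn hm) fun _ hz =>
    hm (hx.trans hz.1) (hx.trans (hz.1.trans hz.2)) hz.2.le

end TestFunctions

section AntitoneLimit

/-- The functions `m n` converge to the functional `L` in the sense of distributions on
`(0, ∞)`. -/
def TendstoDistrib (m : ℕ → ℝ → ℝ) (L : (ℝ → ℝ) → ℝ) : Prop :=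
  ∀ φ, IsTest (Ioi 0) φ → Tendsto (fun n => ∫ y in Ioi 0, m n y * φ y) atTop (𝓝 (L φ))

/-- The supremum of `L` over the bumps living to the right of `y`. If `L` is a limit of antitone
functions, then this is the right continuous function representing `L`. -/
noncomputable def bumpSup (L : (ℝ → ℝ) → ℝ) (y : ℝ) : ℝ :=
  sSup (L '' {φ | IsBump (Ioi y) φ})

variable {m : ℕ → ℝ → ℝ} {L : (ℝ → ℝ) → ℝ} {φ χ : ℝ → ℝ} {x y : ℝ}

theorem nonempty_bump_image (L : (ℝ → ℝ) → ℝ) (y : ℝ) : (L '' {φ | IsBump (Ioi y) φ}).Nonempty :=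
  let ⟨φ, hφ⟩ := exists_isBump (lt_add_one y)
  ⟨L φ, φ, hφ.mono Ioo_subset_Ioi_self, rfl⟩

theorem apply_le_apply_of_isBump (hm : ∀ n, AntitoneOn (m n) (Ioi 0)) (hL : TendstoDistrib m L)
    (hx : 0 < x) (hφ : IsBump (Ioo x y) φ) (hχ : IsBump (Ioi y) χ) : L χ ≤ L φ := by
  obtain ⟨z, hxz, hzy⟩ := hφ.nonempty
  have hy : 0 < y := hx.trans (hxz.trans hzy)
  exact le_of_tendsto_of_tendsto' (hL χ (hχ.toIsTest.mono (Ioi_subset_Ioi hy.le)))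
    (hL φ (hφ.toIsTest.mono fun z hz => hx.trans hz.1)) fun n =>
      (hχ.integral_le_apply hy (hm n)).trans (hφ.apply_le_integral hx (hm n))

theorem apply_le_bumpSup (hm : ∀ n, AntitoneOn (m n) (Ioi 0)) (hL : TendstoDistrib m L)
    (hy : 0 < y) (hφ : IsBump (Ioi y) φ) : L φ ≤ bumpSup L y := by
  obtain ⟨χ, hχ⟩ := exists_isBump (half_lt_self hy)
  refine le_csSup ⟨L χ, ?_⟩ ⟨φ, hφ, rfl⟩
  rintro _ ⟨φ', hφ', rfl⟩
  exact apply_le_apply_of_isBump hm hL (half_pos hy) hχ hφ'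

theorem exists_isBump_lt_apply {c : ℝ} (hc : c < bumpSup L y) :
    ∃ φ, IsBump (Ioi y) φ ∧ c < L φ := by
  obtain ⟨_, ⟨φ, hφ, rfl⟩, hr⟩ := exists_lt_of_lt_csSup (nonempty_bump_image L y) hc
  exact ⟨φ, hφ, hr⟩

theorem antitoneOn_bumpSup (hm : ∀ n, AntitoneOn (m n) (Ioi 0)) (hL : TendstoDistrib m L) :
    AntitoneOn (bumpSup L) (Ioi 0) := fun x hx y _ hxy => by
  refine csSup_le (nonempty_bump_image L y) ?_
  rintro _ ⟨φ, hφ, rfl⟩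
  exact apply_le_bumpSup hm hL hx (hφ.mono (Ioi_subset_Ioi hxy))

theorem continuousWithinAt_bumpSup (hm : ∀ n, AntitoneOn (m n) (Ioi 0)) (hL : TendstoDistrib m L)
    (hy : 0 < y) : ContinuousWithinAt (bumpSup L) (Ici y) y := by
  rw [Metric.continuousWithinAt_iff']
  intro e he
  obtain ⟨φ, hφ, hlt⟩ := exists_isBump_lt_apply (sub_lt_self (bumpSup L y) he)
  obtain ⟨a, b, hya, -, hab⟩ := hφ.toIsTest.exists_Icc
  filter_upwards [Ico_mem_nhdsGE hya] with x hx
  have hx0 : 0 < x := hy.trans_le hx.1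
  have hφx : IsBump (Ioi x) φ :=
    ⟨⟨hφ.smooth, hφ.compact, fun z hz => hx.2.trans_le (hab hz).1⟩, hφ.nonneg, hφ.integral_eq⟩
  have lower := apply_le_bumpSup hm hL hx0 hφx
  have upper := antitoneOn_bumpSup hm hL hy hx0 hx.1
  rw [Real.dist_eq, abs_lt]
  constructor <;> linarith

theorem tendsto_bumpSup_of_continuousAt (hm : ∀ n, AntitoneOn (m n) (Ioi 0))
    (hL : TendstoDistrib m L) (hy : 0 < y) (hcont : ContinuousAt (bumpSup L) y) :
    Tendsto (fun n => m n y) atTop (𝓝 (bumpSup L y)) := by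
  refine tendsto_order.2 ⟨fun c hc => ?_, fun c hc => ?_⟩
  · obtain ⟨φ, hφ, hlt⟩ := exists_isBump_lt_apply hc
    filter_upwards [(hL φ (hφ.toIsTest.mono (Ioi_subset_Ioi hy.le))).eventually_const_lt hlt]
      with n hn
    exact hn.trans_le (hφ.integral_le_apply hy (hm n))
  · have hev : ∀ᶠ x in 𝓝[<] y, bumpSup L x < c :=
      nhdsWithin_le_nhds (hcont.eventually_lt_const hc)
    obtain ⟨x, hxc, hx⟩ := (hev.and (Ioo_mem_nhdsLT hy)).exists
    obtain ⟨φ, hφ⟩ := exists_isBump hx.2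
    have hlt : L φ < c :=
      (apply_le_bumpSup hm hL hx.1 (hφ.mono Ioo_subset_Ioi_self)).trans_lt hxc
    filter_upwards [(hL φ (hφ.toIsTest.mono fun z hz => hx.1.trans hz.1)).eventually_lt_const hlt]
      with n hn
    exact (hφ.apply_le_integral hx.1 (hm n)).trans_lt hn

theorem ae_tendsto_bumpSup (hm : ∀ n, AntitoneOn (m n) (Ioi 0)) (hL : TendstoDistrib m L) :
    ∀ᵐ y ∂volHalf, Tendsto (fun n => m n y) atTop (𝓝 (bumpSup L y)) := by
  have hcountable := (antitoneOn_bumpSup hm hL).countable_not_continuousWithinAt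
  filter_upwards [ae_restrict_mem measurableSet_Ioi, ae_restrict_of_ae
    (measure_eq_zero_iff_ae_notMem.1 (hcountable.measure_zero volume))] with y hy hcont
  refine tendsto_bumpSup_of_continuousAt hm hL hy ?_
  exact (not_not.1 fun h => hcont ⟨hy, h⟩).continuousAt (Ioi_mem_nhds hy)

theorem tendsto_integral_mul_of_antitoneOn {G : ℝ → ℝ} (hm : ∀ n, AntitoneOn (m n) (Ioi 0))
    (hlim : ∀ᵐ y ∂volHalf, Tendsto (fun n => m n y) atTop (𝓝 (G y))) (hφ : IsTest (Ioi 0) φ) :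
    Tendsto (fun n => ∫ y in Ioi 0, m n y * φ y) atTop (𝓝 (∫ y in Ioi 0, G y * φ y)) := by
  obtain ⟨a, b, ha, hab, hsupp⟩ := hφ.exists_Icc
  have hgood : ∀ c d : ℝ, 0 ≤ c → c < d → ∃ x ∈ Ioo c d, Tendsto (fun n => m n x) atTop (𝓝 (G x)) :=
    fun c d hc hcd => by
      have hae := ae_restrict_of_ae_restrict_of_subset
        (Ioo_subset_Ioi_self.trans (Ioi_subset_Ioi hc) : Ioo c d ⊆ Ioi 0) hlim
      have : (volume.restrict (Ioo c d)) ≠ 0 := by simp [hcd]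
      have : (ae (volume.restrict (Ioo c d))).NeBot := ae_neBot.2 this
      obtain ⟨x, hx, hx'⟩ := (hae.and (ae_restrict_mem measurableSet_Ioo)).exists
      exact ⟨x, hx', hx⟩
  obtain ⟨α, hα, hαlim⟩ := hgood 0 a le_rfl ha
  obtain ⟨β, hβ, hβlim⟩ := hgood b (b + 1) (ha.le.trans hab.le) (lt_add_one b)
  have hβ0 : 0 < β := ha.trans (hab.trans hβ.1)
  obtain ⟨C₁, hC₁⟩ := hαlim.bddAbove_range
  obtain ⟨C₂, hC₂⟩ := hβlim.bddBelow_range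
  have hbound : ∀ n, ∀ y ∈ Icc a b, |m n y| ≤ max |C₂| |C₁| := fun n y hy =>
    have hy0 : 0 < y := ha.trans_le hy.1
    abs_le_max_abs_abs (le_trans (hC₂ ⟨n, rfl⟩) (hm n hy0 hβ0 (hy.2.trans hβ.1.le)))
      ((hm n hα.1 hy0 (hα.2.le.trans hy.1)).trans (hC₁ ⟨n, rfl⟩))
  refine tendsto_integral_of_dominated_convergence (fun y => max |C₂| |C₁| * |φ y|)
    (fun n => (hφ.integrableOn_mul
      (locallyIntegrableOn_of_antitoneOn (hm n))).aestronglyMeasurable) ?_ (fun n => ?_) ?_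
  · exact ((hφ.smooth.continuous.abs.integrable_of_hasCompactSupport
      hφ.compact.norm).const_mul _).integrableOn
  · refine ae_of_all _ fun y => ?_
    by_cases hy : y ∈ Icc a b
    · rw [norm_mul]
      exact mul_le_mul_of_nonneg_right (hbound n y hy) (abs_nonneg _)
    · simp [image_eq_zero_of_notMem_tsupport fun h' => hy (hsupp h')]
  · filter_upwards [hlim] with y hy using hy.mul_const _

theorem apply_eq_integral_bumpSup (hm : ∀ n, AntitoneOn (m n) (Ioi 0)) (hL : TendstoDistrib m L)
    (hφ : IsTest (Ioi 0) φ) : L φ = ∫ y in Ioi 0, bumpSup L y * φ y :=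
  tendsto_nhds_unique (hL φ hφ)
    (tendsto_integral_mul_of_antitoneOn hm (ae_tendsto_bumpSup hm hL) hφ)

end AntitoneLimit

section BV

variable {α : Type*} [LinearOrder α] {V : Type*} [NormedAddCommGroup V]

theorem eVariationOn_sub_le (f g : α → V) (s : Set α) :
    eVariationOn (f - g) s ≤ eVariationOn f s + eVariationOn g s := by
  refine iSup_le ?_
  rintro ⟨n, ⟨u, hu, us⟩⟩
  calc ∑ i ∈ Finset.range n, edist ((f - g) (u (i + 1))) ((f - g) (u i))
      ≤ ∑ i ∈ Finset.range n, (edist (f (u (i + 1))) (f (u i))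
          + edist (g (u (i + 1))) (g (u i))) := by
        refine Finset.sum_le_sum fun i _ => ?_
        simp only [edist_eq_enorm_sub, Pi.sub_apply]
        rw [sub_sub_sub_comm]
        exact enorm_sub_le
    _ ≤ eVariationOn f s + eVariationOn g s := by
        rw [Finset.sum_add_distrib]
        exact add_le_add (eVariationOn.sum_le hu us) (eVariationOn.sum_le hu us)

theorem boundedVariationOn_sub {f g : α → V} {s : Set α} (hf : BoundedVariationOn f s)
    (hg : BoundedVariationOn g s) : BoundedVariationOn (f - g) s :=
  ((eVariationOn_sub_le f g s).trans_lt (ENNReal.add_lt_top.2 ⟨hf.lt_top, hg.lt_top⟩)).ne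

theorem IsBV.sub {v w : ℝ → V} (hv : IsBV v) (hw : IsBV w) : IsBV (v - w) where
  bounded := by
    obtain ⟨C, hC⟩ := hv.bounded
    obtain ⟨D, hD⟩ := hw.bounded
    exact ⟨C + D, fun t ht => (norm_sub_le _ _).trans (add_le_add (hC t ht) (hD t ht))⟩
  variation T := boundedVariationOn_sub (hv.variation T) (hw.variation T)
  right_continuous t ht := (hv.right_continuous t ht).sub (hw.right_continuous t ht)

theorem isBV_const (c : V) : IsBV fun _ : ℝ => c where
  bounded := ⟨‖c‖, fun _ _ => le_rfl⟩
  variation T := by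
    rw [BoundedVariationOn, eVariationOn.constant_on]
    · exact ENNReal.zero_ne_top
    · rintro _ ⟨x, -, rfl⟩ _ ⟨y, -, rfl⟩; rfl
  right_continuous _ _ := continuousWithinAt_const

theorem IsBV.integrableOn {θ : ℝ → ℝ} (hθ : IsBV θ) {T₁ T₂ : ℝ} (h0 : 0 ≤ T₁) :
    IntegrableOn θ (Ioc T₁ T₂) := by
  have hsub : Ioc T₁ T₂ ⊆ Ioo 0 (T₂ + 1) := fun t ht => ⟨h0.trans_lt ht.1, by linarith [ht.2]⟩
  refine IntegrableOn.mono_set ?_ hsub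
  simpa only [mul_one] using integrableOn_mul_of_boundedVariationOn measurableSet_Ioo
    (hθ.variation (T₂ + 1)) (integrableOn_const (C := (1 : ℝ)) measure_Ioo_lt_top.ne)

theorem IsBV.locallyIntegrableOn {θ : ℝ → ℝ} (hθ : IsBV θ) : LocallyIntegrableOn θ (Ioi 0) :=
  (locallyIntegrableOn_iff isOpen_Ioi.isLocallyClosed).2 fun k hk hkc => by
    obtain ⟨T, hT⟩ := hkc.bddAbove
    exact (hθ.integrableOn le_rfl).mono_set fun x hx => ⟨hk hx, hT hx⟩

end BV

section RightContinuous

variable {G G' : ℝ → ℝ} {C t : ℝ}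

theorem frequently_nhdsGE_of_ae {p : ℝ → Prop} (h : ∀ᵐ x ∂volHalf, p x) (ht : 0 < t) :
    ∃ᶠ x in 𝓝[≥] t, p x := by
  rw [ae_restrict_iff' measurableSet_Ioi] at h
  intro hn
  obtain ⟨δ, hδ, hsub⟩ := mem_nhdsGT_iff_exists_Ioo_subset.1
    (nhdsWithin_mono t Ioi_subset_Ici_self hn)
  have hnull : volume (Ioo t δ) = 0 :=
    measure_mono_null (fun x hx => fun hpx : 0 < x → p x => hsub hx (hpx (ht.trans hx.1)))
      (ae_iff.1 h)
  rw [Real.volume_Ioo, ENNReal.ofReal_eq_zero, sub_nonpos] at hnull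
  exact hnull.not_gt hδ

theorem le_of_ae_le_of_continuousWithinAt_Ici (hG : ContinuousWithinAt G (Ici t) t)
    (hG' : ContinuousWithinAt G' (Ici t) t) (h : G ≤ᵐ[volHalf] G') (ht : 0 < t) : G t ≤ G' t :=
  le_of_tendsto_of_tendsto_of_frequently hG hG' (frequently_nhdsGE_of_ae h ht)

theorem eq_of_ae_eq_of_continuousWithinAt_Ici (hG : ContinuousWithinAt G (Ici t) t)
    (hG' : ContinuousWithinAt G' (Ici t) t) (h : G =ᵐ[volHalf] G') (ht : 0 < t) : G t = G' t :=
  (le_of_ae_le_of_continuousWithinAt_Ici hG hG' h.le ht).antisymm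
    (le_of_ae_le_of_continuousWithinAt_Ici hG' hG h.symm.le ht)

theorem exists_tendsto_atTop_of_antitoneOn (hG : AntitoneOn G (Ioi 0))
    (hC : ∀ y, 0 < y → C ≤ G y) : ∃ l, Tendsto G atTop (𝓝 l) ∧ C ≤ l := by
  have hanti : Antitone fun y => G (max y 1) := fun x y hxy =>
    hG (by simp : (0 : ℝ) < max x 1) (by simp : (0 : ℝ) < max y 1) (max_le_max_right 1 hxy)
  have hlim := tendsto_atTop_ciInf hanti ⟨C, by
    rintro _ ⟨y, rfl⟩
    exact hC _ (by simp)⟩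
  refine ⟨_, hlim.congr' ?_, le_ciInf fun y => hC _ (by simp)⟩
  filter_upwards [eventually_ge_atTop 1] with y hy
  rw [max_eq_left hy]

end RightContinuous

/-- `G` is right continuous on `(0, ∞)` and increases there at most at the rate `c`. -/
structure AlmostAntitone (G : ℝ → ℝ) (c : ℝ) : Prop where
  antitoneOn : AntitoneOn (fun y => G y - c * y) (Ioi 0)
  right_continuous : ∀ t, 0 < t → ContinuousWithinAt G (Ici t) t

namespace AlmostAntitone

variable {G : ℝ → ℝ} {c C : ℝ}

theorem monotoneOn_abs (h : AlmostAntitone G c) : MonotoneOn (fun y => |c| * y - G y) (Ioi 0) :=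
  fun x hx y hy hxy => by
    have hanti := h.antitoneOn hx hy hxy
    have hrate := mul_le_mul_of_nonneg_right (le_abs_self c) (sub_nonneg.2 hxy)
    simp only at hanti ⊢
    linarith

theorem locallyIntegrableOn (h : AlmostAntitone G c) : LocallyIntegrableOn G (Ioi 0) := by
  have hlin : LocallyIntegrableOn (fun y : ℝ => c * y) (Ioi 0) :=
    (continuous_const_mul c).locallyIntegrable.locallyIntegrableOn _
  have hG : G = (fun y => G y - c * y) + fun y => c * y := by ext y; simp
  rw [hG]
  exact (locallyIntegrableOn_of_antitoneOn h.antitoneOn).add hlin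

theorem isBV (h : AlmostAntitone G c) (hC : ∀ y, 0 < y → |G y| ≤ C) : IsBV G where
  bounded := ⟨C, hC⟩
  variation T := by
    have hlin : ∀ y ∈ Ioo 0 T, |(|c| * y)| ≤ |c| * T := fun y hy => by
      rw [abs_mul, abs_abs, abs_of_pos hy.1]
      exact mul_le_mul_of_nonneg_left hy.2.le (abs_nonneg c)
    have hcy : BoundedVariationOn (fun y => |c| * y) (Ioo 0 T) :=
      MonotoneOn.boundedVariationOn
        (fun _ _ _ _ hxy => mul_le_mul_of_nonneg_left hxy (abs_nonneg c)) hlin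
    have hcG : BoundedVariationOn (fun y => |c| * y - G y) (Ioo 0 T) :=
      (h.monotoneOn_abs.mono Ioo_subset_Ioi_self).boundedVariationOn (C := |c| * T + C)
        fun y hy => (abs_sub _ _).trans (add_le_add (hlin y hy) (hC y hy.1))
    have hG : G = (fun y => |c| * y) - fun y => |c| * y - G y := by ext y; simp
    rw [hG]
    exact boundedVariationOn_sub hcy hcG
  right_continuous := h.right_continuous

theorem exists_tendsto_nhdsGT (h : AlmostAntitone G c) (hC : ∀ y, 0 < y → |G y| ≤ C) :
    ∃ l, Tendsto G (𝓝[>] 0) (𝓝 l) := by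
  have hmono := h.monotoneOn_abs.tendsto_nhdsGT ⟨-C, by
    rintro _ ⟨y, hy, rfl⟩
    have hcy := mul_nonneg (abs_nonneg c) (le_of_lt (mem_Ioi.1 hy))
    have hGy := (abs_le.1 (hC y hy)).2
    simp only
    linarith⟩
  have hlin : Tendsto (fun y : ℝ => |c| * y) (𝓝[>] 0) (𝓝 (|c| * 0)) :=
    tendsto_nhdsWithin_of_tendsto_nhds (by fun_prop : Continuous fun y : ℝ => |c| * y).continuousAt
  exact ⟨_, (hlin.sub hmono).congr fun y => by ring⟩

end AlmostAntitone

theorem exists_almostAntitone_limit {h : ℕ → ℝ → ℝ} {c : ℕ → ℝ} {c₀ : ℝ} {L : (ℝ → ℝ) → ℝ}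
    (hc : Tendsto c atTop (𝓝 c₀)) (hh : ∀ n, AntitoneOn (fun y => h n y - c n * y) (Ioi 0))
    (hL : TendstoDistrib h L) :
    ∃ G : ℝ → ℝ, AlmostAntitone G c₀ ∧
      (∀ᵐ y ∂volHalf, Tendsto (fun n => h n y) atTop (𝓝 (G y))) ∧
      ∀ φ, IsTest (Ioi 0) φ → L φ = ∫ y in Ioi 0, G y * φ y := by
  have hlin : LocallyIntegrableOn (fun y : ℝ => y) (Ioi 0) :=
    continuous_id.locallyIntegrable.locallyIntegrableOn _
  set L' : (ℝ → ℝ) → ℝ := fun φ => L φ - c₀ * ∫ y in Ioi 0, y * φ y with hL'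
  have split : ∀ {m : ℝ → ℝ} {d : ℝ} {φ : ℝ → ℝ}, AntitoneOn m (Ioi 0) → IsTest (Ioi 0) φ →
      ∫ y in Ioi 0, (m y + d * y) * φ y
        = (∫ y in Ioi 0, m y * φ y) + d * ∫ y in Ioi 0, y * φ y := fun {m d φ} hm hφ => by
    rw [← integral_const_mul, ← integral_add (hφ.integrableOn_mul
      (locallyIntegrableOn_of_antitoneOn hm)) ((hφ.integrableOn_mul hlin).const_mul d)]
    exact integral_congr_ae (ae_of_all _ fun y => by ring)
  have hdistrib : TendstoDistrib (fun n y => h n y - c n * y) L' := fun φ hφ => by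
    refine ((hL φ hφ).sub (hc.mul_const _)).congr fun n => ?_
    rw [sub_eq_iff_eq_add, ← split (hh n) hφ]
    simp only [sub_add_cancel]
  have hanti := antitoneOn_bumpSup hh hdistrib
  refine ⟨fun y => bumpSup L' y + c₀ * y, ⟨by simpa only [add_sub_cancel_right] using hanti,
    fun t ht => (continuousWithinAt_bumpSup hh hdistrib ht).add (by fun_prop)⟩, ?_, fun φ hφ => ?_⟩
  · filter_upwards [ae_tendsto_bumpSup hh hdistrib] with y hy
    exact (hy.add (hc.mul_const y)).congr fun n => by ring
  · rw [split hanti hφ, ← apply_eq_integral_bumpSup hh hdistrib hφ, hL', sub_add_cancel]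

section ParametricIntegrals

variable {P P' : ℝ × ℝ → ℝ} {ψ : ℝ → ℝ} {s : Set ℝ} {a b x : ℝ}

theorem intervalIntegrable_mul_of_continuousOn_prod (hP : ContinuousOn P (s ×ˢ Icc a b))
    (hab : a ≤ b) (hψ : IntervalIntegrable ψ volume a b) (hx : x ∈ s) :
    IntervalIntegrable (fun t => P (x, t) * ψ t) volume a b := by
  refine hψ.continuousOn_mul ?_
  rw [uIcc_of_le hab]
  exact hP.comp (by fun_prop) fun t ht => ⟨hx, ht⟩

theorem continuousOn_integral_mul (hs : IsClosed s) (hP : ContinuousOn P (s ×ˢ Icc a b))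
    (hab : a ≤ b) (hψ : IntervalIntegrable ψ volume a b) :
    ContinuousOn (fun x => ∫ t in a..b, P (x, t) * ψ t) s := by
  intro x₀ hx₀
  obtain ⟨C, hC⟩ := (((isCompact_closedBall x₀ 1).inter_right hs).prod
    isCompact_Icc).exists_bound_of_continuousOn (hP.mono (prod_mono_left inter_subset_right))
  refine intervalIntegral.continuousWithinAt_of_dominated_interval (bound := fun t => C * ‖ψ t‖)
    ?_ ?_ (hψ.norm.const_mul C) ?_
  · filter_upwards [self_mem_nhdsWithin] with x hx
    exact (intervalIntegrable_mul_of_continuousOn_prod hP hab hψ hx).def'.aestronglyMeasurable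
  · filter_upwards [self_mem_nhdsWithin,
      nhdsWithin_le_nhds (Metric.closedBall_mem_nhds x₀ one_pos)] with x hx hx'
    refine ae_of_all _ fun t ht => ?_
    rw [uIoc_of_le hab] at ht
    rw [norm_mul]
    exact mul_le_mul_of_nonneg_right (hC (x, t) ⟨⟨hx', hx⟩, Ioc_subset_Icc_self ht⟩)
      (norm_nonneg _)
  · refine ae_of_all _ fun t ht => ?_
    rw [uIoc_of_le hab] at ht
    have ht' := Ioc_subset_Icc_self ht
    exact ((hP _ ⟨hx₀, ht'⟩).comp (f := fun x => (x, t)) (by fun_prop)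
      fun x hx => ⟨hx, ht'⟩).mul_const _

theorem hasDerivAt_integral_mul (hs : IsOpen s) (hP : ContinuousOn P (s ×ˢ Icc a b))
    (hP' : ContinuousOn P' (s ×ˢ Icc a b))
    (hd : ∀ x ∈ s, ∀ t ∈ Icc a b, HasDerivAt (fun z => P (z, t)) (P' (x, t)) x) (hab : a ≤ b)
    (hψ : IntervalIntegrable ψ volume a b) (hx : x ∈ s) :
    HasDerivAt (fun z => ∫ t in a..b, P (z, t) * ψ t) (∫ t in a..b, P' (x, t) * ψ t) x := by
  obtain ⟨δ, hδ, hball⟩ := Metric.nhds_basis_closedBall.mem_iff.1 (hs.mem_nhds hx)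
  obtain ⟨C, hC⟩ := ((isCompact_closedBall x δ).prod isCompact_Icc).exists_bound_of_continuousOn
    (hP'.mono (prod_mono_left hball))
  refine (intervalIntegral.hasDerivAt_integral_of_dominated_loc_of_deriv_le
    (bound := fun t => C * ‖ψ t‖) (F' := fun z t => P' (z, t) * ψ t)
    (Metric.closedBall_mem_nhds x hδ) ?_
    (intervalIntegrable_mul_of_continuousOn_prod hP hab hψ hx)
    (intervalIntegrable_mul_of_continuousOn_prod hP' hab hψ hx).def'.aestronglyMeasurable
    ?_ (hψ.norm.const_mul C) ?_).2
  · filter_upwards [hs.mem_nhds hx] with z hz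
    exact (intervalIntegrable_mul_of_continuousOn_prod hP hab hψ hz).def'.aestronglyMeasurable
  · refine ae_of_all _ fun t ht z hz => ?_
    rw [uIoc_of_le hab] at ht
    rw [norm_mul]
    exact mul_le_mul_of_nonneg_right (hC (z, t) ⟨hz, Ioc_subset_Icc_self ht⟩) (norm_nonneg _)
  · refine ae_of_all _ fun t ht z hz => ?_
    rw [uIoc_of_le hab] at ht
    exact (hd z (hball hz) t (Ioc_subset_Icc_self ht)).mul_const _

theorem continuousOn_of_hasDerivAt_fst {S : Set (ℝ × ℝ)} (hS : IsOpen S)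
    (hP : ContDiffOn ℝ 1 P S) (hd : ∀ p ∈ S, HasDerivAt (fun z => P (z, p.2)) (P' p) p.1) :
    ContinuousOn P' S := by
  refine ((hP.continuousOn_fderiv_of_isOpen hS le_rfl).clm_apply
    (continuousOn_const (c := ((1 : ℝ), (0 : ℝ))))).congr fun p hp => ?_
  have hline : HasDerivAt (fun z : ℝ => (z, p.2)) ((1 : ℝ), (0 : ℝ)) p.1 :=
    (hasDerivAt_id p.1).prodMk (hasDerivAt_const p.1 p.2)
  have hPp : HasFDerivAt P (fderiv ℝ P p) (p.1, p.2) :=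
    (hP.differentiableOn one_ne_zero).hasFDerivAt (hS.mem_nhds hp)
  exact (hd p hp).unique (hPp.comp_hasDerivAt p.1 hline)

end ParametricIntegrals

section ViscousSolutions

variable {N : ℕ} {𝒰 : Set (State N)} {f : State N → State N} {ε : ℝ} {uI uB : ℝ → State N}
  {u : ℝ → ℝ → State N} {U F : State N → ℝ} {ψ : ℝ → ℝ} {a b x t : ℝ}

/-- The space derivative of `u`, one-sided at `x = 0`. -/
noncomputable def spaceDeriv (u : ℝ → ℝ → State N) (x t : ℝ) : State N :=
  fderivWithin ℝ (fun p : ℝ × ℝ => u p.1 p.2) (Ici 0 ×ˢ Ioi 0) (x, t) (1, 0)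

/-- Time average of `g(u(x, ·))` against the weight `ψ`. -/
noncomputable def solAvg (u : ℝ → ℝ → State N) (g : State N → ℝ) (ψ : ℝ → ℝ) (a b x : ℝ) : ℝ :=
  ∫ t in a..b, g (u x t) * ψ t

/-- Time average of the viscous entropy flux `F(u) - ε ∂ₓU(u)` against the weight `ψ`. -/
noncomputable def viscFlux (ε : ℝ) (u : ℝ → ℝ → State N) (U F : State N → ℝ) (ψ : ℝ → ℝ)
    (a b x : ℝ) : ℝ :=
  ∫ t in a..b, (F (u x t) - ε * fderiv ℝ U (u x t) (spaceDeriv u x t)) * ψ t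

/-- The weight `ψ` is integrable on `[a, b]` and its distributional derivative there, boundary
masses included, has total mass at most `M`. -/
structure PairingBound (ψ : ℝ → ℝ) (a b M : ℝ) : Prop where
  integrable : IntervalIntegrable ψ volume a b
  bound : ∀ g g' : ℝ → ℝ, (∀ t ∈ Icc a b, HasDerivAt g (g' t) t) → ContinuousOn g' (Icc a b) →
    ∀ B, (∀ t ∈ Icc a b, |g t| ≤ B) → |∫ t in a..b, ψ t * g' t| ≤ M * B

theorem uniqueDiffOn_quarter : UniqueDiffOn ℝ (Ici (0 : ℝ) ×ˢ Ioi (0 : ℝ)) :=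
  (uniqueDiffOn_Ici 0).prod isOpen_Ioi.uniqueDiffOn

theorem quarter_mem_nhds (hx : 0 < x) (ht : 0 < t) : Ici (0 : ℝ) ×ˢ Ioi (0 : ℝ) ∈ 𝓝 (x, t) :=
  prod_mem_nhds (Ici_mem_nhds hx) (Ioi_mem_nhds ht)

theorem Icc_subset_Ioi_zero (ha : 0 < a) : Icc a b ⊆ Ioi 0 := fun _ ht => ha.trans_le ht.1

namespace IsViscousSolution

theorem mapsTo (hu : IsViscousSolution 𝒰 f ε uI uB u) :
    MapsTo (fun p : ℝ × ℝ => u p.1 p.2) (Ici 0 ×ˢ Ioi 0) 𝒰 :=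
  fun p hp => hu.mem p.1 p.2 hp.1 (le_of_lt hp.2)

theorem contDiffOn_spaceDeriv (hu : IsViscousSolution 𝒰 f ε uI uB u) :
    ContDiffOn ℝ 1 (fun p : ℝ × ℝ => spaceDeriv u p.1 p.2) (Ici 0 ×ˢ Ioi 0) :=
  (hu.contDiffOn.fderivWithin (m := 1) uniqueDiffOn_quarter (by norm_num)).clm_apply
    contDiffOn_const

theorem contDiffOn_fderiv_comp (hu : IsViscousSolution 𝒰 f ε uI uB u) (h𝒰 : IsOpen 𝒰)
    (hU : ContDiffOn ℝ 2 U 𝒰) :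
    ContDiffOn ℝ 1 (fun p : ℝ × ℝ => fderiv ℝ U (u p.1 p.2) (spaceDeriv u p.1 p.2))
      (Ici 0 ×ˢ Ioi 0) :=
  ((hU.fderiv_of_isOpen (m := 1) h𝒰 (by norm_num)).comp
    (hu.contDiffOn.of_le (by norm_num)) hu.mapsTo).clm_apply hu.contDiffOn_spaceDeriv

theorem contDiffOn_flux (hu : IsViscousSolution 𝒰 f ε uI uB u) (h𝒰 : IsOpen 𝒰)
    (hUF : IsEntropyPair 𝒰 f U F) :
    ContDiffOn ℝ 1 (fun p : ℝ × ℝ => F (u p.1 p.2)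
      - ε * fderiv ℝ U (u p.1 p.2) (spaceDeriv u p.1 p.2)) (Ici 0 ×ˢ Ioi 0) :=
  ((hUF.contDiffOn_flux.comp hu.contDiffOn hu.mapsTo).of_le (by norm_num)).sub
    (contDiffOn_const.mul (hu.contDiffOn_fderiv_comp h𝒰 hUF.contDiffOn_entropy))

theorem contDiffOn_time (hu : IsViscousSolution 𝒰 f ε uI uB u) (hx : 0 ≤ x) :
    ContDiffOn ℝ 2 (fun s => u x s) (Ioi 0) :=
  hu.contDiffOn.comp (f := fun s : ℝ => (x, s)) (by fun_prop) fun s hs => ⟨hx, hs⟩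

theorem hasDerivAt_time (hu : IsViscousSolution 𝒰 f ε uI uB u) (hx : 0 ≤ x) (ht : 0 < t) :
    HasDerivAt (fun s => u x s) (deriv (fun s => u x s) t) t :=
  ((hu.contDiffOn_time hx).differentiableOn two_ne_zero).hasDerivAt (Ioi_mem_nhds ht)

theorem hasDerivAt_space (hu : IsViscousSolution 𝒰 f ε uI uB u) (hx : 0 < x) (ht : 0 < t) :
    HasDerivAt (fun z => u z t) (spaceDeriv u x t) x := by
  have hup : HasFDerivAt (fun p : ℝ × ℝ => u p.1 p.2) _ (x, t) :=
    ((hu.contDiffOn.differentiableOn two_ne_zero (x, t)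
      ⟨hx.le, ht⟩).hasFDerivWithinAt).hasFDerivAt (quarter_mem_nhds hx ht)
  have hline : HasDerivAt (fun z : ℝ => (z, t)) ((1 : ℝ), (0 : ℝ)) x :=
    (hasDerivAt_id x).prodMk (hasDerivAt_const x t)
  exact hup.comp_hasDerivAt x hline

theorem hasDerivAt_spaceDeriv (hu : IsViscousSolution 𝒰 f ε uI uB u) (hx : 0 < x) (ht : 0 < t) :
    HasDerivAt (fun z => spaceDeriv u z t) (deriv (deriv fun z => u z t) x) x := by
  have hdiff : DifferentiableAt ℝ (fun z => spaceDeriv u z t) x :=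
    ((hu.contDiffOn_spaceDeriv.differentiableOn one_ne_zero).differentiableAt
      (quarter_mem_nhds hx ht)).comp (f := fun z : ℝ => (z, t)) x (by fun_prop)
  have heq : (deriv fun z => u z t) =ᶠ[𝓝 x] fun z => spaceDeriv u z t := by
    filter_upwards [Ioi_mem_nhds hx] with z hz using (hu.hasDerivAt_space hz ht).deriv
  rw [heq.deriv_eq]
  exact hdiff.hasDerivAt

theorem entropy_balance (hu : IsViscousSolution 𝒰 f ε uI uB u) (h𝒰 : IsOpen 𝒰)
    (hf : DifferentiableOn ℝ f 𝒰) (hUF : IsEntropyPair 𝒰 f U F) (hx : 0 < x) (ht : 0 < t) :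
    fderiv ℝ U (u x t) (deriv (fun s => u x s) t) + fderiv ℝ F (u x t) (spaceDeriv u x t)
      = ε * fderiv ℝ U (u x t) (deriv (deriv fun z => u z t) x) := by
  have hm : u x t ∈ 𝒰 := hu.mem x t hx.le ht.le
  have hfx : HasDerivAt (fun z => f (u z t)) (fderiv ℝ f (u x t) (spaceDeriv u x t)) x :=
    (hf.hasFDerivAt (h𝒰.mem_nhds hm)).comp_hasDerivAt x (hu.hasDerivAt_space hx ht)
  rw [hUF.compatible _ hm, ContinuousLinearMap.comp_apply, ← map_add, ← hfx.deriv,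
    hu.equation x t hx ht, map_smul, smul_eq_mul]

theorem hasDerivAt_flux (hu : IsViscousSolution 𝒰 f ε uI uB u) (h𝒰 : IsOpen 𝒰)
    (hf : DifferentiableOn ℝ f 𝒰) (hUF : IsEntropyPair 𝒰 f U F) (hx : 0 < x) (ht : 0 < t) :
    HasDerivAt (fun z => F (u z t) - ε * fderiv ℝ U (u z t) (spaceDeriv u z t))
      (-deriv (fun s => U (u x s)) t
        - ε * fderiv ℝ (fderiv ℝ U) (u x t) (spaceDeriv u x t) (spaceDeriv u x t)) x := by
  have hn := h𝒰.mem_nhds (hu.mem x t hx.le ht.le)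
  have hux := hu.hasDerivAt_space hx ht
  have hU := (hUF.contDiffOn_entropy.differentiableOn two_ne_zero).hasFDerivAt hn
  have hF := (hUF.contDiffOn_flux.differentiableOn two_ne_zero).hasFDerivAt hn
  have hDU := ((hUF.contDiffOn_entropy.fderiv_of_isOpen (m := 1) h𝒰
    (by norm_num)).differentiableOn one_ne_zero).hasFDerivAt hn
  have hUt : HasDerivAt (fun s => U (u x s)) _ t :=
    hU.comp_hasDerivAt t (hu.hasDerivAt_time hx.le ht)
  have hFx : HasDerivAt (fun z => F (u z t)) _ x := hF.comp_hasDerivAt x hux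
  have hDUx : HasDerivAt (fun z => fderiv ℝ U (u z t)) _ x := hDU.comp_hasDerivAt x hux
  refine (hFx.sub ((hDUx.clm_apply (hu.hasDerivAt_spaceDeriv hx ht)).const_mul ε)).congr_deriv ?_
  rw [hUt.deriv]
  linarith [hu.entropy_balance h𝒰 hf hUF hx ht]

theorem continuousOn_solAvg (hu : IsViscousSolution 𝒰 f ε uI uB u) {g : State N → ℝ}
    (hg : ContinuousOn g 𝒰) (ha : 0 < a) (hab : a ≤ b) (hψ : IntervalIntegrable ψ volume a b) :
    ContinuousOn (solAvg u g ψ a b) (Ici 0) :=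
  continuousOn_integral_mul (P := fun p => g (u p.1 p.2)) isClosed_Ici
    ((hg.comp hu.contDiffOn.continuousOn hu.mapsTo).mono
      (prod_mono_right (Icc_subset_Ioi_zero ha))) hab hψ

theorem continuousOn_viscFlux (hu : IsViscousSolution 𝒰 f ε uI uB u) (h𝒰 : IsOpen 𝒰)
    (hUF : IsEntropyPair 𝒰 f U F) (ha : 0 < a) (hab : a ≤ b)
    (hψ : IntervalIntegrable ψ volume a b) :
    ContinuousOn (viscFlux ε u U F ψ a b) (Ici 0) :=
  continuousOn_integral_mul isClosed_Ici ((hu.contDiffOn_flux h𝒰 hUF).continuousOn.mono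
    (prod_mono_right (Icc_subset_Ioi_zero ha))) hab hψ

theorem hasDerivAt_solAvg (hu : IsViscousSolution 𝒰 f ε uI uB u) (h𝒰 : IsOpen 𝒰)
    (hε : ε ≠ 0) (hUF : IsEntropyPair 𝒰 f U F) (ha : 0 < a) (hab : a ≤ b)
    (hψ : IntervalIntegrable ψ volume a b) (hx : 0 < x) :
    HasDerivAt (solAvg u U ψ a b) (ε⁻¹ * (solAvg u F ψ a b x - viscFlux ε u U F ψ a b x)) x := by
  have hsub : Ioi (0 : ℝ) ×ˢ Icc a b ⊆ Ici 0 ×ˢ Ioi 0 :=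
    prod_mono Ioi_subset_Ici_self (Icc_subset_Ioi_zero ha)
  have hUx : ContinuousOn (fun p : ℝ × ℝ => fderiv ℝ U (u p.1 p.2) (spaceDeriv u p.1 p.2))
      (Ioi 0 ×ˢ Icc a b) :=
    (hu.contDiffOn_fderiv_comp h𝒰 hUF.contDiffOn_entropy).continuousOn.mono hsub
  have hcomp : ∀ {g : State N → ℝ}, ContDiffOn ℝ 2 g 𝒰 →
      ContinuousOn (fun p : ℝ × ℝ => g (u p.1 p.2)) (Ioi 0 ×ˢ Icc a b) := fun hg =>
    (hg.continuousOn.comp hu.contDiffOn.continuousOn hu.mapsTo).mono hsub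
  have hd := hasDerivAt_integral_mul isOpen_Ioi (hcomp hUF.contDiffOn_entropy) hUx
    (fun x hx t ht => ((hUF.contDiffOn_entropy.differentiableOn two_ne_zero).hasFDerivAt
      (h𝒰.mem_nhds (hu.mem x t (le_of_lt hx) (ha.le.trans ht.1)))).comp_hasDerivAt x
        (hu.hasDerivAt_space hx (ha.trans_le ht.1))) hab hψ (mem_Ioi.2 hx)
  refine hd.congr_deriv ?_
  have hflux : viscFlux ε u U F ψ a b x = solAvg u F ψ a b x
      - ε * ∫ t in a..b, fderiv ℝ U (u x t) (spaceDeriv u x t) * ψ t := by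
    rw [viscFlux, solAvg, ← intervalIntegral.integral_const_mul, ← intervalIntegral.integral_sub
      (intervalIntegrable_mul_of_continuousOn_prod (hcomp hUF.contDiffOn_flux) hab hψ hx)
      ((intervalIntegrable_mul_of_continuousOn_prod hUx hab hψ hx).const_mul ε)]
    exact intervalIntegral.integral_congr fun t _ => by simp only; ring
  rw [hflux, sub_sub_cancel, inv_mul_cancel_left₀ hε]

theorem abs_integral_mul_deriv_time_le (hu : IsViscousSolution 𝒰 f ε uI uB u)
    (hU : ContDiffOn ℝ 2 U 𝒰) {M B : ℝ} (ha : 0 < a) (hψ : PairingBound ψ a b M)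
    (hB : ∀ x t, 0 ≤ x → 0 ≤ t → |U (u x t)| ≤ B) (hx : 0 ≤ x) :
    ContinuousOn (deriv fun s => U (u x s)) (Icc a b) ∧
      |∫ t in a..b, ψ t * deriv (fun s => U (u x s)) t| ≤ M * B := by
  have hUt : ContDiffOn ℝ 2 (fun s => U (u x s)) (Ioi 0) :=
    hU.comp (hu.contDiffOn_time hx) fun s hs => hu.mem x s hx (le_of_lt hs)
  have hcont := (hUt.continuousOn_deriv_of_isOpen isOpen_Ioi (by norm_num)).mono
    (Icc_subset_Ioi_zero (b := b) ha)
  exact ⟨hcont, hψ.bound _ _ (fun t ht => (hUt.differentiableOn two_ne_zero).hasDerivAt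
    (Ioi_mem_nhds (ha.trans_le ht.1))) hcont B fun t ht => hB x t hx (ha.le.trans ht.1)⟩

theorem exists_hasDerivAt_viscFlux_le (hu : IsViscousSolution 𝒰 f ε uI uB u) (h𝒰 : IsOpen 𝒰)
    (hε : 0 ≤ ε) (hf : DifferentiableOn ℝ f 𝒰) (hUF : IsEntropyPair 𝒰 f U F) {M B : ℝ}
    (ha : 0 < a) (hab : a ≤ b) (hψ : PairingBound ψ a b M)
    (hsign : ∀ w ∈ 𝒰, ∀ z, ∀ t ∈ Icc a b, 0 ≤ fderiv ℝ (fderiv ℝ U) w z z * ψ t)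
    (hB : ∀ x t, 0 ≤ x → 0 ≤ t → |U (u x t)| ≤ B) (hx : 0 < x) :
    ∃ G', HasDerivAt (viscFlux ε u U F ψ a b) G' x ∧ G' ≤ M * B := by
  have hopen : IsOpen (Ioi (0 : ℝ) ×ˢ Ioi (0 : ℝ)) := isOpen_Ioi.prod isOpen_Ioi
  have hC1 := (hu.contDiffOn_flux h𝒰 hUF).mono (prod_mono_left Ioi_subset_Ici_self)
  have hder := continuousOn_of_hasDerivAt_fst hopen hC1
    (fun p hp => hu.hasDerivAt_flux h𝒰 hf hUF hp.1 hp.2)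
  have hsub := prod_mono_right (s := Ioi (0 : ℝ)) (Icc_subset_Ioi_zero (b := b) ha)
  refine ⟨_, hasDerivAt_integral_mul isOpen_Ioi (hC1.continuousOn.mono hsub) (hder.mono hsub)
    (fun x hx t ht => hu.hasDerivAt_flux h𝒰 hf hUF hx (ha.trans_le ht.1)) hab hψ.integrable
    (mem_Ioi.2 hx), ?_⟩
  obtain ⟨hcont, hbound⟩ :=
    hu.abs_integral_mul_deriv_time_le hUF.contDiffOn_entropy ha hψ hB hx.le
  have hint : IntervalIntegrable (fun t => -(ψ t * deriv (fun s => U (u x s)) t)) volume a b :=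
    (hψ.integrable.mul_continuousOn (by rwa [uIcc_of_le hab])).neg
  calc _ ≤ ∫ t in a..b, -(ψ t * deriv (fun s => U (u x s)) t) := by
        refine intervalIntegral.integral_mono_on hab (intervalIntegrable_mul_of_continuousOn_prod
          (hder.mono hsub) hab hψ.integrable hx) hint fun t ht => ?_
        have dissipation := mul_nonneg hε (hsign (u x t)
          (hu.mem x t hx.le (ha.le.trans ht.1)) (spaceDeriv u x t) t ht)
        linarith
    _ ≤ M * B := by
        rw [intervalIntegral.integral_neg]
        exact (neg_le_abs _).trans hbound

theorem antitoneOn_viscFlux (hu : IsViscousSolution 𝒰 f ε uI uB u) (h𝒰 : IsOpen 𝒰)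
    (hε : 0 ≤ ε) (hf : DifferentiableOn ℝ f 𝒰) (hUF : IsEntropyPair 𝒰 f U F) {M B : ℝ}
    (ha : 0 < a) (hab : a ≤ b) (hψ : PairingBound ψ a b M)
    (hsign : ∀ w ∈ 𝒰, ∀ z, ∀ t ∈ Icc a b, 0 ≤ fderiv ℝ (fderiv ℝ U) w z z * ψ t)
    (hB : ∀ x t, 0 ≤ x → 0 ≤ t → |U (u x t)| ≤ B) :
    AntitoneOn (fun x => viscFlux ε u U F ψ a b x - M * B * x) (Ici 0) := by
  have hd : ∀ x ∈ Ioi (0 : ℝ), ∃ G', HasDerivAt (viscFlux ε u U F ψ a b) G' x ∧ G' ≤ M * B :=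
    fun x hx => hu.exists_hasDerivAt_viscFlux_le h𝒰 hε hf hUF ha hab hψ hsign hB hx
  intro x hx y hy hxy
  have := (convex_Ici (0 : ℝ)).image_sub_le_mul_sub_of_deriv_le
    (hu.continuousOn_viscFlux h𝒰 hUF ha hab hψ.integrable)
    (by
      rw [interior_Ici]
      intro z hz
      obtain ⟨G', hG', -⟩ := hd z hz
      exact hG'.differentiableAt.differentiableWithinAt)
    (by
      rw [interior_Ici]
      intro z hz
      obtain ⟨G', hG', hle⟩ := hd z hz
      rwa [hG'.deriv]) x hx y hy hxy
  linarith

theorem integral_viscFlux_mul (hu : IsViscousSolution 𝒰 f ε uI uB u) (h𝒰 : IsOpen 𝒰)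
    (hε : ε ≠ 0) (hUF : IsEntropyPair 𝒰 f U F) (ha : 0 < a) (hab : a ≤ b)
    (hψ : IntervalIntegrable ψ volume a b) {s : ℝ} (hs : 0 < s) {φ : ℝ → ℝ}
    (hφ : IsTest (Ioi 0) φ) :
    ∫ y in Ioi 0, viscFlux ε u U F ψ a b (s * y) * φ y
      = (∫ y in Ioi 0, solAvg u F ψ a b (s * y) * φ y)
        + ε / s * ∫ y in Ioi 0, solAvg u U ψ a b (s * y) * deriv φ y := by
  have hscale : MapsTo (fun y => s * y) (Ioi 0) (Ici 0) := fun y hy => (mul_pos hs hy).le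
  have hG : LocallyIntegrableOn (fun y => viscFlux ε u U F ψ a b (s * y)) (Ioi 0) :=
    ((hu.continuousOn_viscFlux h𝒰 hUF ha hab hψ).comp (by fun_prop)
      hscale).locallyIntegrableOn measurableSet_Ioi
  have hF : LocallyIntegrableOn (fun y => solAvg u F ψ a b (s * y)) (Ioi 0) :=
    ((hu.continuousOn_solAvg hUF.contDiffOn_flux.continuousOn ha hab hψ).comp (by fun_prop)
      hscale).locallyIntegrableOn measurableSet_Ioi
  have hd : ∀ y, 0 < y → HasDerivAt (fun y => solAvg u U ψ a b (s * y))
      (s / ε * (solAvg u F ψ a b (s * y) - viscFlux ε u U F ψ a b (s * y))) y := fun y hy =>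
    ((hu.hasDerivAt_solAvg h𝒰 hε hUF ha hab hψ (mul_pos hs hy)).comp y
      ((hasDerivAt_id y).const_mul s)).congr_deriv (by ring)
  have hparts := hφ.integral_mul_deriv hd ((hF.sub hG).continuousOn_mul continuousOn_const
    isOpen_Ioi.isLocallyClosed)
  simp only [mul_assoc, integral_const_mul, sub_mul] at hparts
  rw [hparts, integral_sub (hφ.integrableOn_mul hF) (hφ.integrableOn_mul hG)]
  field_simp
  ring

end IsViscousSolution

end ViscousSolutions

section CompactRange

theorem exists_isCompact_convex_superset {E : Type*} [NormedAddCommGroup E] [NormedSpace ℝ E]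
    [FiniteDimensional ℝ E] {S 𝒰 : Set E} (h𝒰 : IsOpen 𝒰) (h𝒰c : Convex ℝ 𝒰) (hS : IsCompact S)
    (hS𝒰 : S ⊆ 𝒰) : ∃ K, IsCompact K ∧ Convex ℝ K ∧ S ⊆ K ∧ K ⊆ 𝒰 := by
  suffices ∃ V : Set E, V.Finite ∧ V ⊆ 𝒰 ∧ S ⊆ convexHull ℝ V by
    obtain ⟨V, hV, hV𝒰, hSV⟩ := this
    exact ⟨convexHull ℝ V, hV.isCompact_convexHull ℝ, convex_convexHull ℝ V, hSV,
      convexHull_min hV𝒰 h𝒰c⟩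
  refine hS.induction_on ⟨∅, finite_empty, empty_subset _, empty_subset _⟩ ?_ ?_ ?_
  · exact fun s t hst ⟨V, hV, hV𝒰, htV⟩ => ⟨V, hV, hV𝒰, hst.trans htV⟩
  · exact fun s t ⟨V, hV, hV𝒰, hsV⟩ ⟨W, hW, hW𝒰, htW⟩ =>
      ⟨V ∪ W, hV.union hW, union_subset hV𝒰 hW𝒰,
        union_subset (hsV.trans (convexHull_mono subset_union_left))
          (htW.trans (convexHull_mono subset_union_right))⟩
  · intro z hz
    obtain ⟨b, hzb, hb𝒰⟩ := exists_mem_interior_convexHull_affineBasis (h𝒰.mem_nhds (hS𝒰 hz))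
    exact ⟨_, mem_nhdsWithin_of_mem_nhds (mem_interior_iff_mem_nhds.1 hzb), range b,
      finite_range b, (subset_convexHull ℝ _).trans hb𝒰, Subset.rfl⟩

theorem closure_subset_of_inv_infDist_le {X : Type*} [PseudoMetricSpace X] {S 𝒰 : Set X} {D : ℝ}
    (h𝒰 : IsOpen 𝒰) (hS : S ⊆ 𝒰) (hD : ∀ z ∈ S, (Metric.infDist z 𝒰ᶜ)⁻¹ ≤ D) :
    closure S ⊆ 𝒰 := by
  intro z hz
  by_contra hz𝒰
  have hpos : ∀ w ∈ S, 0 < Metric.infDist w 𝒰ᶜ := fun w hw =>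
    (h𝒰.isClosed_compl.notMem_iff_infDist_pos ⟨z, hz𝒰⟩).1 (not_not.2 (hS hw))
  obtain ⟨w₀, hw₀⟩ := closure_nonempty_iff.1 ⟨z, hz⟩
  have hD0 : 0 < D := (inv_pos.2 (hpos w₀ hw₀)).trans_le (hD w₀ hw₀)
  have hle : D⁻¹ ≤ Metric.infDist z 𝒰ᶜ :=
    closure_minimal (t := {w | D⁻¹ ≤ Metric.infDist w 𝒰ᶜ})
      (fun w hw => inv_le_of_inv_le₀ (hpos w hw) (hD w hw))
      (isClosed_le continuous_const (Metric.continuous_infDist_pt _)) hz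
  rw [Metric.infDist_zero_of_mem hz𝒰] at hle
  exact hle.not_gt (inv_pos.2 hD0)

theorem le_of_ae_le_of_continuousOn {X : Type*} [TopologicalSpace X] [MeasurableSpace X]
    {m : Measure X} [m.IsOpenPosMeasure] {O : Set X} {h : X → ℝ} {C : ℝ} (hO : IsOpen O)
    (hc : ContinuousOn h O) (hle : ∀ᵐ p ∂m.restrict O, h p ≤ C) : ∀ p ∈ O, h p ≤ C := by
  have heq : EqOn (fun p => min (h p) C) h O :=
    Measure.eqOn_open_of_ae_eq (hle.mono fun p hp => min_eq_left hp) hO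
      (ContinuousOn.inf hc continuousOn_const) hc
  exact fun p hp => min_eq_left_iff.1 (heq hp)

end CompactRange

section WeakStar

theorem ae_norm_le_of_memLp_top {α E : Type*} [MeasurableSpace α] [NormedAddCommGroup E]
    {m : Measure α} {h : α → E} (hh : MemLp h ⊤ m) :
    ∀ᵐ p ∂m, ‖h p‖ ≤ (eLpNorm h ⊤ m).toReal := by
  filter_upwards [ae_le_eLpNormEssSup (f := h) (μ := m)] with p hp
  rw [← eLpNorm_exponent_top] at hp
  simpa only [toReal_enorm] using ENNReal.toReal_mono hh.eLpNorm_ne_top hp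

theorem ae_le_const_of_forall_setIntegral_le {α : Type*} [MeasurableSpace α] {m : Measure α}
    [SigmaFinite m] {h : α → ℝ} {C : ℝ} (hh : MemLp h ⊤ m)
    (hle : ∀ s, MeasurableSet s → m s < ⊤ → ∫ p in s, h p ∂m ≤ C * m.real s) :
    ∀ᵐ p ∂m, h p ≤ C := by
  have hint : ∀ s, m s < ⊤ → IntegrableOn h s m := fun s hs =>
    have := isFiniteMeasure_restrict.2 hs.ne
    (hh.restrict s).integrable le_top
  have hnonneg : 0 ≤ᵐ[m] fun p => C - h p := by
    refine ae_nonneg_of_forall_setIntegral_nonneg_of_sigmaFinite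
      (fun s _ hfin => (integrableOn_const hfin.ne).sub (hint s hfin)) fun s hs hfin => ?_
    rw [integral_sub (integrableOn_const (C := C) hfin.ne) (hint s hfin), setIntegral_const,
      smul_eq_mul, mul_comm]
    exact sub_nonneg.2 (hle s hs hfin)
  exact hnonneg.mono fun p hp => sub_nonneg.1 hp

namespace WeakStarTendsto

variable {h : ℕ → ℝ × ℝ → ℝ} {h' : ℝ × ℝ → ℝ} {s : Set (ℝ × ℝ)}

theorem tendsto_setIntegral (H : WeakStarTendsto h h') (hs : MeasurableSet s)
    (hfin : volQuarter s < ⊤) :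
    Tendsto (fun n => ∫ p in s, h n p ∂volQuarter) atTop (𝓝 (∫ p in s, h' p ∂volQuarter)) := by
  have hmul : ∀ g : ℝ × ℝ → ℝ, ∫ p, g p * s.indicator 1 p ∂volQuarter
      = ∫ p in s, g p ∂volQuarter := fun g => by
    rw [← integral_indicator hs]
    congr 1 with p
    by_cases hp : p ∈ s <;> simp [hp]
  simpa only [hmul] using H.tendsto (s.indicator 1)
    ((integrable_indicator_iff hs).2 (integrableOn_const (C := (1 : ℝ)) hfin.ne))

theorem exists_ae_le (H : WeakStarTendsto h h') :
    ∃ C : ℝ, ∀ n, ∀ᵐ p ∂volQuarter, h n p ≤ C := by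
  let Λ : ℕ → Lp ℝ 1 volQuarter →L[ℝ] ℝ := fun n =>
    (ContinuousLinearMap.mul ℝ ℝ).lpPairing volQuarter ⊤ 1 (H.memLp n).toLp
  have hΛ : ∀ n (φ : Lp ℝ 1 volQuarter), Λ n φ = ∫ p, h n p * φ p ∂volQuarter := fun n φ => by
    rw [ContinuousLinearMap.lpPairing_eq_integral]
    refine integral_congr_ae ?_
    filter_upwards [(H.memLp n).coeFn_toLp] with p hp
    rw [hp, ContinuousLinearMap.mul_apply']
  obtain ⟨C, hC⟩ := banach_steinhaus (g := Λ) fun φ => by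
    obtain ⟨C, hC⟩ := (H.tendsto φ (L1.integrable_coeFn φ)).norm.bddAbove_range
    exact ⟨C, fun n => (hΛ n φ).symm ▸ hC ⟨n, rfl⟩⟩
  refine ⟨C, fun n => ae_le_const_of_forall_setIntegral_le (H.memLp n) fun s hs hfin => ?_⟩
  have hle := (Λ n).le_of_opNorm_le (hC n) (indicatorConstLp 1 hs hfin.ne (1 : ℝ))
  have heq : Λ n (indicatorConstLp 1 hs hfin.ne (1 : ℝ)) = ∫ p in s, h n p ∂volQuarter := by
    rw [hΛ, ← integral_indicator hs]
    refine integral_congr_ae ?_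
    filter_upwards [indicatorConstLp_coeFn (p := 1) (hs := hs) (hμs := hfin.ne) (c := (1 : ℝ))]
      with p hp
    rw [hp]
    by_cases hps : p ∈ s <;> simp [hps]
  rw [heq, norm_indicatorConstLp one_ne_zero ENNReal.one_ne_top] at hle
  simpa using (le_abs_self _).trans hle

end WeakStarTendsto

end WeakStar

section YoungMeasures

variable {N : ℕ} {𝒰 K : Set (State N)} {w : ℕ → ℝ × ℝ → State N}
  {κ : Kernel (ℝ × ℝ) (State N)}

/-- Since `1 / dist(·, 𝒰ᶜ)` is a continuous function on `𝒰`, its weak-`⋆` convergence along `w`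
keeps the values of `w` away from the boundary of `𝒰`. -/
theorem IsYoungMeasure.exists_compact_range (h𝒰 : IsOpen 𝒰) (h𝒰c : Convex ℝ 𝒰)
    (hκ : IsYoungMeasure 𝒰 w κ) (hw : ∀ n, ContinuousOn (w n) (Ici 0 ×ˢ Ici 0))
    (hmem : ∀ n, MapsTo (w n) (Ici 0 ×ˢ Ici 0) 𝒰) {C : ℝ}
    (hC : ∀ n, ∀ p ∈ (Ici 0 ×ˢ Ici 0 : Set (ℝ × ℝ)), ‖w n p‖ ≤ C) :
    ∃ K : Set (State N), IsCompact K ∧ Convex ℝ K ∧ K ⊆ 𝒰 ∧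
      ∀ n, MapsTo (w n) (Ici 0 ×ˢ Ici 0) K := by
  have hQ : (Ioi (0 : ℝ) ×ˢ Ioi (0 : ℝ)) ⊆ Ici 0 ×ˢ Ici 0 :=
    prod_mono Ioi_subset_Ici_self Ioi_subset_Ici_self
  have hg : ContinuousOn (fun z => (Metric.infDist z 𝒰ᶜ)⁻¹) 𝒰 := by
    rcases eq_or_ne 𝒰 univ with rfl | hne
    · simp only [compl_univ, Metric.infDist_empty]
      exact continuousOn_const
    · exact (Metric.continuous_infDist_pt _).continuousOn.inv₀ fun z hz =>
        ((h𝒰.isClosed_compl.notMem_iff_infDist_pos (nonempty_compl.2 hne)).1 (not_not.2 hz)).ne'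
  obtain ⟨D, hD⟩ := (hκ.weakStar _ hg).exists_ae_le
  have hle : ∀ n, ∀ p ∈ (Ioi 0 ×ˢ Ioi 0 : Set (ℝ × ℝ)), (Metric.infDist (w n p) 𝒰ᶜ)⁻¹ ≤ D :=
    fun n => le_of_ae_le_of_continuousOn (isOpen_Ioi.prod isOpen_Ioi)
      (hg.comp ((hw n).mono hQ) ((hmem n).mono_left hQ)) (hD n)
  set S : Set (State N) := ⋃ n, w n '' (Ioi 0 ×ˢ Ioi 0)
  have hS_compact : IsCompact (closure S) := by
    have hSC : S ⊆ Metric.closedBall 0 C := iUnion_subset fun n =>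
      image_subset_iff.2 fun p hp => mem_closedBall_zero_iff.2 (hC n p (hQ hp))
    exact (Metric.isBounded_closedBall.subset hSC).isCompact_closure
  have hS𝒰 : closure S ⊆ 𝒰 := by
    refine closure_subset_of_inv_infDist_le (D := D) h𝒰
      (iUnion_subset fun n => image_subset_iff.2 ((hmem n).mono_left hQ)) fun z hz => ?_
    obtain ⟨n, p, hp, rfl⟩ := mem_iUnion.1 hz
    exact hle n p hp
  obtain ⟨K, hK, hKc, hSK, hK𝒰⟩ := exists_isCompact_convex_superset h𝒰 h𝒰c hS_compact hS𝒰
  refine ⟨K, hK, hKc, hK𝒰, fun n p hp => hSK ?_⟩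
  refine ((hw n p hp).mono hQ).mem_closure ?_ fun q hq => mem_iUnion.2 ⟨n, q, hq, rfl⟩
  rwa [closure_prod_eq, closure_Ioi]

theorem IsYoungMeasure.ae_compl_eq_zero (hκ : IsYoungMeasure 𝒰 w κ) (hK : IsClosed K)
    (hmem : ∀ n, MapsTo (w n) (Ioi 0 ×ˢ Ioi 0) K) : ∀ᵐ p ∂volQuarter, κ p Kᶜ = 0 := by
  have := hκ.markov
  have hne : K.Nonempty := ⟨w 0 (1, 1), hmem 0 (by simp)⟩
  set g : State N → ℝ := fun z => min (Metric.infDist z K) 1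
  have hg : Continuous g := (Metric.continuous_infDist_pt K).min continuous_const
  have hg0 : 0 ≤ g := fun z => le_min Metric.infDist_nonneg zero_le_one
  have H := hκ.weakStar g hg.continuousOn
  have hzero : ∀ n s, ∫ p in s, g (w n p) ∂volQuarter = 0 := fun n s =>
    integral_eq_zero_of_ae <| ae_restrict_of_ae <| by
      filter_upwards [ae_restrict_mem (measurableSet_Ioi.prod measurableSet_Ioi)] with p hp
      simp [g, Metric.infDist_zero_of_mem (hmem n hp)]
  have hle : ∀ᵐ p ∂volQuarter, ∫ z, g z ∂(κ p) ≤ 0 :=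
    ae_le_const_of_forall_setIntegral_le H.memLp_limit fun s hs hfin => by
      have hlim := H.tendsto_setIntegral hs hfin
      simp only [hzero] at hlim
      rw [tendsto_nhds_unique hlim tendsto_const_nhds, zero_mul]
  filter_upwards [hle] with p hp
  have hint : Integrable g (κ p) :=
    Integrable.of_bound hg.aestronglyMeasurable 1 <| ae_of_all _ fun z => by
      rw [Real.norm_of_nonneg (hg0 z)]
      exact min_le_right _ _
  have hae := (integral_eq_zero_iff_of_nonneg hg0 hint).1 (hp.antisymm (integral_nonneg hg0))
  refine measure_mono_null (fun z hz => ?_) (ae_iff.1 hae)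
  exact (lt_min ((hK.notMem_iff_infDist_pos hne).1 hz) one_pos).ne'

theorem abs_integral_le_of_compl_eq_zero {α : Type*} [MeasurableSpace α] {K : Set α}
    {m : Measure α} [IsProbabilityMeasure m] (hm : m Kᶜ = 0) {g : α → ℝ} {B : ℝ}
    (hB : ∀ z ∈ K, |g z| ≤ B) : |∫ z, g z ∂m| ≤ B := by
  have hae : ∀ᵐ z ∂m, ‖g z‖ ≤ B := by
    filter_upwards [measure_eq_zero_iff_ae_notMem.1 hm] with z hz using hB z (not_not.1 hz)
  simpa using norm_integral_le_of_norm_le_const hae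

end YoungMeasures

section TensorTests

theorem volQuarter_eq_prod : volQuarter = volHalf.prod volHalf :=
  (Measure.prod_restrict _ _).symm

theorem integrable_and_tendsto_integral_abs_sub_of_dominated {α : Type*} [MeasurableSpace α]
    {m : Measure α} {χn : ℕ → α → ℝ} {χ bound : α → ℝ}
    (hm : ∀ n, AEStronglyMeasurable (χn n) m) (hbound : Integrable bound m)
    (hle : ∀ n, ∀ᵐ t ∂m, |χn n t| ≤ bound t)
    (hlim : ∀ᵐ t ∂m, Tendsto (fun n => χn n t) atTop (𝓝 (χ t))) :
    Integrable χ m ∧ Tendsto (fun n => ∫ t, |χn n t - χ t| ∂m) atTop (𝓝 0) := by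
  have hχm : AEStronglyMeasurable χ m := aestronglyMeasurable_of_tendsto_ae _ hm hlim
  have hχ_le : ∀ᵐ t ∂m, |χ t| ≤ bound t := by
    filter_upwards [hlim, ae_all_iff.2 hle] with t ht hle_t
    exact le_of_tendsto' ht.abs hle_t
  have hχ : Integrable χ m := hbound.mono' hχm hχ_le
  refine ⟨hχ, ?_⟩
  rw [← integral_zero α ℝ (μ := m)]
  refine tendsto_integral_of_dominated_convergence (fun t => bound t + |χ t|)
    (fun n => ((hm n).sub hχm).norm) (hbound.add hχ.norm) (fun n => ?_) ?_
  · filter_upwards [hle n] with t ht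
    rw [Real.norm_eq_abs, abs_abs]
    exact (abs_sub _ _).trans (by gcongr)
  · filter_upwards [hlim] with t ht
    simpa using (ht.sub_const (χ t)).abs

theorem integral_quarter_mul {h : ℝ × ℝ → ℝ} (hh : MemLp h ⊤ volQuarter) {φ χ : ℝ → ℝ}
    (hφ : Integrable φ volHalf) (hχ : Integrable χ volHalf) :
    ∫ p, h p * (φ p.1 * χ p.2) ∂volQuarter
      = ∫ y in Ioi 0, (∫ t in Ioi 0, h (y, t) * χ t) * φ y := by
  rw [volQuarter_eq_prod] at hh ⊢
  have hint : Integrable (fun p => h p * (φ p.1 * χ p.2)) (volHalf.prod volHalf) :=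
    (hφ.mul_prod hχ).mul_of_top_right hh
  rw [integral_prod _ hint]
  refine integral_congr_ae (ae_of_all _ fun y => ?_)
  simp only [← integral_mul_const]
  exact integral_congr_ae (ae_of_all _ fun t => by ring)

theorem intervalIntegral_eq_indicator {h ψ : ℝ → ℝ} {a b : ℝ} (ha : 0 ≤ a) (hab : a ≤ b) :
    ∫ t in a..b, h t * ψ t = ∫ t in Ioi 0, h t * (Ioc a b).indicator ψ t := by
  have hsub : Ioc a b ⊆ Ioi 0 := fun t ht => ha.trans_lt ht.1
  simp only [← indicator_mul_right]
  rw [intervalIntegral.integral_of_le hab, setIntegral_indicator measurableSet_Ioc,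
    inter_eq_self_of_subset_right hsub]

namespace WeakStarTendsto

variable {h : ℕ → ℝ × ℝ → ℝ} {h' : ℝ × ℝ → ℝ} {B : ℝ}

theorem tendsto_integral_mul (H : WeakStarTendsto h h')
    (hB : ∀ n, ∀ᵐ p ∂volQuarter, |h n p| ≤ B) {Φn : ℕ → ℝ × ℝ → ℝ} {Φ : ℝ × ℝ → ℝ}
    (hΦn : ∀ n, Integrable (Φn n) volQuarter) (hΦ : Integrable Φ volQuarter)
    (hL1 : Tendsto (fun n => ∫ p, |Φn n p - Φ p| ∂volQuarter) atTop (𝓝 0)) :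
    Tendsto (fun n => ∫ p, h n p * Φn n p ∂volQuarter) atTop
      (𝓝 (∫ p, h' p * Φ p ∂volQuarter)) := by
  have herr : Tendsto (fun n => ∫ p, h n p * (Φn n p - Φ p) ∂volQuarter) atTop (𝓝 0) := by
    refine squeeze_zero_norm (fun n => ?_) (by simpa using hL1.const_mul B)
    rw [← integral_const_mul]
    refine norm_integral_le_of_norm_le (((hΦn n).sub hΦ).norm.const_mul B) ?_
    filter_upwards [hB n] with p hp
    rw [norm_mul]
    exact mul_le_mul_of_nonneg_right hp (norm_nonneg _)
  have hsum := (H.tendsto Φ hΦ).add herr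
  rw [add_zero] at hsum
  have hint : ∀ n {Ψ : ℝ × ℝ → ℝ}, Integrable Ψ volQuarter →
      Integrable (fun p => h n p * Ψ p) volQuarter := fun n _ hΨ => hΨ.mul_of_top_right (H.memLp n)
  refine hsum.congr fun n => ?_
  rw [← integral_add (hint n hΦ) (hint n (Ψ := fun p => Φn n p - Φ p) ((hΦn n).sub hΦ))]
  exact integral_congr_ae (ae_of_all _ fun p => by ring)

theorem tendsto_integral_tensor (H : WeakStarTendsto h h')
    (hB : ∀ n, ∀ᵐ p ∂volQuarter, |h n p| ≤ B) {χn : ℕ → ℝ → ℝ} {χ φ : ℝ → ℝ}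
    (hχn : ∀ n, Integrable (χn n) volHalf) (hχ : Integrable χ volHalf)
    (hL1 : Tendsto (fun n => ∫ t in Ioi 0, |χn n t - χ t|) atTop (𝓝 0))
    (hφ : Integrable φ volHalf) :
    Tendsto (fun n => ∫ y in Ioi 0, (∫ t in Ioi 0, h n (y, t) * χn n t) * φ y) atTop
      (𝓝 (∫ y in Ioi 0, (∫ t in Ioi 0, h' (y, t) * χ t) * φ y)) := by
  have hprod : ∀ {χ : ℝ → ℝ}, Integrable χ volHalf →
      Integrable (fun p : ℝ × ℝ => φ p.1 * χ p.2) volQuarter := fun hχ =>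
    volQuarter_eq_prod ▸ hφ.mul_prod hχ
  simp only [← integral_quarter_mul H.memLp_limit hφ hχ,
    ← integral_quarter_mul (H.memLp _) hφ (hχn _)]
  refine H.tendsto_integral_mul hB (fun n => hprod (hχn n)) (hprod hχ) ?_
  have hnorm : ∀ n, ∫ p, |φ p.1 * χn n p.2 - φ p.1 * χ p.2| ∂volQuarter
      = (∫ y in Ioi 0, |φ y|) * ∫ t in Ioi 0, |χn n t - χ t| := fun n => by
    simp only [← mul_sub, abs_mul]
    rw [volQuarter_eq_prod]
    exact integral_prod_mul (fun y => |φ y|) fun t => |χn n t - χ t|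
  simpa only [hnorm, mul_zero] using hL1.const_mul (∫ y in Ioi 0, |φ y|)

end WeakStarTendsto

end TensorTests

section TestSequences

variable {ψn : ℕ → ℝ → ℝ} {ψ θ : ℝ → ℝ} {a : ℕ → ℝ} {A T₁ T₂ M : ℝ}

/-- Weights `ψn n` on the time windows `[a n, T₂]`, converging to the weight `ψ` on
`[T₁, T₂]` with uniform bounds. The windows start at `a n > 0` because the viscous solutions need
not be differentiable at `t = 0`. -/
structure TestSeq (ψn : ℕ → ℝ → ℝ) (ψ : ℝ → ℝ) (a : ℕ → ℝ) (T₁ T₂ M : ℝ) : Prop where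
  nonneg : 0 ≤ T₁
  lt : T₁ < T₂
  mem : ∀ n, a n ∈ Ioo T₁ T₂
  tendsto : Tendsto a atTop (𝓝 T₁)
  pairing : ∀ n, PairingBound (ψn n) (a n) T₂ M
  bounded : ∃ A, ∀ n t, 0 < t → |ψn n t| ≤ A
  lim : ∀ᵐ t ∂volHalf, Tendsto (fun n => ψn n t) atTop (𝓝 (ψ t))

namespace TestSeq

theorem pos (h : TestSeq ψn ψ a T₁ T₂ M) (n : ℕ) : 0 < a n := h.nonneg.trans_lt (h.mem n).1

theorem neg (h : TestSeq ψn ψ a T₁ T₂ M) :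
    TestSeq (fun n t => -ψn n t) (fun t => -ψ t) a T₁ T₂ M where
  nonneg := h.nonneg
  lt := h.lt
  mem := h.mem
  tendsto := h.tendsto
  pairing := fun n => ⟨(h.pairing n).integrable.neg, fun g g' hg hg' B hB => by
    simpa only [neg_mul, intervalIntegral.integral_neg, abs_neg] using
      (h.pairing n).bound g g' hg hg' B hB⟩
  bounded := by simpa only [abs_neg] using h.bounded
  lim := h.lim.mono fun _ ht => ht.neg

theorem integrable_indicator (h : TestSeq ψn ψ a T₁ T₂ M) (n : ℕ) :
    Integrable ((Ioc (a n) T₂).indicator (ψn n)) :=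
  ((intervalIntegrable_iff_integrableOn_Ioc_of_le (h.mem n).2.le).1
    (h.pairing n).integrable).integrable_indicator measurableSet_Ioc

theorem ae_tendsto_indicator (h : TestSeq ψn ψ a T₁ T₂ M) :
    ∀ᵐ t ∂volHalf, Tendsto (fun n => (Ioc (a n) T₂).indicator (ψn n) t) atTop
      (𝓝 ((Ioc T₁ T₂).indicator ψ t)) := by
  filter_upwards [h.lim] with t ht
  by_cases hmem : t ∈ Ioc T₁ T₂
  · rw [indicator_of_mem hmem]
    refine ht.congr' ?_
    filter_upwards [h.tendsto.eventually (gt_mem_nhds hmem.1)] with n hn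
    rw [indicator_of_mem (show t ∈ Ioc (a n) T₂ from ⟨hn, hmem.2⟩)]
  · rw [indicator_of_notMem hmem]
    exact tendsto_const_nhds.congr fun n =>
      (indicator_of_notMem (fun hn => hmem ⟨(h.mem n).1.trans hn.1, hn.2⟩) _).symm

theorem exists_abs_indicator_le (h : TestSeq ψn ψ a T₁ T₂ M) :
    ∃ A, ∀ n t, |(Ioc (a n) T₂).indicator (ψn n) t| ≤ (Ioc T₁ T₂).indicator (fun _ => A) t := by
  obtain ⟨A, hA⟩ := h.bounded
  have hA0 : 0 ≤ A := (abs_nonneg _).trans (hA 0 1 one_pos)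
  refine ⟨A, fun n t => ?_⟩
  by_cases ht : t ∈ Ioc (a n) T₂
  · rw [indicator_of_mem ht, indicator_of_mem (Ioc_subset_Ioc_left (h.mem n).1.le ht)]
    exact hA n t ((h.pos n).trans ht.1)
  · rw [indicator_of_notMem ht, abs_zero]
    exact indicator_nonneg (fun _ _ => hA0) t

theorem integrable_and_tendsto_integral_abs_sub (h : TestSeq ψn ψ a T₁ T₂ M) :
    Integrable ((Ioc T₁ T₂).indicator ψ) volHalf ∧
      Tendsto (fun n => ∫ t in Ioi 0,
        |(Ioc (a n) T₂).indicator (ψn n) t - (Ioc T₁ T₂).indicator ψ t|) atTop (𝓝 0) := by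
  obtain ⟨A, hA⟩ := h.exists_abs_indicator_le
  have hbound : Integrable ((Ioc T₁ T₂).indicator fun _ => A) :=
    (integrableOn_const measure_Ioc_lt_top.ne).integrable_indicator measurableSet_Ioc
  exact integrable_and_tendsto_integral_abs_sub_of_dominated
    (fun n => (h.integrable_indicator n).aestronglyMeasurable.restrict) hbound.restrict
    (fun n => ae_of_all _ (hA n)) h.ae_tendsto_indicator

theorem integrableOn (h : TestSeq ψn ψ a T₁ T₂ M) : IntegrableOn ψ (Ioc T₁ T₂) := by
  have hsub : Ioc T₁ T₂ ⊆ Ioi 0 := fun t ht => h.nonneg.trans_lt ht.1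
  have hint := (integrable_indicator_iff measurableSet_Ioc).1
    h.integrable_and_tendsto_integral_abs_sub.1
  rwa [IntegrableOn, Measure.restrict_restrict_of_subset hsub] at hint

theorem tendsto_solAvg {N : ℕ} {𝒰 : Set (State N)} (h : TestSeq ψn ψ a T₁ T₂ M)
    {u : ℕ → ℝ → ℝ → State N} {s : ℕ → ℝ} (hs : ∀ n, 0 < s n) {κ : Kernel (ℝ × ℝ) (State N)}
    (hκ : IsYoungMeasure 𝒰 (fun n p => u n (s n * p.1) p.2) κ) {g : State N → ℝ}
    (hg : ContinuousOn g 𝒰) {B : ℝ} (hB : ∀ n x t, 0 ≤ x → 0 ≤ t → |g (u n x t)| ≤ B)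
    {φ : ℝ → ℝ} (hφ : Integrable φ volHalf) :
    Tendsto (fun n => ∫ y in Ioi 0, solAvg (u n) g (ψn n) (a n) T₂ (s n * y) * φ y) atTop
      (𝓝 (∫ y in Ioi 0, timeAvg κ g ψ T₁ T₂ y * φ y)) := by
  have havg : ∀ y, timeAvg κ g ψ T₁ T₂ y
      = ∫ t in Ioi 0, (∫ w, g w ∂(κ (y, t))) * (Ioc T₁ T₂).indicator ψ t := fun y =>
    intervalIntegral_eq_indicator h.nonneg h.lt.le
  have hsol : ∀ n x, solAvg (u n) g (ψn n) (a n) T₂ x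
      = ∫ t in Ioi 0, g (u n x t) * (Ioc (a n) T₂).indicator (ψn n) t := fun n x =>
    intervalIntegral_eq_indicator (h.pos n).le (h.mem n).2.le
  simp only [havg, hsol]
  obtain ⟨hint, hlim⟩ := h.integrable_and_tendsto_integral_abs_sub
  refine (hκ.weakStar g hg).tendsto_integral_tensor (B := B) (fun n => ?_)
    (fun n => (h.integrable_indicator n).restrict) hint hlim hφ
  filter_upwards [ae_restrict_mem (measurableSet_Ioi.prod measurableSet_Ioi)] with p hp
  exact hB n _ _ (mul_pos (hs n) hp.1).le (le_of_lt hp.2)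

end TestSeq

/-- The start of the `n`-th time window, decreasing to `T₁`. -/
noncomputable def windowStart (T₁ T₂ : ℝ) (n : ℕ) : ℝ := T₁ + (T₂ - T₁) / (n + 2)

theorem windowStart_mem (h : T₁ < T₂) (n : ℕ) : windowStart T₁ T₂ n ∈ Ioo T₁ T₂ := by
  have hlen : 0 < T₂ - T₁ := sub_pos.2 h
  have hn : (1 : ℝ) < n + 2 := by linarith [n.cast_nonneg (α := ℝ)]
  have hlt := div_lt_self hlen hn
  have hpos : 0 < (T₂ - T₁) / (n + 2) := by positivity
  constructor <;> simp only [windowStart] <;> linarith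

theorem tendsto_windowStart (T₁ T₂ : ℝ) : Tendsto (windowStart T₁ T₂) atTop (𝓝 T₁) := by
  have hdiv : Tendsto (fun n : ℕ => (n : ℝ) + 2) atTop atTop :=
    tendsto_atTop_add_const_right _ _ tendsto_natCast_atTop_atTop
  have hsum := (hdiv.const_div_atTop (T₂ - T₁)).const_add T₁
  rwa [add_zero] at hsum

theorem pairingBound_of_boundedVariationOn {a b : ℝ} (hab : a ≤ b)
    (hψ : BoundedVariationOn ψ (Icc a b)) (hA : ∀ t ∈ Icc a b, |ψ t| ≤ A) :
    PairingBound ψ a b (2 * A + (eVariationOn ψ (Icc a b)).toReal) where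
  integrable := (intervalIntegrable_iff_integrableOn_Icc_of_le hab).2 <| by
    simpa only [mul_one] using integrableOn_mul_of_boundedVariationOn measurableSet_Icc hψ
      (integrableOn_const (C := (1 : ℝ)) measure_Icc_lt_top.ne)
  bound := fun _ _ hg hg' _ hB => abs_integral_mul_deriv_le hab hψ hA hg hg' hB

theorem PairingBound.mono {a b M' : ℝ} (h : PairingBound ψ a b M) (hab : a ≤ b) (hM : M ≤ M') :
    PairingBound ψ a b M' where
  integrable := h.integrable
  bound := fun g g' hg hg' B hB => (h.bound g g' hg hg' B hB).trans <|
    mul_le_mul_of_nonneg_right hM ((abs_nonneg _).trans (hB _ (right_mem_Icc.2 hab)))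

theorem testSeq_of_variation_le {V : NNReal} (h0 : 0 ≤ T₁) (h : T₁ < T₂)
    (hA : ∀ n t, 0 < t → |ψn n t| ≤ A) (hV : ∀ n, eVariationOn (ψn n) (Ioo 0 (T₂ + 1)) ≤ V)
    (hlim : ∀ᵐ t ∂volHalf, Tendsto (fun n => ψn n t) atTop (𝓝 (ψ t))) :
    TestSeq ψn ψ (windowStart T₁ T₂) T₁ T₂ (2 * A + V) where
  nonneg := h0
  lt := h
  mem := windowStart_mem h
  tendsto := tendsto_windowStart T₁ T₂
  pairing := fun n => by
    obtain ⟨hlt, hlt'⟩ := windowStart_mem h n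
    have hsub : Icc (windowStart T₁ T₂ n) T₂ ⊆ Ioo 0 (T₂ + 1) := fun t ht =>
      ⟨h0.trans_lt (hlt.trans_le ht.1), ht.2.trans_lt (lt_add_one T₂)⟩
    have hle := (eVariationOn.mono (ψn n) hsub).trans (hV n)
    refine (pairingBound_of_boundedVariationOn hlt'.le (hle.trans_lt ENNReal.coe_lt_top).ne
      fun t ht => hA n t (hsub ht).1).mono hlt'.le ?_
    gcongr
    exact ENNReal.toReal_mono ENNReal.coe_ne_top hle
  bounded := ⟨A, hA⟩
  lim := hlim

theorem IsBV.exists_testSeq (hθ : IsBV θ) (h0 : 0 ≤ T₁) (h : T₁ < T₂) :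
    ∃ M, TestSeq (fun _ => θ) θ (windowStart T₁ T₂) T₁ T₂ M := by
  obtain ⟨A, hA⟩ := hθ.bounded
  exact ⟨_, testSeq_of_variation_le (V := (eVariationOn θ (Ioo 0 (T₂ + 1))).toNNReal) h0 h
    (fun _ => hA) (fun _ => (ENNReal.coe_toNNReal (hθ.variation _)).ge)
    (ae_of_all _ fun _ => tendsto_const_nhds)⟩

end TestSequences

section ViscousFamilies

/-- The data of the vanishing viscosity method, with values in one compact convex set `K`. -/
structure ViscousFamily {N : ℕ} (𝒰 K : Set (State N)) (f : State N → State N) (ε : ℕ → ℝ)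
    (uIε uBε : ℕ → ℝ → State N) (u : ℕ → ℝ → ℝ → State N) : Prop where
  isOpen : IsOpen 𝒰
  compact : IsCompact K
  convex : Convex ℝ K
  subset : K ⊆ 𝒰
  smooth : ContDiffOn ℝ 2 f 𝒰
  eps_pos : ∀ n, 0 < ε n
  eps_tendsto : Tendsto ε atTop (𝓝 0)
  sol : ∀ n, IsViscousSolution 𝒰 f (ε n) (uIε n) (uBε n) (u n)
  mem : ∀ n x t, 0 ≤ x → 0 ≤ t → u n x t ∈ K

namespace ViscousFamily

variable {N : ℕ} {𝒰 K : Set (State N)} {f : State N → State N} {ε : ℕ → ℝ}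
  {uIε uBε : ℕ → ℝ → State N} {u : ℕ → ℝ → ℝ → State N} {U F : State N → ℝ}

theorem exists_bound (hV : ViscousFamily 𝒰 K f ε uIε uBε u) {g : State N → ℝ}
    (hg : ContinuousOn g 𝒰) : ∃ B, 0 ≤ B ∧ ∀ z ∈ K, |g z| ≤ B := by
  obtain ⟨B, hB⟩ := hV.compact.exists_bound_of_continuousOn (hg.mono hV.subset)
  exact ⟨B, (norm_nonneg _).trans (hB _ (hV.mem 0 0 0 le_rfl le_rfl)), hB⟩

theorem antitoneOn_viscFlux (hV : ViscousFamily 𝒰 K f ε uIε uBε u) (hUF : IsEntropyPair 𝒰 f U F)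
    {ψn : ℕ → ℝ → ℝ} {ψ : ℝ → ℝ} {a : ℕ → ℝ} {T₁ T₂ M : ℝ} (h : TestSeq ψn ψ a T₁ T₂ M)
    (hsign : ∀ n, ∀ w ∈ 𝒰, ∀ z, ∀ t, 0 < t → 0 ≤ fderiv ℝ (fderiv ℝ U) w z z * ψn n t)
    {B : ℝ} (hB : ∀ z ∈ K, |U z| ≤ B) (n : ℕ) :
    AntitoneOn (fun x => viscFlux (ε n) (u n) U F (ψn n) (a n) T₂ x - M * B * x) (Ici 0) :=
  (hV.sol n).antitoneOn_viscFlux hV.isOpen (hV.eps_pos n).le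
    (hV.smooth.differentiableOn two_ne_zero) hUF (h.pos n) (h.mem n).2.le (h.pairing n)
    (fun w hw z t ht => hsign n w hw z t ((h.pos n).trans_le ht.1))
    (fun x t hx ht => hB _ (hV.mem n x t hx ht))

theorem exists_viscFlux_limit (hV : ViscousFamily 𝒰 K f ε uIε uBε u)
    (hUF : IsEntropyPair 𝒰 f U F) {ψn : ℕ → ℝ → ℝ} {ψ : ℝ → ℝ} {a : ℕ → ℝ} {T₁ T₂ M : ℝ}
    (h : TestSeq ψn ψ a T₁ T₂ M)
    (hsign : ∀ n, ∀ w ∈ 𝒰, ∀ z, ∀ t, 0 < t → 0 ≤ fderiv ℝ (fderiv ℝ U) w z z * ψn n t)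
    {B : ℝ} (hB : ∀ z ∈ K, |U z| ≤ B) {s : ℕ → ℝ} (hs : ∀ n, 0 < s n) {s₀ r : ℝ}
    (hs₀ : Tendsto s atTop (𝓝 s₀)) (hr : Tendsto (fun n => ε n / s n) atTop (𝓝 r))
    {κ : Kernel (ℝ × ℝ) (State N)} (hκ : IsYoungMeasure 𝒰 (fun n p => u n (s n * p.1) p.2) κ) :
    ∃ G : ℝ → ℝ, AlmostAntitone G (M * B * s₀) ∧
      (∀ᵐ y ∂volHalf, Tendsto
        (fun n => viscFlux (ε n) (u n) U F (ψn n) (a n) T₂ (s n * y)) atTop (𝓝 (G y))) ∧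
      ∀ φ, IsTest (Ioi 0) φ → (∫ y in Ioi 0, timeAvg κ F ψ T₁ T₂ y * φ y)
        + r * (∫ y in Ioi 0, timeAvg κ U ψ T₁ T₂ y * deriv φ y) = ∫ y in Ioi 0, G y * φ y := by
  have hUc := hUF.contDiffOn_entropy.continuousOn
  have hFc := hUF.contDiffOn_flux.continuousOn
  obtain ⟨B', -, hB'⟩ := hV.exists_bound hFc
  refine exists_almostAntitone_limit (c := fun n => M * B * s n) (hs₀.const_mul _)
    (fun n => ?_) (fun φ hφ => ?_)
  · intro x hx y hy hxy
    simpa only [mul_assoc] using hV.antitoneOn_viscFlux hUF h hsign hB n (mul_pos (hs n) hx).le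
      (mul_pos (hs n) hy).le (mul_le_mul_of_nonneg_left hxy (hs n).le)
  · have hφ_int : Integrable φ volHalf :=
      (hφ.smooth.continuous.integrable_of_hasCompactSupport hφ.compact).restrict
    have hφ'_int : Integrable (deriv φ) volHalf :=
      (hφ.deriv.smooth.continuous.integrable_of_hasCompactSupport hφ.deriv.compact).restrict
    have hlimF := h.tendsto_solAvg hs hκ hFc (fun n x t hx ht => hB' _ (hV.mem n x t hx ht)) hφ_int
    have hlimU := h.tendsto_solAvg hs hκ hUc (fun n x t hx ht => hB _ (hV.mem n x t hx ht)) hφ'_int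
    exact (hlimF.add (hr.mul hlimU)).congr fun n => ((hV.sol n).integral_viscFlux_mul hV.isOpen
      (hV.eps_pos n).ne' hUF (h.pos n) (h.mem n).2.le (h.pairing n).integrable (hs n) hφ).symm

end ViscousFamily

end ViscousFamilies

section YoungMeasureCompactness

variable {Ω E : Type*} [MeasurableSpace Ω] [MeasurableSpace E] {m : Measure Ω} {K : Set E}

theorem isClosed_setOf_apply_eq_zero [TopologicalSpace E] [OpensMeasurableSpace E]
    [HasOuterApproxClosed E] {G : Set E} (hG : IsOpen G) :
    IsClosed {M : ProbabilityMeasure E | (M : Measure E) G = 0} := by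
  refine isClosed_iff_ultrafilter.2 fun M 𝓕 hM hmem => le_antisymm ?_ zero_le
  have hle := ProbabilityMeasure.le_liminf_measure_open_of_tendsto (L := (𝓕 : Filter _)) (μs := id)
    (tendsto_id'.2 hM) hG
  have hzero : Tendsto (fun M' : ProbabilityMeasure E => (M' : Measure E) G) 𝓕 (𝓝 0) :=
    tendsto_const_nhds.congr' (Filter.mem_of_superset hmem fun _ h => Eq.symm h)
  exact hle.trans_eq hzero.liminf_eq

theorem exists_kernel_compProd_eq [StandardBorelSpace E] {M : Measure (Ω × E)}
    [IsFiniteMeasure M] (hK : MeasurableSet K) (hne : K.Nonempty) (hM : M.snd Kᶜ = 0) :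
    ∃ κ : Kernel Ω E, IsMarkovKernel κ ∧ (∀ t, κ t Kᶜ = 0) ∧ M.fst ⊗ₘ κ = M := by
  obtain ⟨k, hk⟩ := hne
  have : Nonempty E := ⟨k⟩
  have hE : MeasurableSet {t | M.condKernel t Kᶜ = 0} :=
    M.condKernel.measurable_coe hK.compl (measurableSet_singleton 0)
  have hae : ∀ᵐ t ∂M.fst, M.condKernel t Kᶜ = 0 := by
    rw [Measure.snd_apply hK.compl, ← M.disintegrate M.condKernel,
      Measure.compProd_apply (measurable_snd hK.compl), lintegral_eq_zero_iff
        (Kernel.measurable_kernel_prodMk_left (measurable_snd hK.compl))] at hM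
    exact hM
  classical
  let κ := Kernel.piecewise hE M.condKernel (Kernel.const Ω (Measure.dirac k))
  have hκ : IsMarkovKernel κ := inferInstanceAs (IsMarkovKernel (Kernel.piecewise _ _ _))
  refine ⟨κ, hκ, fun t => ?_, ?_⟩
  · rw [Kernel.piecewise_apply]
    split_ifs with ht
    · exact ht
    · rw [Kernel.const_apply, Measure.dirac_apply' _ hK.compl,
        indicator_of_notMem (notMem_compl_iff.2 hk)]
  · rw [Measure.compProd_congr (κ := κ) (η := M.condKernel) (hae.mono fun t ht => if_pos ht),
      M.disintegrate]

theorem aestronglyMeasurable_integral_kernel [TopologicalSpace E] [BorelSpace E]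
    (κ : Kernel Ω E) (g : E →ᵇ ℝ) :
    AEStronglyMeasurable (fun t => ∫ z, g z ∂(κ t)) m :=
  (g.continuous.measurable.stronglyMeasurable.integral_kernel (κ := κ)).aestronglyMeasurable

theorem abs_integral_kernel_le [TopologicalSpace E] (κ : Kernel Ω E) [IsMarkovKernel κ]
    (g : E →ᵇ ℝ) (t : Ω) : |∫ z, g z ∂(κ t)| ≤ ‖g‖ :=
  abs_integral_le_of_compl_eq_zero (K := univ) (by simp) fun z _ => g.norm_coe_le_norm z

variable [TopologicalSpace Ω] [PolishSpace Ω] [BorelSpace Ω]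

theorem tendsto_integral_mul_of_forall_boundedContinuous [IsFiniteMeasure m] {ι : Type*}
    {l : Filter ι} {a : ι → Ω → ℝ} {a₀ : Ω → ℝ} {C : ℝ} (ha : ∀ i, AEStronglyMeasurable (a i) m)
    (ha₀ : AEStronglyMeasurable a₀ m) (hC : ∀ i t, |a i t| ≤ C) (hC₀ : ∀ t, |a₀ t| ≤ C)
    (hlim : ∀ h : Ω →ᵇ ℝ, Tendsto (fun i => ∫ t, a i t * h t ∂m) l (𝓝 (∫ t, a₀ t * h t ∂m)))
    {h : Ω → ℝ} (hh : Integrable h m) :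
    Tendsto (fun i => ∫ t, a i t * h t ∂m) l (𝓝 (∫ t, a₀ t * h t ∂m)) := by
  rw [Metric.tendsto_nhds]
  intro e he
  obtain ⟨h', hh', hh'_int⟩ := hh.exists_boundedContinuous_integral_sub_le
    (ε := e / (4 * (|C| + 1))) (by positivity)
  have happrox : ∀ {b : Ω → ℝ}, AEStronglyMeasurable b m → (∀ t, |b t| ≤ C) →
      |(∫ t, b t * h t ∂m) - ∫ t, b t * h' t ∂m| ≤ e / 4 := fun {b} hb hbC => by
    have hint : ∀ {g : Ω → ℝ}, Integrable g m → Integrable (fun t => b t * g t) m := fun hg =>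
      hg.bdd_mul hb (ae_of_all _ hbC)
    calc |(∫ t, b t * h t ∂m) - ∫ t, b t * h' t ∂m|
        = ‖∫ t, (b t * h t - b t * h' t) ∂m‖ := by
          rw [integral_sub (hint hh) (hint hh'_int), Real.norm_eq_abs]
      _ ≤ ∫ t, (|C| + 1) * ‖h t - h' t‖ ∂m := by
          refine norm_integral_le_of_norm_le ((hh.sub hh'_int).norm.const_mul _)
            (ae_of_all _ fun t => ?_)
          rw [← mul_sub, norm_mul]
          exact mul_le_mul_of_nonneg_right ((hbC t).trans (by linarith [le_abs_self C]))
            (norm_nonneg _)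
      _ ≤ (|C| + 1) * (e / (4 * (|C| + 1))) := by
          rw [integral_const_mul]
          gcongr
      _ = e / 4 := by field_simp
  filter_upwards [Metric.tendsto_nhds.1 (hlim h') (e / 4) (by linarith)] with i hi
  have hleft := abs_le.1 (happrox (ha i) (hC i))
  have hright := abs_le.1 (happrox ha₀ hC₀)
  rw [Real.dist_eq, abs_lt] at hi ⊢
  constructor <;> linarith [hleft.1, hleft.2, hright.1, hright.2, hi.1, hi.2]

variable [TopologicalSpace E] [PolishSpace E] [BorelSpace E]

theorem isCompact_setOf_fst_eq_and_snd_compl_eq_zero (m : Measure Ω) [IsProbabilityMeasure m]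
    (hK : IsCompact K) :
    IsCompact {M : ProbabilityMeasure (Ω × E) |
      (M : Measure (Ω × E)).fst = m ∧ (M : Measure (Ω × E)).snd Kᶜ = 0} := by
  set S := {M : ProbabilityMeasure (Ω × E) |
      (M : Measure (Ω × E)).fst = m ∧ (M : Measure (Ω × E)).snd Kᶜ = 0}
  have htight : IsTightMeasureSet {M : Measure (Ω × E) | ∃ M' ∈ S, (M' : Measure (Ω × E)) = M} := by
    refine IsTightMeasureSet.prodMk ((isTightMeasureSet_singleton (μ := m)).subset ?_)
      (isTightMeasureSet_iff_exists_isCompact_measure_compl_le.2 fun e _ => ⟨K, hK, ?_⟩)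
    · rintro _ ⟨_, ⟨M, hM, rfl⟩, rfl⟩
      exact hM.1
    · rintro _ ⟨_, ⟨M, hM, rfl⟩, rfl⟩
      exact hM.2.trans_le zero_le
  have hfst : IsClosed {M : ProbabilityMeasure (Ω × E) | (M : Measure (Ω × E)).fst = m} := by
    let m' : ProbabilityMeasure Ω := ⟨m, inferInstance⟩
    have hclosed := (isClosed_singleton (x := m')).preimage
      (ProbabilityMeasure.continuous_map (Ω := Ω × E) continuous_fst)
    convert hclosed using 1
    exact Set.ext fun M => ⟨fun h => Subtype.ext h, congrArg Subtype.val⟩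
  have hsnd : IsClosed {M : ProbabilityMeasure (Ω × E) | (M : Measure (Ω × E)).snd Kᶜ = 0} := by
    simpa only [Measure.snd_apply hK.measurableSet.compl] using isClosed_setOf_apply_eq_zero
      (hK.isClosed.isOpen_compl.preimage (continuous_snd (X := Ω)))
  have hS : IsClosed S := hfst.inter hsnd
  exact hS.closure_eq ▸ isCompact_closure_of_isTightMeasureSet htight

theorem integral_compProd_boundedContinuous [IsFiniteMeasure m] (κ : Kernel Ω E)
    [IsMarkovKernel κ] (g : E →ᵇ ℝ) (h : Ω →ᵇ ℝ) :
    ∫ p, (g.compContinuous .snd * h.compContinuous .fst : Ω × E →ᵇ ℝ) p ∂(m ⊗ₘ κ)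
      = ∫ t, (∫ z, g z ∂(κ t)) * h t ∂m := by
  rw [Measure.integral_compProd (BoundedContinuousFunction.integrable _ _)]
  exact integral_congr_ae (ae_of_all _ fun t => integral_mul_const (h t) g)

theorem exists_kernel_limit_of_isProbabilityMeasure [IsProbabilityMeasure m] {ι : Type*}
    (𝓕 : Ultrafilter ι) (κs : ι → Kernel Ω E) [∀ i, IsMarkovKernel (κs i)]
    (hK : IsCompact K) (hne : K.Nonempty) (hsupp : ∀ᶠ i in 𝓕, ∀ᵐ t ∂m, κs i t Kᶜ = 0) :
    ∃ κ₀ : Kernel Ω E, IsMarkovKernel κ₀ ∧ (∀ t, κ₀ t Kᶜ = 0) ∧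
      ∀ (g : E →ᵇ ℝ) (h : Ω → ℝ), Integrable h m →
        Tendsto (fun i => ∫ t, (∫ z, g z ∂(κs i t)) * h t ∂m) 𝓕
          (𝓝 (∫ t, (∫ z, g z ∂(κ₀ t)) * h t ∂m)) := by
  have hKm : MeasurableSet Kᶜ := hK.measurableSet.compl
  let Ms : ι → ProbabilityMeasure (Ω × E) := fun i => ⟨m ⊗ₘ κs i, inferInstance⟩
  have hMs : ∀ᶠ i in 𝓕, (Ms i : Measure (Ω × E)).fst = m ∧ (Ms i : Measure (Ω × E)).snd Kᶜ = 0 := by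
    filter_upwards [hsupp] with i hi
    refine ⟨Measure.fst_compProd m (κs i), ?_⟩
    change (m ⊗ₘ κs i).snd Kᶜ = 0
    rw [Measure.snd_apply hKm, Measure.compProd_apply (measurable_snd hKm)]
    exact (lintegral_congr_ae hi).trans lintegral_zero
  obtain ⟨M, ⟨hfst, hsnd⟩, hM⟩ :=
    (isCompact_setOf_fst_eq_and_snd_compl_eq_zero m hK).ultrafilter_le_nhds (𝓕.map Ms)
      (le_principal_iff.2 hMs)
  obtain ⟨κ₀, hκ₀, hκ₀K, hdis⟩ := exists_kernel_compProd_eq hK.measurableSet hne hsnd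
  rw [hfst] at hdis
  refine ⟨κ₀, hκ₀, hκ₀K, fun g h hh => ?_⟩
  refine tendsto_integral_mul_of_forall_boundedContinuous
    (fun i => aestronglyMeasurable_integral_kernel (κs i) g)
    (aestronglyMeasurable_integral_kernel κ₀ g) (fun i => abs_integral_kernel_le (κs i) g)
    (abs_integral_kernel_le κ₀ g) (fun h => ?_) hh
  have hMs_lim : Tendsto Ms 𝓕 (𝓝 M) := hM
  have hweak := ProbabilityMeasure.tendsto_iff_forall_integral_tendsto.1 hMs_lim
    (g.compContinuous .snd * h.compContinuous .fst)
  rw [← hdis, integral_compProd_boundedContinuous] at hweak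
  exact hweak.congr fun i => integral_compProd_boundedContinuous (κs i) g h

theorem exists_kernel_limit [SigmaFinite m] [NeZero m] {ι : Type*} (𝓕 : Ultrafilter ι)
    (κs : ι → Kernel Ω E) [∀ i, IsMarkovKernel (κs i)] (hK : IsCompact K) (hne : K.Nonempty)
    (hsupp : ∀ᶠ i in 𝓕, ∀ᵐ t ∂m, κs i t Kᶜ = 0) :
    ∃ κ₀ : Kernel Ω E, IsMarkovKernel κ₀ ∧ (∀ t, κ₀ t Kᶜ = 0) ∧
      ∀ (g : E →ᵇ ℝ) (h : Ω → ℝ), Integrable h m →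
        Tendsto (fun i => ∫ t, (∫ z, g z ∂(κs i t)) * h t ∂m) 𝓕
          (𝓝 (∫ t, (∫ z, g z ∂(κ₀ t)) * h t ∂m)) := by
  have hac : m ≪ m.toFinite := absolutelyContinuous_toFinite m
  obtain ⟨κ₀, hκ₀, hκ₀K, hlim⟩ := exists_kernel_limit_of_isProbabilityMeasure (m := m.toFinite) 𝓕 κs
    hK hne (hsupp.mono fun i hi => (toFinite_absolutelyContinuous m).ae_le hi)
  refine ⟨κ₀, hκ₀, hκ₀K, fun g h hh => ?_⟩
  have hdensity := hlim g (fun t => (m.rnDeriv m.toFinite t).toReal • h t)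
    ((integrable_rnDeriv_smul_iff hac).2 hh)
  simpa only [mul_smul_comm, integral_rnDeriv_smul hac] using hdensity

end YoungMeasureCompactness

section TraceFilter

theorem eventually_traceFilter {p : ℝ → Prop} (h : ∀ᵐ x ∂volHalf, p x) :
    ∀ᶠ x in 𝓝[>] (0 : ℝ) ⊓ ae volume, p x := by
  rw [ae_restrict_iff' measurableSet_Ioi] at h
  filter_upwards [inf_le_left (a := 𝓝[>] (0 : ℝ)) self_mem_nhdsWithin,
    inf_le_right (a := 𝓝[>] (0 : ℝ)) h] with x hx hp using hp hx

instance traceFilter_neBot : (𝓝[>] (0 : ℝ) ⊓ ae volume).NeBot := by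
  refine inf_neBot_iff.2 fun {s} hs {t} ht => ?_
  obtain ⟨δ, hδ, hsub⟩ := mem_nhdsGT_iff_exists_Ioo_subset.1 hs
  by_contra hne
  have hzero : volume (Ioo 0 δ) = 0 :=
    measure_mono_null (fun x hx hxt => hne ⟨x, hsub hx, hxt⟩) (mem_ae_iff.1 ht)
  rw [Real.volume_Ioo, ENNReal.ofReal_eq_zero, sub_zero] at hzero
  exact hzero.not_gt hδ

instance volHalf_neZero : NeZero volHalf :=
  ⟨fun h => by simp [Measure.restrict_eq_zero, Real.volume_Ioi] at h⟩

end TraceFilter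

section Traces

variable {N : ℕ} {K : Set (State N)} {g : State N → ℝ}

theorem exists_boundedContinuous_eqOn (hK : IsCompact K) (hg : ContinuousOn g K) :
    ∃ g' : State N →ᵇ ℝ, EqOn g' g K := by
  have := isCompact_iff_compactSpace.1 hK
  obtain ⟨g', -, hg'⟩ := BoundedContinuousFunction.exists_norm_eq_domRestrict_eq_of_closed
    (BoundedContinuousFunction.mkOfCompact ⟨K.domRestrict g, hg.domRestrict⟩) hK.isClosed
  exact ⟨g', fun z hz => DFunLike.congr_fun hg' ⟨z, hz⟩⟩

theorem integral_congr_of_eqOn {m : Measure (State N)} (hm : m Kᶜ = 0) {g' : State N → ℝ}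
    (h : EqOn g g' K) : ∫ z, g z ∂m = ∫ z, g' z ∂m := by
  refine integral_congr_ae ?_
  filter_upwards [measure_eq_zero_iff_ae_notMem.1 hm] with z hz using h (not_not.1 hz)

theorem exists_trace_along {κ : Kernel (ℝ × ℝ) (State N)} [IsMarkovKernel κ] (hK : IsCompact K)
    (hne : K.Nonempty) (hsupp : ∀ᵐ p ∂volQuarter, κ p Kᶜ = 0) :
    ∃ κ₀ : Kernel ℝ (State N), IsMarkovKernel κ₀ ∧ (∀ t, κ₀ t Kᶜ = 0) ∧
      ∃ 𝓕 : Ultrafilter ℝ, ↑𝓕 ≤ 𝓝[>] (0 : ℝ) ⊓ ae volume ∧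
        ∀ g : State N → ℝ, ContinuousOn g K → ∀ (θ : ℝ → ℝ) (T₁ T₂ : ℝ), 0 ≤ T₁ → T₁ < T₂ →
          IntegrableOn θ (Ioc T₁ T₂) → Tendsto (timeAvg κ g θ T₁ T₂) 𝓕
            (𝓝 (∫ t in T₁..T₂, (∫ w, g w ∂(κ₀ t)) * θ t)) := by
  let 𝓕 := Ultrafilter.of (𝓝[>] (0 : ℝ) ⊓ ae volume)
  have h𝓕 : ↑𝓕 ≤ 𝓝[>] (0 : ℝ) ⊓ ae volume := Ultrafilter.of_le _
  rw [volQuarter_eq_prod] at hsupp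
  have hslice : ∀ᶠ x in (𝓕 : Filter ℝ), ∀ᵐ t ∂volHalf, κ (x, t) Kᶜ = 0 :=
    h𝓕 (eventually_traceFilter (Measure.ae_ae_of_ae_prod hsupp))
  obtain ⟨κ₀, hκ₀, hκ₀K, hlim⟩ := exists_kernel_limit (m := volHalf) 𝓕
    (fun x => κ.comap (fun t => (x, t)) measurable_prodMk_left) hK hne hslice
  refine ⟨κ₀, hκ₀, hκ₀K, 𝓕, h𝓕, fun g hg θ T₁ T₂ h0 h hθ => ?_⟩
  obtain ⟨g', hg'⟩ := exists_boundedContinuous_eqOn hK hg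
  have hθ' : Integrable ((Ioc T₁ T₂).indicator θ) volHalf :=
    (hθ.integrable_indicator measurableSet_Ioc).restrict
  have hlim' := hlim g' _ hθ'
  simp only [integral_congr_of_eqOn (hκ₀K _) hg'] at hlim'
  rw [intervalIntegral_eq_indicator h0 h.le]
  refine hlim'.congr' ?_
  filter_upwards [hslice] with x hx
  rw [timeAvg, intervalIntegral_eq_indicator h0 h.le]
  refine integral_congr_ae ?_
  filter_upwards [hx] with t ht
  rw [Kernel.comap_apply, integral_congr_of_eqOn ht hg']

end Traces

section TimeAverages

variable {N : ℕ} {𝒰 : Set (State N)} {w : ℕ → ℝ × ℝ → State N} {κ : Kernel (ℝ × ℝ) (State N)}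
  {g : State N → ℝ} {θ θ' : ℝ → ℝ} {T₁ T₂ : ℝ}

namespace IsYoungMeasure

theorem exists_slice_bound (hκ : IsYoungMeasure 𝒰 w κ) (hg : ContinuousOn g 𝒰) :
    ∃ C, 0 ≤ C ∧ ∀ᵐ z ∂volHalf, ∀ (θ : ℝ → ℝ) (T₁ T₂ : ℝ), 0 ≤ T₁ → T₁ ≤ T₂ →
      IntegrableOn θ (Ioc T₁ T₂) →
      IntervalIntegrable (fun t => (∫ v, g v ∂(κ (z, t))) * θ t) volume T₁ T₂ ∧
      |timeAvg κ g θ T₁ T₂ z| ≤ C * ∫ t in T₁..T₂, |θ t| := by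
  have hmem := (hκ.weakStar g hg).memLp_limit
  have hbound := ae_norm_le_of_memLp_top hmem
  have hmeas := hmem.aestronglyMeasurable
  set C := (eLpNorm (fun p => ∫ v, g v ∂(κ p)) ⊤ volQuarter).toReal with hC
  rw [volQuarter_eq_prod] at hbound hmeas
  refine ⟨C, ENNReal.toReal_nonneg, ?_⟩
  filter_upwards [hmeas.prodMk_left, Measure.ae_ae_of_ae_prod hbound]
    with z hz_meas hz_bound θ T₁ T₂ h0 h hθ
  have hsub : Ioc T₁ T₂ ⊆ Ioi 0 := fun t ht => h0.trans_lt ht.1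
  have hslice := ae_restrict_of_ae_restrict_of_subset hsub hz_bound
  refine ⟨(intervalIntegrable_iff_integrableOn_Ioc_of_le h).2
    (Integrable.bdd_mul (c := C) hθ (hz_meas.mono_set hsub) hslice), ?_⟩
  rw [timeAvg, intervalIntegral.integral_of_le h, intervalIntegral.integral_of_le h,
    ← integral_const_mul, ← Real.norm_eq_abs]
  refine norm_integral_le_of_norm_le (hθ.norm.const_mul C) ?_
  filter_upwards [hslice] with t ht
  rw [norm_mul]
  exact mul_le_mul_of_nonneg_right ht (norm_nonneg _)

theorem aestronglyMeasurable_timeAvg (hκ : IsYoungMeasure 𝒰 w κ) (hg : ContinuousOn g 𝒰)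
    (h0 : 0 ≤ T₁) (h : T₁ ≤ T₂) (hθ : IntegrableOn θ (Ioc T₁ T₂)) :
    AEStronglyMeasurable (timeAvg κ g θ T₁ T₂) volHalf := by
  have hmeas := (hκ.weakStar g hg).memLp_limit.aestronglyMeasurable
  rw [volQuarter_eq_prod] at hmeas
  have hind : AEStronglyMeasurable ((Ioc T₁ T₂).indicator θ) volHalf :=
    (hθ.integrable_indicator measurableSet_Ioc).aestronglyMeasurable.restrict
  exact (hmeas.mul (hind.comp_snd (μ := volHalf))).integral_prod_right'.congr
    (ae_of_all _ fun _ => (intervalIntegral_eq_indicator h0 h).symm)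

theorem integrableOn_timeAvg_mul (hκ : IsYoungMeasure 𝒰 w κ) (hg : ContinuousOn g 𝒰)
    (h0 : 0 ≤ T₁) (h : T₁ ≤ T₂) (hθ : IntegrableOn θ (Ioc T₁ T₂)) {s : Set ℝ} (hs : s ⊆ Ioi 0)
    {φ : ℝ → ℝ} (hφ : IntegrableOn φ s) :
    IntegrableOn (fun y => timeAvg κ g θ T₁ T₂ y * φ y) s := by
  obtain ⟨C, -, hC⟩ := hκ.exists_slice_bound hg
  refine hφ.bdd_mul (c := C * ∫ t in T₁..T₂, |θ t|)
    ((hκ.aestronglyMeasurable_timeAvg hg h0 h hθ).mono_set hs) ?_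
  filter_upwards [ae_restrict_of_ae_restrict_of_subset hs hC] with z hz
    using (hz θ T₁ T₂ h0 h hθ).2

theorem integrableOn_timeAvg (hκ : IsYoungMeasure 𝒰 w κ) (hg : ContinuousOn g 𝒰)
    (h0 : 0 ≤ T₁) (h : T₁ ≤ T₂) (hθ : IntegrableOn θ (Ioc T₁ T₂)) {s : Set ℝ} (hs : s ⊆ Ioi 0)
    (hs' : volume s ≠ ⊤) : IntegrableOn (timeAvg κ g θ T₁ T₂) s := by
  simpa only [mul_one] using
    hκ.integrableOn_timeAvg_mul hg h0 h hθ hs (integrableOn_const (C := (1 : ℝ)) hs')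

theorem locallyIntegrableOn_timeAvg (hκ : IsYoungMeasure 𝒰 w κ) (hg : ContinuousOn g 𝒰)
    (h0 : 0 ≤ T₁) (h : T₁ ≤ T₂) (hθ : IntegrableOn θ (Ioc T₁ T₂)) :
    LocallyIntegrableOn (timeAvg κ g θ T₁ T₂) (Ioi 0) :=
  (locallyIntegrableOn_iff isOpen_Ioi.isLocallyClosed).2 fun _ hk hkc =>
    hκ.integrableOn_timeAvg hg h0 h hθ hk hkc.measure_lt_top.ne

theorem timeAvg_sub_ae (hκ : IsYoungMeasure 𝒰 w κ) (hg : ContinuousOn g 𝒰) (h0 : 0 ≤ T₁)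
    (h : T₁ ≤ T₂) (hθ : IntegrableOn θ (Ioc T₁ T₂)) (hθ' : IntegrableOn θ' (Ioc T₁ T₂)) :
    timeAvg κ g (fun t => θ t - θ' t) T₁ T₂
      =ᵐ[volHalf] fun z => timeAvg κ g θ T₁ T₂ z - timeAvg κ g θ' T₁ T₂ z := by
  obtain ⟨C, -, hC⟩ := hκ.exists_slice_bound hg
  filter_upwards [hC] with z hz
  simp only [timeAvg, mul_sub]
  exact intervalIntegral.integral_sub (hz θ T₁ T₂ h0 h hθ).1 (hz θ' T₁ T₂ h0 h hθ').1

end IsYoungMeasure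

theorem IsLayerFlux.eq {μ : Kernel (ℝ × ℝ) (State N)} {U F : State N → ℝ} {G G' : ℝ → ℝ}
    (hG : IsLayerFlux μ U F θ T₁ T₂ G) (hG' : IsLayerFlux μ U F θ T₁ T₂ G') (h : IsBV G)
    (h' : IsBV G') {y : ℝ} (hy : 0 < y) : G y = G' y := by
  refine eq_of_ae_eq_of_continuousWithinAt_Ici (h.right_continuous y hy) (h'.right_continuous y hy)
    (ae_eq_of_forall_isTest h.locallyIntegrableOn h'.locallyIntegrableOn fun φ hφ => ?_) hy
  rw [← hG φ hφ.smooth hφ.compact hφ.supp, hG' φ hφ.smooth hφ.compact hφ.supp]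

end TimeAverages

section LimitFluxes

variable {N : ℕ} {𝒰 K : Set (State N)} {f : State N → State N} {ε : ℕ → ℝ}
  {uIε uBε : ℕ → ℝ → State N} {u : ℕ → ℝ → ℝ → State N} {U F : State N → ℝ}
  {ν μ : Kernel (ℝ × ℝ) (State N)} {ψn : ℕ → ℝ → ℝ} {ψ : ℝ → ℝ} {a : ℕ → ℝ} {T₁ T₂ M B : ℝ}

namespace ViscousFamily

theorem exists_interior_flux (hV : ViscousFamily 𝒰 K f ε uIε uBε u)
    (hν : IsYoungMeasure 𝒰 (fun n p => u n p.1 p.2) ν) (hUF : IsEntropyPair 𝒰 f U F)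
    (h : TestSeq ψn ψ a T₁ T₂ M)
    (hsign : ∀ n, ∀ w ∈ 𝒰, ∀ z, ∀ t, 0 < t → 0 ≤ fderiv ℝ (fderiv ℝ U) w z z * ψn n t)
    (hB : ∀ z ∈ K, |U z| ≤ B) :
    ∃ g : ℝ → ℝ, AlmostAntitone g (M * B) ∧
      (∀ᵐ x ∂volHalf, Tendsto (fun n => viscFlux (ε n) (u n) U F (ψn n) (a n) T₂ x) atTop
        (𝓝 (g x))) ∧
      timeAvg ν F ψ T₁ T₂ =ᵐ[volHalf] g ∧ ∃ C, ∀ x, 0 < x → |g x| ≤ C := by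
  have hF := hUF.contDiffOn_flux.continuousOn
  obtain ⟨g, hg, hlim, hdistrib⟩ := hV.exists_viscFlux_limit hUF h hsign hB (s := fun _ => 1)
    (fun _ => one_pos) tendsto_const_nhds (r := 0) (by simpa only [div_one] using hV.eps_tendsto)
    (κ := ν) (by simpa only [one_mul] using hν)
  simp only [mul_one, one_mul, zero_mul, add_zero] at hg hlim hdistrib
  have hae : timeAvg ν F ψ T₁ T₂ =ᵐ[volHalf] g :=
    ae_eq_of_forall_isTest (hν.locallyIntegrableOn_timeAvg hF h.nonneg h.lt.le h.integrableOn)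
      hg.locallyIntegrableOn hdistrib
  obtain ⟨C, -, hC⟩ := hν.exists_slice_bound hF
  have hbound : ∀ᵐ x ∂volHalf, |g x| ≤ C * ∫ t in T₁..T₂, |ψ t| := by
    filter_upwards [hae, hC] with x hx hx_bound
    exact hx ▸ (hx_bound ψ T₁ T₂ h.nonneg h.lt.le h.integrableOn).2
  exact ⟨g, hg, hlim, hae, _, fun x hx => le_of_ae_le_of_continuousWithinAt_Ici
    (hg.right_continuous x hx).abs continuousWithinAt_const hbound hx⟩

theorem exists_layer_flux (hV : ViscousFamily 𝒰 K f ε uIε uBε u)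
    (hμ : IsYoungMeasure 𝒰 (fun n p => u n (ε n * p.1) p.2) μ) (hUF : IsEntropyPair 𝒰 f U F)
    (h : TestSeq ψn ψ a T₁ T₂ M)
    (hsign : ∀ n, ∀ w ∈ 𝒰, ∀ z, ∀ t, 0 < t → 0 ≤ fderiv ℝ (fderiv ℝ U) w z z * ψn n t)
    (hB : ∀ z ∈ K, |U z| ≤ B) :
    ∃ G : ℝ → ℝ, AlmostAntitone G 0 ∧
      (∀ᵐ y ∂volHalf, Tendsto (fun n => viscFlux (ε n) (u n) U F (ψn n) (a n) T₂ (ε n * y)) atTop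
        (𝓝 (G y))) ∧ IsLayerFlux μ U F ψ T₁ T₂ G := by
  obtain ⟨G, hG, hlim, hdistrib⟩ := hV.exists_viscFlux_limit hUF h hsign hB (s := ε)
    hV.eps_pos hV.eps_tendsto (r := 1)
    (tendsto_const_nhds.congr fun n => (div_self (hV.eps_pos n).ne').symm) hμ
  rw [mul_zero] at hG
  refine ⟨G, hG, hlim, fun φ smooth compact supp => ?_⟩
  have hφ : IsTest (Ioi 0) φ := ⟨smooth, compact, supp⟩
  have hint : ∀ {g : State N → ℝ} {χ : ℝ → ℝ}, ContinuousOn g 𝒰 → IsTest (Ioi 0) χ →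
      IntegrableOn (fun y => timeAvg μ g ψ T₁ T₂ y * χ y) (Ioi 0) := fun hg hχ =>
    hχ.integrableOn_mul (hμ.locallyIntegrableOn_timeAvg hg h.nonneg h.lt.le h.integrableOn)
  rw [← hdistrib φ hφ, one_mul]
  exact integral_add (hint hUF.contDiffOn_flux.continuousOn hφ)
    (hint hUF.contDiffOn_entropy.continuousOn hφ.deriv)

end ViscousFamily

end LimitFluxes

section FluxTraces

variable {N : ℕ} {𝒰 K : Set (State N)} {f : State N → State N} {ε : ℕ → ℝ}
  {uIε uBε : ℕ → ℝ → State N} {u : ℕ → ℝ → ℝ → State N} {U F : State N → ℝ}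
  {ν : Kernel (ℝ × ℝ) (State N)} {θ : ℝ → ℝ} {T₁ T₂ : ℝ}

theorem IsConvexEntropyPair.hessian_mul_nonneg (hUF : IsConvexEntropyPair 𝒰 f U F)
    (hθ : ∀ t, 0 < t → 0 ≤ θ t) : ∀ w ∈ 𝒰, ∀ z, ∀ t, 0 < t →
      0 ≤ fderiv ℝ (fderiv ℝ U) w z z * θ t :=
  fun w hw z t ht => mul_nonneg (hUF.hessian_nonneg w hw z) (hθ t ht)

theorem IsBV.exists_eq_sub_nonneg (hθ : IsBV θ) : ∃ p q : ℝ → ℝ, IsBV p ∧ IsBV q ∧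
    (∀ t, 0 < t → 0 ≤ p t) ∧ (∀ t, 0 < t → 0 ≤ q t) ∧ θ = fun t => p t - q t := by
  obtain ⟨C, hC⟩ := hθ.bounded
  refine ⟨_, _, hθ.sub (isBV_const (-C)), isBV_const C, fun t ht => ?_,
    fun t ht => (norm_nonneg _).trans (hC t ht), by ext t; simp⟩
  simp only [Pi.sub_apply]
  linarith [(abs_le.1 (hC t ht)).1]

namespace ViscousFamily

theorem exists_interior_isBV (hV : ViscousFamily 𝒰 K f ε uIε uBε u)
    (hν : IsYoungMeasure 𝒰 (fun n p => u n p.1 p.2) ν) (hUF : IsConvexEntropyPair 𝒰 f U F)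
    (hθ : IsBV θ) (h0 : 0 ≤ T₁) (h : T₁ < T₂) :
    ∃ g : ℝ → ℝ, IsBV g ∧ timeAvg ν F θ T₁ T₂ =ᵐ[volHalf] g ∧ ∃ l, Tendsto g (𝓝[>] 0) (𝓝 l) := by
  have of_nonneg : ∀ {θ : ℝ → ℝ}, IsBV θ → (∀ t, 0 < t → 0 ≤ θ t) → ∃ g : ℝ → ℝ, IsBV g ∧
      timeAvg ν F θ T₁ T₂ =ᵐ[volHalf] g ∧ ∃ l, Tendsto g (𝓝[>] 0) (𝓝 l) := fun hθ hpos => by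
    obtain ⟨M, hM⟩ := hθ.exists_testSeq h0 h
    obtain ⟨B, -, hB⟩ := hV.exists_bound hUF.contDiffOn_entropy.continuousOn
    obtain ⟨g, hg, -, hae, C, hC⟩ := hV.exists_interior_flux hν hUF.toIsEntropyPair hM
      (fun _ => hUF.hessian_mul_nonneg hpos) hB
    exact ⟨g, hg.isBV hC, hae, hg.exists_tendsto_nhdsGT hC⟩
  obtain ⟨p, q, hp, hq, hp_pos, hq_pos, rfl⟩ := hθ.exists_eq_sub_nonneg
  obtain ⟨gp, hgp, hgp_ae, lp, hlp⟩ := of_nonneg hp hp_pos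
  obtain ⟨gq, hgq, hgq_ae, lq, hlq⟩ := of_nonneg hq hq_pos
  exact ⟨gp - gq, hgp.sub hgq,
    (hν.timeAvg_sub_ae hUF.contDiffOn_flux.continuousOn h0 h.le (hp.integrableOn h0)
      (hq.integrableOn h0)).trans (hgp_ae.sub hgq_ae), lp - lq, hlp.sub hlq⟩

theorem nonempty (hV : ViscousFamily 𝒰 K f ε uIε uBε u) : K.Nonempty :=
  ⟨u 0 0 0, hV.mem 0 0 0 le_rfl le_rfl⟩

theorem exists_fluxTrace (hV : ViscousFamily 𝒰 K f ε uIε uBε u)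
    (hν : IsYoungMeasure 𝒰 (fun n p => u n p.1 p.2) ν) :
    ∃ ν₀ : Kernel ℝ (State N), IsFluxTrace 𝒰 f ν ν₀ := by
  have := hν.markov
  obtain ⟨ν₀, hν₀, hν₀K, 𝓕, h𝓕, hlim⟩ := exists_trace_along (κ := ν) hV.compact hV.nonempty
    (hν.ae_compl_eq_zero hV.compact.isClosed
      fun n p hp => hV.mem n p.1 p.2 (le_of_lt hp.1) (le_of_lt hp.2))
  refine ⟨ν₀, ⟨hν₀, K, hV.compact, hV.subset, fun t _ => hν₀K t⟩, fun U F hUF θ hθ T₁ T₂ h0 h => ?_⟩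
  obtain ⟨g, -, hae, l, hl⟩ := hV.exists_interior_isBV hν hUF hθ h0 h
  have htrace : Tendsto (timeAvg ν F θ T₁ T₂) (𝓝[>] (0 : ℝ) ⊓ ae volume) (𝓝 l) :=
    (hl.mono_left inf_le_left).congr' (eventually_traceFilter (EventuallyEq.symm hae))
  have hlim' := hlim F (hUF.contDiffOn_flux.continuousOn.mono hV.subset) θ T₁ T₂ h0 h
    (hθ.integrableOn h0)
  rwa [HasTraceOn, tendsto_nhds_unique hlim' (htrace.mono_left h𝓕)]

end ViscousFamily

theorem fderiv_coord (j : Fin N) :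
    fderiv ℝ (fun w : State N => w j) = fun _ => (EuclideanSpace.proj j : State N →L[ℝ] ℝ) :=
  funext fun _ => (EuclideanSpace.proj (𝕜 := ℝ) j).hasFDerivAt.fderiv

theorem hessian_coord (j : Fin N) (w z : State N) :
    fderiv ℝ (fderiv ℝ (fun w : State N => w j)) w z z = 0 := by
  simp [fderiv_coord]

theorem isConvexEntropyPair_coord (h𝒰 : IsOpen 𝒰) (hf : ContDiffOn ℝ 2 f 𝒰) (j : Fin N) :
    IsConvexEntropyPair 𝒰 f (fun w => w j) (fun w => f w j) where
  contDiffOn_entropy := (EuclideanSpace.proj (𝕜 := ℝ) j).contDiff.contDiffOn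
  contDiffOn_flux := (EuclideanSpace.proj (𝕜 := ℝ) j).contDiff.comp_contDiffOn hf
  compatible w hw := by
    rw [fderiv_coord]
    exact ((EuclideanSpace.proj (𝕜 := ℝ) j).hasFDerivAt.comp w
      ((hf.differentiableOn two_ne_zero).differentiableAt (h𝒰.mem_nhds hw)).hasFDerivAt).fderiv
  hessian_nonneg w _ z := (hessian_coord j w z).ge

theorem viscFlux_neg (ε : ℝ) (u : ℝ → ℝ → State N) (U F : State N → ℝ) (ψ : ℝ → ℝ) (a b x : ℝ) :
    viscFlux ε u U F (fun t => -ψ t) a b x = -viscFlux ε u U F ψ a b x := by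
  simp only [viscFlux, mul_neg, intervalIntegral.integral_neg]

namespace ViscousFamily

variable {ψn : ℕ → ℝ → ℝ} {ψ : ℝ → ℝ} {a : ℕ → ℝ} {M B : ℝ}

theorem abs_viscFlux_coord_sub_le (hV : ViscousFamily 𝒰 K f ε uIε uBε u)
    (h : TestSeq ψn ψ a T₁ T₂ M) {j : Fin N} (hB : ∀ z ∈ K, |z j| ≤ B) (n : ℕ) {x : ℝ}
    (hx : 0 ≤ x) :
    |viscFlux (ε n) (u n) (fun w => w j) (fun w => f w j) (ψn n) (a n) T₂ x
      - viscFlux (ε n) (u n) (fun w => w j) (fun w => f w j) (ψn n) (a n) T₂ 0| ≤ M * B * x := by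
  have hP := (isConvexEntropyPair_coord hV.isOpen hV.smooth j).toIsEntropyPair
  have hupper := hV.antitoneOn_viscFlux hP h (fun n w _ z t _ => by rw [hessian_coord, zero_mul])
    hB n self_mem_Ici hx hx
  have hlower := hV.antitoneOn_viscFlux hP h.neg
    (fun n w _ z t _ => by rw [hessian_coord, zero_mul]) hB n self_mem_Ici hx hx
  simp only [viscFlux_neg] at hupper hlower
  rw [abs_le]
  constructor <;> linarith

theorem tendsto_viscFlux_coord_zero (hV : ViscousFamily 𝒰 K f ε uIε uBε u)
    (hν : IsYoungMeasure 𝒰 (fun n p => u n p.1 p.2) ν) {ν₀ : Kernel ℝ (State N)}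
    (hν₀ : IsFluxTrace 𝒰 f ν ν₀) (j : Fin N) (h : TestSeq ψn ψ a T₁ T₂ M) (hψ : IsBV ψ) :
    Tendsto (fun n => viscFlux (ε n) (u n) (fun w => w j) (fun w => f w j) (ψn n) (a n) T₂ 0) atTop
      (𝓝 (∫ t in T₁..T₂, (∫ w, f w j ∂(ν₀ t)) * ψ t)) := by
  have hP := isConvexEntropyPair_coord hV.isOpen hV.smooth j
  obtain ⟨B, -, hB⟩ := hV.exists_bound hP.contDiffOn_entropy.continuousOn
  obtain ⟨g, -, hlim, hae, -⟩ := hV.exists_interior_flux hν hP.toIsEntropyPair h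
    (fun n w _ z t _ => by rw [hessian_coord, zero_mul]) hB
  have hg : Tendsto g (𝓝[>] (0 : ℝ) ⊓ ae volume)
      (𝓝 (∫ t in T₁..T₂, (∫ w, f w j ∂(ν₀ t)) * ψ t)) :=
    (hν₀.trace _ _ hP ψ hψ T₁ T₂ h.nonneg h.lt).congr' (eventually_traceFilter hae)
  refine TendstoUniformlyOnFilter.tendsto_of_eventually_tendsto
    (F := fun x n => viscFlux (ε n) (u n) (fun w => w j) (fun w => f w j) (ψn n) (a n) T₂ x)
    (Metric.tendstoUniformlyOnFilter_iff.2 fun e he => ?_) (eventually_traceFilter hlim) hg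
  have hlin : Tendsto (fun x : ℝ => M * B * x) (𝓝 0) (𝓝 0) := by
    simpa only [mul_zero] using (continuous_const_mul (M * B)).tendsto 0
  have hsmall : ∀ᶠ x in 𝓝[>] (0 : ℝ) ⊓ ae volume, M * B * x < e ∧ 0 < x :=
    inf_le_left (a := 𝓝[>] (0 : ℝ)) (((hlin.mono_left nhdsWithin_le_nhds).eventually
      (gt_mem_nhds he)).and self_mem_nhdsWithin)
  filter_upwards [hsmall.prod_inl _] with p hp
  rw [dist_comm, Real.dist_eq]
  exact (hV.abs_viscFlux_coord_sub_le h hB p.2 hp.2.le).trans_lt hp.1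

end ViscousFamily

end FluxTraces

section BoundaryValues

variable {N : ℕ} {𝒰 K : Set (State N)} {f : State N → State N} {ε : ℕ → ℝ}
  {uIε uBε : ℕ → ℝ → State N} {uB : ℝ → State N} {u : ℕ → ℝ → ℝ → State N}
  {R : State N → ℝ} {θ : ℝ → ℝ} {T₁ T₂ : ℝ}

/-- Boundary values of uniformly bounded variation converging almost everywhere to `uB`. -/
structure BoundaryData (uBε : ℕ → ℝ → State N) (uB : ℝ → State N) : Prop where
  isBV : IsBV uB
  variation : ∀ T : ℝ, ∃ C : NNReal, ∀ n, eVariationOn (uBε n) (Ioo 0 T) ≤ C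
  lim : ∀ᵐ t ∂volHalf, Tendsto (fun n => uBε n t) atTop (𝓝 (uB t))

theorem intervalIntegrable_mul_of_bounded {h : ℝ → ℝ} {C : ℝ} (hm : AEStronglyMeasurable h volHalf)
    (hC : ∀ t, 0 < t → |h t| ≤ C) (h0 : 0 ≤ T₁) (h' : T₁ ≤ T₂) (hθ : IntegrableOn θ (Ioc T₁ T₂)) :
    IntervalIntegrable (fun t => h t * θ t) volume T₁ T₂ := by
  have hsub : Ioc T₁ T₂ ⊆ Ioi 0 := fun t ht => h0.trans_lt ht.1
  rw [intervalIntegrable_iff_integrableOn_Ioc_of_le h']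
  refine hθ.bdd_mul (hm.mono_set hsub) (c := C) ?_
  filter_upwards [ae_restrict_mem measurableSet_Ioc] with t ht using hC t (hsub ht)

namespace ViscousFamily

theorem boundary_mem (hV : ViscousFamily 𝒰 K f ε uIε uBε u) (n : ℕ) {t : ℝ} (ht : 0 < t) :
    uBε n t ∈ K :=
  (hV.sol n).boundary t ht ▸ hV.mem n 0 t le_rfl ht.le

theorem boundary_limit_mem (hV : ViscousFamily 𝒰 K f ε uIε uBε u) (hD : BoundaryData uBε uB)
    {t : ℝ} (ht : 0 < t) : uB t ∈ K := by
  have hae : ∀ᵐ t ∂volHalf, uB t ∈ K := by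
    filter_upwards [hD.lim, ae_restrict_mem measurableSet_Ioi] with t hlim ht
    exact hV.compact.isClosed.mem_of_tendsto hlim
      (Eventually.of_forall fun n => hV.boundary_mem n ht)
  exact hV.compact.isClosed.mem_of_frequently_of_tendsto (frequently_nhdsGE_of_ae hae ht)
    (hD.isBV.right_continuous t ht)

theorem continuousAt_boundary_limit (hV : ViscousFamily 𝒰 K f ε uIε uBε u)
    (hD : BoundaryData uBε uB) (hR : ContinuousOn R 𝒰) {t : ℝ} (ht : 0 < t) :
    ContinuousAt R (uB t) :=
  hR.continuousAt (hV.isOpen.mem_nhds (hV.subset (hV.boundary_limit_mem hD ht)))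

theorem continuousOn_boundary (hV : ViscousFamily 𝒰 K f ε uIε uBε u) (n : ℕ) :
    ContinuousOn (uBε n) (Ioi 0) :=
  ((hV.sol n).contDiffOn_time le_rfl).continuousOn.congr fun t ht => ((hV.sol n).boundary t ht).symm

theorem continuousOn_comp_boundary (hV : ViscousFamily 𝒰 K f ε uIε uBε u)
    (hR : ContinuousOn R 𝒰) (n : ℕ) : ContinuousOn (fun t => R (uBε n t)) (Ioi 0) :=
  hR.comp (hV.continuousOn_boundary n) fun _ ht => hV.subset (hV.boundary_mem n ht)

theorem tendsto_comp_boundary (hV : ViscousFamily 𝒰 K f ε uIε uBε u) (hD : BoundaryData uBε uB)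
    (hR : ContinuousOn R 𝒰) :
    ∀ᵐ t ∂volHalf, Tendsto (fun n => R (uBε n t)) atTop (𝓝 (R (uB t))) := by
  filter_upwards [hD.lim, ae_restrict_mem measurableSet_Ioi] with t hlim ht
  exact (hV.continuousAt_boundary_limit hD hR ht).tendsto.comp hlim

theorem intervalIntegrable_boundary (hV : ViscousFamily 𝒰 K f ε uIε uBε u)
    (hD : BoundaryData uBε uB) (hR : ContinuousOn R 𝒰) (h0 : 0 ≤ T₁) (h : T₁ ≤ T₂)
    (hθ : IntegrableOn θ (Ioc T₁ T₂)) :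
    IntervalIntegrable (fun t => R (uB t) * θ t) volume T₁ T₂ := by
  obtain ⟨B, -, hB⟩ := hV.exists_bound hR
  have hmeas : AEStronglyMeasurable (fun t => R (uB t)) volHalf :=
    aestronglyMeasurable_of_tendsto_ae _
      (fun n => (hV.continuousOn_comp_boundary hR n).aestronglyMeasurable measurableSet_Ioi)
      (hV.tendsto_comp_boundary hD hR)
  exact intervalIntegrable_mul_of_bounded hmeas (fun t ht => hB _ (hV.boundary_limit_mem hD ht))
    h0 h hθ

theorem tendsto_integral_boundary (hV : ViscousFamily 𝒰 K f ε uIε uBε u)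
    (hD : BoundaryData uBε uB) (hR : ContinuousOn R 𝒰) {ψn : ℕ → ℝ → ℝ} {a : ℕ → ℝ} {M : ℝ}
    (h : TestSeq ψn θ a T₁ T₂ M) :
    Tendsto (fun n => ∫ t in a n..T₂, R (uBε n t) * ψn n t) atTop
      (𝓝 (∫ t in T₁..T₂, R (uB t) * θ t)) := by
  obtain ⟨B, hB0, hB⟩ := hV.exists_bound hR
  obtain ⟨A, hA⟩ := h.exists_abs_indicator_le
  have hbound : Integrable ((Ioc T₁ T₂).indicator fun _ => A) volHalf :=
    ((integrableOn_const measure_Ioc_lt_top.ne).integrable_indicator measurableSet_Ioc).restrict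
  rw [intervalIntegral_eq_indicator (h := fun t => R (uB t)) h.nonneg h.lt.le]
  simp only [fun n => intervalIntegral_eq_indicator (h := fun t => R (uBε n t)) (ψ := ψn n)
    (h.pos n).le (h.mem n).2.le]
  refine tendsto_integral_of_dominated_convergence _ (fun n => ?_) (hbound.const_mul B)
    (fun n => ?_) ?_
  · exact ((hV.continuousOn_comp_boundary hR n).aestronglyMeasurable measurableSet_Ioi).mul
      (h.integrable_indicator n).aestronglyMeasurable.restrict
  · filter_upwards [ae_restrict_mem measurableSet_Ioi] with t ht
    rw [norm_mul]
    exact mul_le_mul (hB _ (hV.boundary_mem n ht)) (hA n t) (norm_nonneg _) hB0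
  · filter_upwards [hV.tendsto_comp_boundary hD hR, h.ae_tendsto_indicator] with t hR hψ
    exact hR.mul hψ

theorem exists_lipschitzOnWith (hV : ViscousFamily 𝒰 K f ε uIε uBε u) {q : State N → ℝ}
    (hq : ContDiffOn ℝ 1 q 𝒰) : ∃ C : NNReal, LipschitzOnWith C q K := by
  obtain ⟨C, hC⟩ := hV.compact.exists_bound_of_continuousOn
    ((hq.continuousOn_fderiv_of_isOpen hV.isOpen le_rfl).mono hV.subset)
  refine ⟨C.toNNReal, hV.convex.lipschitzOnWith_of_nnnorm_fderiv_le (𝕜 := ℝ) (fun x hx =>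
    (hq.differentiableOn one_ne_zero).differentiableAt (hV.isOpen.mem_nhds (hV.subset hx)))
    fun x hx => ?_⟩
  rw [← NNReal.coe_le_coe, coe_nnnorm]
  exact (hC x hx).trans (Real.le_coe_toNNReal C)

theorem isBV_boundary_mul (hV : ViscousFamily 𝒰 K f ε uIε uBε u) (hD : BoundaryData uBε uB)
    {q : State N → ℝ} (hq : ContDiffOn ℝ 1 q 𝒰) (hθ : IsBV θ) :
    IsBV fun t => q (uB t) * θ t where
  bounded := by
    obtain ⟨Q, hQ0, hQ⟩ := hV.exists_bound hq.continuousOn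
    obtain ⟨A, hA⟩ := hθ.bounded
    refine ⟨Q * A, fun t ht => ?_⟩
    rw [norm_mul]
    exact mul_le_mul (hQ _ (hV.boundary_limit_mem hD ht)) (hA t ht) (norm_nonneg _) hQ0
  variation := fun T => by
    obtain ⟨C, hC⟩ := hV.exists_lipschitzOnWith hq
    exact (hC.comp_boundedVariationOn (fun t ht => hV.boundary_limit_mem hD ht.1)
      (hD.isBV.variation T)).mul (hθ.variation T)
  right_continuous := fun t ht =>
    ((hV.continuousAt_boundary_limit hD hq.continuousOn ht).comp_continuousWithinAt
      (hD.isBV.right_continuous t ht)).mul (hθ.right_continuous t ht)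

theorem exists_testSeq_boundary (hV : ViscousFamily 𝒰 K f ε uIε uBε u) (hD : BoundaryData uBε uB)
    {q : State N → ℝ} (hq : ContDiffOn ℝ 1 q 𝒰) (hθ : IsBV θ) (h0 : 0 ≤ T₁) (h : T₁ < T₂) :
    ∃ M, TestSeq (fun n t => q (uBε n t) * θ t) (fun t => q (uB t) * θ t) (windowStart T₁ T₂)
      T₁ T₂ M := by
  obtain ⟨Q, hQ0, hQ⟩ := hV.exists_bound hq.continuousOn
  obtain ⟨C, hC⟩ := hV.exists_lipschitzOnWith hq
  obtain ⟨A, hA⟩ := hθ.bounded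
  obtain ⟨D, hDv⟩ := hD.variation (T₂ + 1)
  refine ⟨_, testSeq_of_variation_le (A := Q * A)
    (V := Q.toNNReal * (eVariationOn θ (Ioo 0 (T₂ + 1))).toNNReal + A.toNNReal * (C * D)) h0 h
    (fun n t ht => ?_) (fun n => ?_) ?_⟩
  · rw [abs_mul]
    exact mul_le_mul (hQ _ (hV.boundary_mem n ht)) (hA t ht) (abs_nonneg _) hQ0
  · have hprod := eVariation_mul_le (f := q ∘ uBε n) (g := θ) (s := Ioo 0 (T₂ + 1))
      (C := (Q.toNNReal : ENNReal)) (D := (A.toNNReal : ENNReal))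
      (fun t ht => enorm_le_coe.2 (NNReal.coe_le_coe.1
        ((hQ _ (hV.boundary_mem n ht.1)).trans (Real.le_coe_toNNReal Q))))
      (fun t ht => enorm_le_coe.2 (NNReal.coe_le_coe.1
        ((hA t ht.1).trans (Real.le_coe_toNNReal A))))
    have hcomp : eVariationOn (q ∘ uBε n) (Ioo 0 (T₂ + 1)) ≤ C * D :=
      (hC.comp_eVariationOn_le fun t ht => hV.boundary_mem n ht.1).trans (by gcongr; exact hDv n)
    refine hprod.trans ?_
    push_cast
    rw [ENNReal.coe_toNNReal (hθ.variation _)]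
    gcongr
  · filter_upwards [hV.tendsto_comp_boundary hD hq.continuousOn] with t ht using ht.mul_const _

end ViscousFamily

end BoundaryValues

section BoundaryFlux

variable {N : ℕ} {𝒰 K : Set (State N)} {f : State N → State N} {ε : ℕ → ℝ}
  {uIε uBε : ℕ → ℝ → State N} {uB : ℝ → State N} {u : ℕ → ℝ → ℝ → State N}
  {U F : State N → ℝ} {ν : Kernel (ℝ × ℝ) (State N)} {ν₀ : Kernel ℝ (State N)}
  {θ : ℝ → ℝ} {T₁ T₂ : ℝ}

theorem sum_coord_mul_apply (ℓ : State N →L[ℝ] ℝ) (v : State N) (s : ℝ) :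
    ∑ j, v j * (ℓ (EuclideanSpace.single j 1) * s) = ℓ v * s := by
  conv_rhs => rw [← (EuclideanSpace.basisFun (Fin N) ℝ).sum_repr v]
  simp only [map_sum, map_smul, Finset.sum_mul, EuclideanSpace.basisFun_repr,
    EuclideanSpace.basisFun_apply, smul_eq_mul, mul_assoc]

theorem contDiffOn_fderiv_apply (h𝒰 : IsOpen 𝒰) (hU : ContDiffOn ℝ 2 U 𝒰) (e : State N) :
    ContDiffOn ℝ 1 (fun w => fderiv ℝ U w e) 𝒰 :=
  (hU.fderiv_of_isOpen (m := 1) h𝒰 (by norm_num)).clm_apply contDiffOn_const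

theorem IsEntropyPair.continuousOn_sub_fderiv_apply (hUF : IsEntropyPair 𝒰 f U F) (h𝒰 : IsOpen 𝒰)
    (hf : ContinuousOn f 𝒰) : ContinuousOn (fun w => F w - fderiv ℝ U w (f w)) 𝒰 :=
  hUF.contDiffOn_flux.continuousOn.sub
    ((hUF.contDiffOn_entropy.continuousOn_fderiv_of_isOpen h𝒰 (by norm_num)).clm_apply hf)

-- At `x = 0` the unknown `∂ₓu` enters only through the viscous fluxes of the coordinates.
theorem ViscousFamily.viscFlux_zero (hV : ViscousFamily 𝒰 K f ε uIε uBε u)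
    (hUF : IsEntropyPair 𝒰 f U F) (n : ℕ) {a b : ℝ} (ha : 0 < a) (hab : a ≤ b)
    (hθ : IntervalIntegrable θ volume a b) :
    viscFlux (ε n) (u n) U F θ a b 0
      = (∫ t in a..b, (F (uBε n t) - fderiv ℝ U (uBε n t) (f (uBε n t))) * θ t)
        + ∑ j, viscFlux (ε n) (u n) (fun w => w j) (fun w => f w j)
          (fun t => fderiv ℝ U (uBε n t) (EuclideanSpace.single j 1) * θ t) a b 0 := by
  have hmul : ∀ {R : State N → ℝ}, ContinuousOn R 𝒰 →
      IntervalIntegrable (fun t => R (uBε n t) * θ t) volume a b := fun hR =>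
    hθ.continuousOn_mul (by
      rw [uIcc_of_le hab]
      exact (hV.continuousOn_comp_boundary hR n).mono (Icc_subset_Ioi_zero ha))
  have hint₀ := hmul (hUF.continuousOn_sub_fderiv_apply hV.isOpen hV.smooth.continuousOn)
  have hint : ∀ j ∈ Finset.univ, IntervalIntegrable (fun t => (f (u n 0 t) j
      - ε n * fderiv ℝ (fun w : State N => w j) (u n 0 t) (spaceDeriv (u n) 0 t))
      * (fderiv ℝ U (uBε n t) (EuclideanSpace.single j 1) * θ t)) volume a b := fun j _ =>
    intervalIntegrable_mul_of_continuousOn_prod (((hV.sol n).contDiffOn_flux hV.isOpen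
      (isConvexEntropyPair_coord hV.isOpen hV.smooth j).toIsEntropyPair).continuousOn.mono
      (prod_mono_right (Icc_subset_Ioi_zero ha))) hab
      (hmul (contDiffOn_fderiv_apply hV.isOpen hUF.contDiffOn_entropy _).continuousOn)
      self_mem_Ici
  simp only [viscFlux]
  rw [← intervalIntegral.integral_finsetSum hint, ← intervalIntegral.integral_add hint₀
    (by simpa only [Finset.sum_fn] using IntervalIntegrable.sum _ hint)]
  refine intervalIntegral.integral_congr fun t ht => ?_
  rw [uIcc_of_le hab] at ht
  have hb := (hV.sol n).boundary t (Icc_subset_Ioi_zero ha ht)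
  have hsum := sum_coord_mul_apply (fderiv ℝ U (uBε n t))
    (f (uBε n t) - ε n • spaceDeriv (u n) 0 t) (θ t)
  simp only [PiLp.sub_apply, PiLp.smul_apply, smul_eq_mul, map_sub, map_smul] at hsum
  simp only [fderiv_coord, PiLp.proj_apply, hb, hsum]
  ring

namespace IsBoundaryYoungMeasure

variable {κ₀ : Kernel ℝ (State N)}

theorem intervalIntegrable (hκ : IsBoundaryYoungMeasure 𝒰 κ₀) {g : State N → ℝ}
    (hg : ContinuousOn g 𝒰) (h0 : 0 ≤ T₁) (h : T₁ ≤ T₂) (hθ : IntegrableOn θ (Ioc T₁ T₂)) :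
    IntervalIntegrable (fun t => (∫ w, g w ∂(κ₀ t)) * θ t) volume T₁ T₂ := by
  obtain ⟨K, hK, hK𝒰, hsupp⟩ := hκ.support
  have := hκ.markov
  obtain ⟨g', hg'⟩ := exists_boundedContinuous_eqOn hK (hg.mono hK𝒰)
  have heq : ∀ t, 0 < t → ∫ w, g' w ∂(κ₀ t) = ∫ w, g w ∂(κ₀ t) := fun t ht =>
    integral_congr_of_eqOn (hsupp t ht) hg'
  refine intervalIntegrable_mul_of_bounded (C := ‖g'‖)
    ((aestronglyMeasurable_integral_kernel κ₀ g').congr ?_) (fun t ht => ?_) h0 h hθ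
  · filter_upwards [ae_restrict_mem measurableSet_Ioi] with t ht using heq t ht
  · exact heq t ht ▸ abs_integral_kernel_le κ₀ g' t

theorem integrable {E : Type*} [NormedAddCommGroup E] (hκ : IsBoundaryYoungMeasure 𝒰 κ₀)
    {g : State N → E} (hg : ContinuousOn g 𝒰) {t : ℝ} (ht : 0 < t) : Integrable g (κ₀ t) := by
  obtain ⟨K, hK, hK𝒰, hsupp⟩ := hκ.support
  have := hκ.markov
  have hint : IntegrableOn g K (κ₀ t) := (hg.mono hK𝒰).integrableOn_compact hK
  rwa [IntegrableOn, Measure.restrict_eq_self_of_ae_mem] at hint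
  filter_upwards [measure_eq_zero_iff_ae_notMem.1 (hsupp t ht)] with z hz using not_not.1 hz

end IsBoundaryYoungMeasure

namespace ViscousFamily

theorem integral_boundaryFlux_add_sum (hV : ViscousFamily 𝒰 K f ε uIε uBε u)
    (hD : BoundaryData uBε uB) (hν₀ : IsBoundaryYoungMeasure 𝒰 ν₀) (hUF : IsEntropyPair 𝒰 f U F)
    (hθ : IsBV θ) (h0 : 0 ≤ T₁) (h : T₁ ≤ T₂) :
    (∫ t in T₁..T₂, (F (uB t) - fderiv ℝ U (uB t) (f (uB t))) * θ t)
        + ∑ j, ∫ t in T₁..T₂, (∫ w, f w j ∂(ν₀ t))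
          * (fderiv ℝ U (uB t) (EuclideanSpace.single j 1) * θ t)
      = ∫ t in T₁..T₂,
          (F (uB t) + fderiv ℝ U (uB t) ((∫ w, f w ∂(ν₀ t)) - f (uB t))) * θ t := by
  have hint : ∀ j ∈ Finset.univ, IntervalIntegrable (fun t => (∫ w, f w j ∂(ν₀ t))
      * (fderiv ℝ U (uB t) (EuclideanSpace.single j 1) * θ t)) volume T₁ T₂ := fun j _ =>
    hν₀.intervalIntegrable
      (isConvexEntropyPair_coord hV.isOpen hV.smooth j).contDiffOn_flux.continuousOn h0 h
      ((hV.isBV_boundary_mul hD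
        (contDiffOn_fderiv_apply hV.isOpen hUF.contDiffOn_entropy _) hθ).integrableOn h0)
  rw [← intervalIntegral.integral_finsetSum hint, ← intervalIntegral.integral_add
    (hV.intervalIntegrable_boundary hD
      (hUF.continuousOn_sub_fderiv_apply hV.isOpen hV.smooth.continuousOn) h0 h
      (hθ.integrableOn h0))
    (by simpa only [Finset.sum_fn] using IntervalIntegrable.sum _ hint)]
  refine intervalIntegral.integral_congr_ae (ae_of_all _ fun t ht => ?_)
  rw [uIoc_of_le h] at ht
  have hcoord : ∀ j, ∫ w, f w j ∂(ν₀ t) = (∫ w, f w ∂(ν₀ t)) j := fun j =>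
    (EuclideanSpace.proj (𝕜 := ℝ) j).integral_comp_comm
      (hν₀.integrable hV.smooth.continuousOn (h0.trans_lt ht.1))
  simp only [hcoord, sum_coord_mul_apply, map_sub]
  ring

theorem tendsto_viscFlux_zero (hV : ViscousFamily 𝒰 K f ε uIε uBε u)
    (hD : BoundaryData uBε uB) (hν : IsYoungMeasure 𝒰 (fun n p => u n p.1 p.2) ν)
    (hν₀ : IsFluxTrace 𝒰 f ν ν₀) (hUF : IsEntropyPair 𝒰 f U F) (hθ : IsBV θ) (h0 : 0 ≤ T₁)
    (h : T₁ < T₂) :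
    Tendsto (fun n => viscFlux (ε n) (u n) U F θ (windowStart T₁ T₂ n) T₂ 0) atTop
      (𝓝 (∫ t in T₁..T₂,
        (F (uB t) + fderiv ℝ U (uB t) ((∫ w, f w ∂(ν₀ t)) - f (uB t))) * θ t)) := by
  obtain ⟨M, hM⟩ := hθ.exists_testSeq h0 h
  have hq := fun j : Fin N => contDiffOn_fderiv_apply hV.isOpen hUF.contDiffOn_entropy
    (EuclideanSpace.single j 1)
  have hdata := hV.tendsto_integral_boundary hD
    (hUF.continuousOn_sub_fderiv_apply hV.isOpen hV.smooth.continuousOn) hM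
  have hcoord : ∀ j ∈ Finset.univ, Tendsto (fun n => viscFlux (ε n) (u n) (fun w => w j)
      (fun w => f w j) (fun t => fderiv ℝ U (uBε n t) (EuclideanSpace.single j 1) * θ t)
      (windowStart T₁ T₂ n) T₂ 0) atTop (𝓝 (∫ t in T₁..T₂, (∫ w, f w j ∂(ν₀ t))
        * (fderiv ℝ U (uB t) (EuclideanSpace.single j 1) * θ t))) := fun j _ => by
    obtain ⟨M', hM'⟩ := hV.exists_testSeq_boundary hD (hq j) hθ h0 h
    exact hV.tendsto_viscFlux_coord_zero hν hν₀ j hM' (hV.isBV_boundary_mul hD (hq j) hθ)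
  rw [← hV.integral_boundaryFlux_add_sum hD hν₀.toIsBoundaryYoungMeasure hUF hθ h0 h.le]
  exact (hdata.add (tendsto_finsetSum _ hcoord)).congr fun n =>
    (hV.viscFlux_zero hUF n (hM.pos n) (hM.mem n).2.le (hM.pairing n).integrable).symm

end ViscousFamily

end BoundaryFlux

section LayerBounds

variable {N : ℕ} {𝒰 K : Set (State N)} {f : State N → State N} {ε : ℕ → ℝ}
  {uIε uBε : ℕ → ℝ → State N} {uB : ℝ → State N} {u : ℕ → ℝ → ℝ → State N}
  {U F : State N → ℝ} {ν μ : Kernel (ℝ × ℝ) (State N)} {ν₀ : Kernel ℝ (State N)}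
  {θ : ℝ → ℝ} {T₁ T₂ : ℝ}

theorem layer_le_boundary {H : ℕ → ℝ → ℝ} {c y l L : ℝ}
    (hH : ∀ n, AntitoneOn (fun x => H n x - c * x) (Ici 0)) (hε_pos : ∀ n, 0 < ε n)
    (hε : Tendsto ε atTop (𝓝 0)) (hy : 0 < y)
    (hl : Tendsto (fun n => H n (ε n * y)) atTop (𝓝 l))
    (hL : Tendsto (fun n => H n 0) atTop (𝓝 L)) : l ≤ L := by
  have hlin : Tendsto (fun n => c * (ε n * y)) atTop (𝓝 0) := by
    simpa only [zero_mul, mul_zero] using (hε.mul_const y).const_mul c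
  refine le_of_tendsto_of_tendsto' (by simpa only [sub_zero] using hl.sub hlin) hL fun n => ?_
  have hn : 0 ≤ ε n * y := (mul_pos (hε_pos n) hy).le
  simpa only [mul_zero, sub_zero] using hH n self_mem_Ici hn hn

theorem interior_le_layer {H : ℕ → ℝ → ℝ} {c x y l g : ℝ}
    (hH : ∀ n, AntitoneOn (fun x => H n x - c * x) (Ici 0)) (hε_pos : ∀ n, 0 < ε n)
    (hε : Tendsto ε atTop (𝓝 0)) (hy : 0 < y)
    (hl : Tendsto (fun n => H n (ε n * y)) atTop (𝓝 l)) (hx : 0 < x)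
    (hg : Tendsto (fun n => H n x) atTop (𝓝 g)) : g - c * x ≤ l := by
  have harg : Tendsto (fun n => ε n * y) atTop (𝓝 0) := by
    simpa only [zero_mul] using hε.mul_const y
  have hlin : Tendsto (fun n => c * (ε n * y)) atTop (𝓝 0) := by
    simpa only [mul_zero] using harg.const_mul c
  refine le_of_tendsto_of_tendsto (hg.sub_const (c * x))
    (by simpa only [sub_zero] using hl.sub hlin) ?_
  filter_upwards [harg.eventually (gt_mem_nhds hx)] with n hn
  exact hH n (mul_pos (hε_pos n) hy).le hx.le hn.le

namespace ViscousFamily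

theorem exists_layer_bounds (hV : ViscousFamily 𝒰 K f ε uIε uBε u)
    (hD : BoundaryData uBε uB) (hν : IsYoungMeasure 𝒰 (fun n p => u n p.1 p.2) ν)
    (hμ : IsYoungMeasure 𝒰 (fun n p => u n (ε n * p.1) p.2) μ) (hν₀ : IsFluxTrace 𝒰 f ν ν₀)
    (hUF : IsConvexEntropyPair 𝒰 f U F) (hθ : IsBV θ) (hpos : ∀ t, 0 < t → 0 ≤ θ t)
    (h0 : 0 ≤ T₁) (h : T₁ < T₂) :
    ∃ G : ℝ → ℝ, AlmostAntitone G 0 ∧ IsLayerFlux μ U F θ T₁ T₂ G ∧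
      (∀ y, 0 < y → G y ≤ ∫ t in T₁..T₂,
        (F (uB t) + fderiv ℝ U (uB t) ((∫ w, f w ∂(ν₀ t)) - f (uB t))) * θ t) ∧
      ∀ y, 0 < y → ∫ t in T₁..T₂, (∫ w, F w ∂(ν₀ t)) * θ t ≤ G y := by
  obtain ⟨M, hM⟩ := hθ.exists_testSeq h0 h
  obtain ⟨B, -, hB⟩ := hV.exists_bound hUF.contDiffOn_entropy.continuousOn
  have hsign := fun _ : ℕ => hUF.hessian_mul_nonneg hpos
  have hanti := hV.antitoneOn_viscFlux hUF.toIsEntropyPair hM hsign hB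
  obtain ⟨G, hG, hGlim, hGL⟩ := hV.exists_layer_flux hμ hUF.toIsEntropyPair hM hsign hB
  obtain ⟨g, -, hglim, hgae, -⟩ := hV.exists_interior_flux hν hUF.toIsEntropyPair hM hsign hB
  refine ⟨G, hG, hGL, fun y hy => ?_, fun y hy => ?_⟩
  · refine le_of_ae_le_of_continuousWithinAt_Ici (hG.right_continuous y hy)
      (continuousWithinAt_const (b := _)) ?_ hy
    filter_upwards [hGlim, ae_restrict_mem measurableSet_Ioi] with y hlim hy
    exact layer_le_boundary hanti hV.eps_pos hV.eps_tendsto hy hlim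
      (hV.tendsto_viscFlux_zero hD hν hν₀ hUF.toIsEntropyPair hθ h0 h)
  · refine le_of_ae_le_of_continuousWithinAt_Ici (continuousWithinAt_const (b := _))
      (hG.right_continuous y hy) ?_ hy
    filter_upwards [hGlim, ae_restrict_mem measurableSet_Ioi] with y hlim hy
    have hlin : Tendsto (fun x : ℝ => G y + M * B * x) (𝓝[>] (0 : ℝ) ⊓ ae volume)
        (𝓝 (G y + M * B * 0)) :=
      ((continuous_const_mul (M * B)).const_add (G y)).tendsto 0 |>.mono_left
        (inf_le_left.trans nhdsWithin_le_nhds)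
    rw [mul_zero, add_zero] at hlin
    refine le_of_tendsto_of_tendsto (hν₀.trace U F hUF θ hθ T₁ T₂ h0 h) hlin
      (eventually_traceFilter ?_)
    filter_upwards [hglim, hgae, ae_restrict_mem measurableSet_Ioi] with x hx_lim hx_eq hx
    rw [hx_eq, ← sub_le_iff_le_add]
    exact interior_le_layer hanti hV.eps_pos hV.eps_tendsto hy hlim hx hx_lim

end ViscousFamily

end LayerBounds

section EntropyTrace

theorem abs_sub_le_of_hasDerivAt_sub {S Φ H : ℝ → ℝ} {A B L y : ℝ} (hS : ContinuousOn S (Ici 0))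
    (hder : ∀ y, 0 < y → HasDerivAt S (Φ y - H y) y) (hA : ∀ y, 0 ≤ y → |S y| ≤ A)
    (hB : ∀ y, 0 ≤ y → |Φ y| ≤ B) (hH : AntitoneOn (fun y => H y - L * y) (Ici 0))
    (hy : y ∈ Ioo 0 1) : |S y - S 0| ≤ (2 * A + 2 * B + 2 * |L| + |H 0|) * y := by
  obtain ⟨c, hc, hcS⟩ := exists_hasDerivAt_eq_slope S _ hy.1 (hS.mono Icc_subset_Ici_self)
    fun z hz => hder z hz.1
  -- On `(1, 2)` some slope is bounded, which bounds `H` from below there, hence on `(0, 1)`.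
  obtain ⟨d, hd, hdS⟩ := exists_hasDerivAt_eq_slope S _ (one_lt_two (α := ℝ))
    (hS.mono fun z hz => zero_le_one.trans hz.1) fun z hz => hder z (one_pos.trans hz.1)
  have hd0 : 0 < d := one_pos.trans hd.1
  have hcd : c < d := hc.2.trans (hy.2.trans hd.1)
  have hH0c := hH self_mem_Ici hc.1.le hc.1.le
  have hHcd := hH hc.1.le hd0.le hcd.le
  have hLc : |L * c| ≤ 2 * |L| := by
    rw [abs_mul, abs_of_pos hc.1, mul_comm]
    gcongr
    exact hcd.le.trans hd.2.le
  have hLdc : |L * d - L * c| ≤ 2 * |L| := by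
    rw [← mul_sub, abs_mul, abs_of_pos (sub_pos.2 hcd), mul_comm]
    gcongr
    linarith [hd.2, hc.1]
  have hslope : |Φ c - H c| ≤ 2 * A + 2 * B + 2 * |L| + |H 0| := by
    norm_num at hdS hH0c
    have := abs_le.1 (hA 1 zero_le_one)
    have := abs_le.1 (hA 2 zero_le_two)
    have := abs_le.1 (hB c hc.1.le)
    have := abs_le.1 (hB d hd0.le)
    have := abs_le.1 hLc
    have := abs_le.1 hLdc
    have := le_abs_self (H 0)
    have := abs_nonneg (H 0)
    have := abs_nonneg L
    exact abs_le.2 ⟨by linarith, by linarith⟩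
  rw [sub_zero, eq_div_iff hy.1.ne'] at hcS
  rw [← hcS, abs_mul, abs_of_pos hy.1]
  exact mul_le_mul_of_nonneg_right hslope hy.1.le

theorem ae_le_of_tendsto_setIntegral {α : Type*} [MeasurableSpace α] {m : Measure α}
    {k : ℕ → α → ℝ} {κ b : α → ℝ} (hk : ∀ n, Integrable (k n) m) (hκ : Integrable κ m)
    (hb : Integrable b m)
    (hlim : ∀ s, MeasurableSet s →
      Tendsto (fun n => ∫ y in s, k n y ∂m) atTop (𝓝 (∫ y in s, κ y ∂m)))
    (hle : ∀ n, k n ≤ᵐ[m] b) : κ ≤ᵐ[m] b :=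
  ae_le_of_forall_setIntegral_le hκ hb fun s hs _ => le_of_tendsto' (hlim s hs) fun n =>
    setIntegral_mono_ae (hk n).integrableOn hb.integrableOn (hle n)

theorem ae_abs_le_of_tendsto_setIntegral {α : Type*} [MeasurableSpace α] {m : Measure α}
    {k : ℕ → α → ℝ} {κ b : α → ℝ} (hk : ∀ n, Integrable (k n) m) (hκ : Integrable κ m)
    (hb : Integrable b m)
    (hlim : ∀ s, MeasurableSet s →
      Tendsto (fun n => ∫ y in s, k n y ∂m) atTop (𝓝 (∫ y in s, κ y ∂m)))
    (hle : ∀ n, ∀ᵐ y ∂m, |k n y| ≤ b y) : ∀ᵐ y ∂m, |κ y| ≤ b y := by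
  have hupper := ae_le_of_tendsto_setIntegral hk hκ hb hlim fun n =>
    (hle n).mono fun y hy => (le_abs_self _).trans hy
  have hlower := ae_le_of_tendsto_setIntegral (k := fun n y => -k n y) (κ := fun y => -κ y)
    (fun n => (hk n).neg) hκ.neg hb
    (fun s hs => by simpa only [integral_neg] using (hlim s hs).neg)
    fun n => (hle n).mono fun y hy => (neg_le_abs _).trans hy
  filter_upwards [hupper, hlower] with y h₁ h₂ using abs_le'.2 ⟨h₁, h₂⟩

variable {N : ℕ} {𝒰 K : Set (State N)} {f : State N → State N} {ε : ℕ → ℝ}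
  {uIε uBε : ℕ → ℝ → State N} {uB : ℝ → State N} {u : ℕ → ℝ → ℝ → State N}
  {U F g : State N → ℝ} {ν μ : Kernel (ℝ × ℝ) (State N)} {θ : ℝ → ℝ} {a T₁ T₂ : ℝ}

namespace ViscousFamily

theorem abs_solAvg_le (hV : ViscousFamily 𝒰 K f ε uIε uBε u) {A B : ℝ} (hB0 : 0 ≤ B)
    (hB : ∀ z ∈ K, |g z| ≤ B) (hA : ∀ t, 0 < t → |θ t| ≤ A) (n : ℕ) (h0 : 0 ≤ T₁)
    (ha : a ∈ Ioo T₁ T₂) {x : ℝ} (hx : 0 ≤ x) :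
    |solAvg (u n) g θ a T₂ x| ≤ B * A * (T₂ - T₁) := by
  have hA0 : 0 ≤ A := (abs_nonneg _).trans (hA 1 one_pos)
  have hle : ‖∫ t in a..T₂, g (u n x t) * θ t‖ ≤ B * A * |T₂ - a| := by
    refine intervalIntegral.norm_integral_le_of_norm_le_const fun t ht => ?_
    rw [uIoc_of_le ha.2.le] at ht
    have ht0 : 0 < t := h0.trans_lt (ha.1.trans ht.1)
    rw [norm_mul]
    exact mul_le_mul (hB _ (hV.mem n x t hx ht0.le)) (hA t ht0) (norm_nonneg _) hB0
  refine hle.trans ?_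
  rw [abs_of_pos (sub_pos.2 ha.2)]
  gcongr
  exact ha.1.le

theorem hasDerivAt_solAvg_rescaled (hV : ViscousFamily 𝒰 K f ε uIε uBε u)
    (hUF : IsEntropyPair 𝒰 f U F) (n : ℕ) (ha : 0 < a) (haT : a ≤ T₂)
    (hθ : IntervalIntegrable θ volume a T₂) {y : ℝ} (hy : 0 < y) :
    HasDerivAt (fun y => solAvg (u n) U θ a T₂ (ε n * y))
      (solAvg (u n) F θ a T₂ (ε n * y) - viscFlux (ε n) (u n) U F θ a T₂ (ε n * y)) y := by
  have hε := (hV.eps_pos n).ne'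
  refine (((hV.sol n).hasDerivAt_solAvg hV.isOpen hε hUF ha haT hθ
    (mul_pos (hV.eps_pos n) hy)).comp y ((hasDerivAt_id y).const_mul (ε n))).congr_deriv ?_
  rw [mul_one, mul_comm, mul_inv_cancel_left₀ hε]

theorem continuousOn_solAvg_rescaled (hV : ViscousFamily 𝒰 K f ε uIε uBε u)
    (hg : ContinuousOn g 𝒰) (n : ℕ) (ha : 0 < a) (haT : a ≤ T₂)
    (hθ : IntervalIntegrable θ volume a T₂) :
    ContinuousOn (fun y => solAvg (u n) g θ a T₂ (ε n * y)) (Ici 0) :=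
  ((hV.sol n).continuousOn_solAvg hg ha haT hθ).comp (continuous_const_mul _).continuousOn
    fun _ hy => mul_nonneg (hV.eps_pos n).le hy

theorem exists_abs_solAvg_sub_le (hV : ViscousFamily 𝒰 K f ε uIε uBε u)
    (hD : BoundaryData uBε uB) (hν : IsYoungMeasure 𝒰 (fun n p => u n p.1 p.2) ν)
    (hUF : IsConvexEntropyPair 𝒰 f U F) (hθ : IsBV θ) (hpos : ∀ t, 0 < t → 0 ≤ θ t)
    (h0 : 0 ≤ T₁) (h : T₁ < T₂) :
    ∃ D, ∀ n, ∀ y ∈ Ioo (0 : ℝ) 1, |solAvg (u n) U θ (windowStart T₁ T₂ n) T₂ (ε n * y)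
      - solAvg (u n) U θ (windowStart T₁ T₂ n) T₂ 0| ≤ D * y := by
  obtain ⟨M, hM⟩ := hθ.exists_testSeq h0 h
  obtain ⟨A, hA⟩ := hθ.bounded
  obtain ⟨B, hB0, hB⟩ := hV.exists_bound hUF.contDiffOn_entropy.continuousOn
  obtain ⟨B', hB0', hB'⟩ := hV.exists_bound hUF.contDiffOn_flux.continuousOn
  obtain ⟨ν₀, hν₀⟩ := hV.exists_fluxTrace hν
  obtain ⟨P, hP⟩ :=
    (hV.tendsto_viscFlux_zero hD hν hν₀ hUF.toIsEntropyPair hθ h0 h).abs.bddAbove_range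
  obtain ⟨L, hL⟩ := (hV.eps_tendsto.const_mul (M * B)).abs.bddAbove_range
  refine ⟨2 * (B * A * (T₂ - T₁)) + 2 * (B' * A * (T₂ - T₁)) + 2 * L + P, fun n y hy => ?_⟩
  have hscale : ∀ {y : ℝ}, 0 ≤ y → 0 ≤ ε n * y := fun hy => mul_nonneg (hV.eps_pos n).le hy
  have hanti : AntitoneOn (fun y => viscFlux (ε n) (u n) U F θ (windowStart T₁ T₂ n) T₂ (ε n * y)
      - M * B * ε n * y) (Ici 0) := fun x hx y hy hxy => by
    simpa only [mul_assoc] using hV.antitoneOn_viscFlux hUF.toIsEntropyPair hM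
      (fun _ => hUF.hessian_mul_nonneg hpos) hB n (hscale hx) (hscale hy)
      (mul_le_mul_of_nonneg_left hxy (hV.eps_pos n).le)
  have hlip := abs_sub_le_of_hasDerivAt_sub
    (hV.continuousOn_solAvg_rescaled hUF.contDiffOn_entropy.continuousOn n (hM.pos n)
      (hM.mem n).2.le (hM.pairing n).integrable)
    (fun y hy => hV.hasDerivAt_solAvg_rescaled hUF.toIsEntropyPair n (hM.pos n) (hM.mem n).2.le
      (hM.pairing n).integrable hy)
    (fun y hy => hV.abs_solAvg_le hB0 hB hA n h0 (hM.mem n) (hscale hy))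
    (fun y hy => hV.abs_solAvg_le hB0' hB' hA n h0 (hM.mem n) (hscale hy)) hanti hy
  rw [mul_zero] at hlip
  refine hlip.trans (mul_le_mul_of_nonneg_right ?_ hy.1.le)
  gcongr
  · exact hL (mem_range_self n)
  · exact hP (mem_range_self n)

theorem tendsto_solAvg_zero (hV : ViscousFamily 𝒰 K f ε uIε uBε u) (hD : BoundaryData uBε uB)
    (hg : ContinuousOn g 𝒰) {M : ℝ} (hM : TestSeq (fun _ => θ) θ (windowStart T₁ T₂) T₁ T₂ M) :
    Tendsto (fun n => solAvg (u n) g θ (windowStart T₁ T₂ n) T₂ 0) atTop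
      (𝓝 (∫ t in T₁..T₂, g (uB t) * θ t)) := by
  refine (hV.tendsto_integral_boundary hD hg hM).congr fun n =>
    intervalIntegral.integral_congr fun t ht => ?_
  rw [uIcc_of_le (hM.mem n).2.le] at ht
  simp only [(hV.sol n).boundary t ((hM.pos n).trans_le ht.1)]

theorem tendsto_setIntegral_solAvg (hV : ViscousFamily 𝒰 K f ε uIε uBε u)
    (hμ : IsYoungMeasure 𝒰 (fun n p => u n (ε n * p.1) p.2) μ) (hg : ContinuousOn g 𝒰) {M : ℝ}
    (hM : TestSeq (fun _ => θ) θ (windowStart T₁ T₂) T₁ T₂ M) {s : Set ℝ} (hs : MeasurableSet s)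
    (hs0 : s ⊆ Ioi 0) (hs_fin : volume s ≠ ⊤) :
    Tendsto (fun n => ∫ y in s, solAvg (u n) g θ (windowStart T₁ T₂ n) T₂ (ε n * y)) atTop
      (𝓝 (∫ y in s, timeAvg μ g θ T₁ T₂ y)) := by
  obtain ⟨B, -, hB⟩ := hV.exists_bound hg
  have hint : Integrable (s.indicator fun _ => (1 : ℝ)) volHalf :=
    ((integrableOn_const hs_fin).integrable_indicator hs).restrict
  have hpair : ∀ p : ℝ → ℝ,
      ∫ y in Ioi 0, p y * s.indicator (fun _ => (1 : ℝ)) y = ∫ y in s, p y := fun p => by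
    simp only [← indicator_mul_right, mul_one]
    rw [setIntegral_indicator hs, inter_eq_self_of_subset_right hs0]
  simpa only [hpair] using hM.tendsto_solAvg hV.eps_pos hμ hg
    (fun n x t hx ht => hB _ (hV.mem n x t hx ht)) hint

theorem exists_ae_abs_timeAvg_sub_le (hV : ViscousFamily 𝒰 K f ε uIε uBε u)
    (hD : BoundaryData uBε uB) (hν : IsYoungMeasure 𝒰 (fun n p => u n p.1 p.2) ν)
    (hμ : IsYoungMeasure 𝒰 (fun n p => u n (ε n * p.1) p.2) μ)
    (hUF : IsConvexEntropyPair 𝒰 f U F) (hθ : IsBV θ) (hpos : ∀ t, 0 < t → 0 ≤ θ t)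
    (h0 : 0 ≤ T₁) (h : T₁ < T₂) :
    ∃ D, ∀ᵐ y ∂volume.restrict (Ioo (0 : ℝ) 1),
      |timeAvg μ U θ T₁ T₂ y - ∫ t in T₁..T₂, U (uB t) * θ t| ≤ D * y := by
  have hUc := hUF.contDiffOn_entropy.continuousOn
  obtain ⟨D, hDn⟩ := hV.exists_abs_solAvg_sub_le hD hν hUF hθ hpos h0 h
  obtain ⟨M, hM⟩ := hθ.exists_testSeq h0 h
  have hsol : ∀ n, IntegrableOn
      (fun y => solAvg (u n) U θ (windowStart T₁ T₂ n) T₂ (ε n * y)) (Ioo 0 1) := fun n =>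
    (((hV.continuousOn_solAvg_rescaled hUc n (hM.pos n) (hM.mem n).2.le
      (hM.pairing n).integrable).mono Icc_subset_Ici_self).integrableOn_compact
        isCompact_Icc).mono_set Ioo_subset_Icc_self
  have havg : IntegrableOn (timeAvg μ U θ T₁ T₂) (Ioo 0 1) :=
    hμ.integrableOn_timeAvg hUc h0 h.le hM.integrableOn Ioo_subset_Ioi_self
      measure_Ioo_lt_top.ne
  have hlin : IntegrableOn (fun y => D * y) (Ioo 0 1) :=
    ((continuous_const_mul D).continuousOn.integrableOn_compact isCompact_Icc).mono_set
      Ioo_subset_Icc_self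
  refine ⟨D, ae_abs_le_of_tendsto_setIntegral
    (k := fun n y => solAvg (u n) U θ (windowStart T₁ T₂ n) T₂ (ε n * y)
      - solAvg (u n) U θ (windowStart T₁ T₂ n) T₂ 0)
    (fun n => (hsol n).sub (integrable_const _)) (havg.sub (integrable_const _)) hlin
    (fun s hs => ?_) fun n => (ae_restrict_mem measurableSet_Ioo).mono (hDn n)⟩
  have hs_fin : volume (s ∩ Ioo 0 1) ≠ ⊤ :=
    ((measure_mono inter_subset_right).trans_lt measure_Ioo_lt_top).ne
  rw [Measure.restrict_restrict hs]
  have hsplit : ∀ {p : ℝ → ℝ} (c : ℝ), IntegrableOn p (Ioo 0 1) →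
      ∫ y in s ∩ Ioo 0 1, (p y - c) = (∫ y in s ∩ Ioo 0 1, p y) - volume.real (s ∩ Ioo 0 1) * c :=
    fun c hp => by
      rw [integral_sub (hp.mono_set inter_subset_right) (integrableOn_const hs_fin),
        setIntegral_const, smul_eq_mul]
  simp only [hsplit _ (hsol _), hsplit _ havg]
  exact (hV.tendsto_setIntegral_solAvg hμ hUc hM (hs.inter measurableSet_Ioo)
    (fun y hy => hy.2.1) hs_fin).sub ((hV.tendsto_solAvg_zero hD hUc hM).const_mul _)

theorem tendsto_entropy_of_nonneg (hV : ViscousFamily 𝒰 K f ε uIε uBε u)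
    (hD : BoundaryData uBε uB) (hν : IsYoungMeasure 𝒰 (fun n p => u n p.1 p.2) ν)
    (hμ : IsYoungMeasure 𝒰 (fun n p => u n (ε n * p.1) p.2) μ)
    (hUF : IsConvexEntropyPair 𝒰 f U F) (hθ : IsBV θ) (hpos : ∀ t, 0 < t → 0 ≤ θ t)
    (h0 : 0 ≤ T₁) (h : T₁ < T₂) :
    Tendsto (timeAvg μ U θ T₁ T₂) (𝓝[>] 0 ⊓ ae volume)
      (𝓝 (∫ t in T₁..T₂, U (uB t) * θ t)) := by
  obtain ⟨D, hle⟩ := hV.exists_ae_abs_timeAvg_sub_le hD hν hμ hUF hθ hpos h0 h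
  rw [ae_restrict_iff' measurableSet_Ioo] at hle
  have hlin : Tendsto (fun y : ℝ => D * y) (𝓝[>] 0 ⊓ ae volume) (𝓝 0) :=
    ((continuous_const_mul D).tendsto' 0 0 (mul_zero D)).mono_left
      (inf_le_left.trans nhdsWithin_le_nhds)
  refine tendsto_sub_nhds_zero_iff.1 (squeeze_zero_norm' ?_ hlin)
  filter_upwards [inf_le_left (a := 𝓝[>] (0 : ℝ)) (Ioo_mem_nhdsGT one_pos),
    inf_le_right (a := 𝓝[>] (0 : ℝ)) hle] with y hy hle using hle hy

theorem tendsto_entropy (hV : ViscousFamily 𝒰 K f ε uIε uBε u)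
    (hD : BoundaryData uBε uB) (hν : IsYoungMeasure 𝒰 (fun n p => u n p.1 p.2) ν)
    (hμ : IsYoungMeasure 𝒰 (fun n p => u n (ε n * p.1) p.2) μ)
    (hUF : IsConvexEntropyPair 𝒰 f U F) (hθ : IsBV θ) (h0 : 0 ≤ T₁) (h : T₁ < T₂) :
    Tendsto (timeAvg μ U θ T₁ T₂) (𝓝[>] 0 ⊓ ae volume)
      (𝓝 (∫ t in T₁..T₂, U (uB t) * θ t)) := by
  have hUc := hUF.contDiffOn_entropy.continuousOn
  obtain ⟨p, q, hp, hq, hp_pos, hq_pos, rfl⟩ := hθ.exists_eq_sub_nonneg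
  have hlim := (hV.tendsto_entropy_of_nonneg hD hν hμ hUF hp hp_pos h0 h).sub
    (hV.tendsto_entropy_of_nonneg hD hν hμ hUF hq hq_pos h0 h)
  rw [← intervalIntegral.integral_sub
    (hV.intervalIntegrable_boundary hD hUc h0 h.le (hp.integrableOn h0))
    (hV.intervalIntegrable_boundary hD hUc h0 h.le (hq.integrableOn h0))] at hlim
  simp only [← mul_sub] at hlim
  refine hlim.congr' (EventuallyEq.symm (eventually_traceFilter ?_))
  exact hμ.timeAvg_sub_ae hUc h0 h.le (hp.integrableOn h0) (hq.integrableOn h0)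

end ViscousFamily

end EntropyTrace

section LayerFlux

variable {N : ℕ} {𝒰 K : Set (State N)} {f : State N → State N} {ε : ℕ → ℝ}
  {uIε uBε : ℕ → ℝ → State N} {uB : ℝ → State N} {u : ℕ → ℝ → ℝ → State N}
  {U F : State N → ℝ} {ν μ : Kernel (ℝ × ℝ) (State N)} {θ : ℝ → ℝ} {T₁ T₂ : ℝ}

theorem IsLayerFlux.sub {w : ℕ → ℝ × ℝ → State N} {p q G H : ℝ → ℝ}
    (hG : IsLayerFlux μ U F p T₁ T₂ G) (hH : IsLayerFlux μ U F q T₁ T₂ H)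
    (hμ : IsYoungMeasure 𝒰 w μ) (hUF : IsEntropyPair 𝒰 f U F) (hp : IsBV p) (hq : IsBV q)
    (h0 : 0 ≤ T₁) (h : T₁ ≤ T₂) (hGi : LocallyIntegrableOn G (Ioi 0))
    (hHi : LocallyIntegrableOn H (Ioi 0)) :
    IsLayerFlux μ U F (fun t => p t - q t) T₁ T₂ (G - H) := by
  intro φ hφ_smooth hφ_compact hφ_supp
  have hφ : IsTest (Ioi 0) φ := ⟨hφ_smooth, hφ_compact, hφ_supp⟩
  have hUc := hUF.contDiffOn_entropy.continuousOn
  have hFc := hUF.contDiffOn_flux.continuousOn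
  have hint : ∀ {θ : ℝ → ℝ}, IsBV θ → IntegrableOn
      (fun y => timeAvg μ F θ T₁ T₂ y * φ y + timeAvg μ U θ T₁ T₂ y * deriv φ y) (Ioi 0) :=
    fun hθ => (hφ.integrableOn_mul
      (hμ.locallyIntegrableOn_timeAvg hFc h0 h (hθ.integrableOn h0))).add
      (hφ.deriv.integrableOn_mul (hμ.locallyIntegrableOn_timeAvg hUc h0 h (hθ.integrableOn h0)))
  simp only [Pi.sub_apply, sub_mul]
  rw [integral_sub (hφ.integrableOn_mul hGi) (hφ.integrableOn_mul hHi),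
    ← hG φ hφ_smooth hφ_compact hφ_supp, ← hH φ hφ_smooth hφ_compact hφ_supp,
    ← integral_sub (hint hp) (hint hq)]
  refine integral_congr_ae ?_
  filter_upwards [hμ.timeAvg_sub_ae hFc h0 h (hp.integrableOn h0) (hq.integrableOn h0),
    hμ.timeAvg_sub_ae hUc h0 h (hp.integrableOn h0) (hq.integrableOn h0)] with y hyF hyU
  rw [hyF, hyU]
  ring

namespace ViscousFamily

theorem exists_layer_isBV (hV : ViscousFamily 𝒰 K f ε uIε uBε u) (hD : BoundaryData uBε uB)
    (hν : IsYoungMeasure 𝒰 (fun n p => u n p.1 p.2) ν)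
    (hμ : IsYoungMeasure 𝒰 (fun n p => u n (ε n * p.1) p.2) μ)
    (hUF : IsConvexEntropyPair 𝒰 f U F) (hθ : IsBV θ) (h0 : 0 ≤ T₁) (h : T₁ < T₂) :
    ∃ G : ℝ → ℝ, IsBV G ∧ IsLayerFlux μ U F θ T₁ T₂ G := by
  obtain ⟨ν₀, hν₀⟩ := hV.exists_fluxTrace hν
  have of_nonneg : ∀ {θ : ℝ → ℝ}, IsBV θ → (∀ t, 0 < t → 0 ≤ θ t) →
      ∃ G : ℝ → ℝ, IsBV G ∧ IsLayerFlux μ U F θ T₁ T₂ G := fun hθ hpos => by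
    obtain ⟨G, hG, hGL, hup, hlow⟩ := hV.exists_layer_bounds hD hν hμ hν₀ hUF hθ hpos h0 h
    exact ⟨G, hG.isBV fun y hy => abs_le_max_abs_abs (hlow y hy) (hup y hy), hGL⟩
  obtain ⟨p, q, hp, hq, hp_pos, hq_pos, rfl⟩ := hθ.exists_eq_sub_nonneg
  obtain ⟨G, hG, hGL⟩ := of_nonneg hp hp_pos
  obtain ⟨H, hH, hHL⟩ := of_nonneg hq hq_pos
  exact ⟨G - H, hG.sub hH, hGL.sub hHL hμ hUF.toIsEntropyPair hp hq h0 h.le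
    hG.locallyIntegrableOn hH.locallyIntegrableOn⟩

theorem layer_bounds (hV : ViscousFamily 𝒰 K f ε uIε uBε u) (hD : BoundaryData uBε uB)
    (hν : IsYoungMeasure 𝒰 (fun n p => u n p.1 p.2) ν)
    (hμ : IsYoungMeasure 𝒰 (fun n p => u n (ε n * p.1) p.2) μ)
    {ν₀ : Kernel ℝ (State N)} (hν₀ : IsFluxTrace 𝒰 f ν ν₀) (hUF : IsConvexEntropyPair 𝒰 f U F)
    (hθ : IsBV θ) (hpos : ∀ t, 0 < t → 0 ≤ θ t) (h0 : 0 ≤ T₁) (h : T₁ < T₂) {G : ℝ → ℝ}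
    (hG : IsBV G) (hGL : IsLayerFlux μ U F θ T₁ T₂ G) :
    AntitoneOn G (Ioi 0) ∧
      (∀ y, 0 < y → G y ≤ ∫ t in T₁..T₂,
        (F (uB t) + fderiv ℝ U (uB t) ((∫ w, f w ∂(ν₀ t)) - f (uB t))) * θ t) ∧
      ∀ y, 0 < y → ∫ t in T₁..T₂, (∫ w, F w ∂(ν₀ t)) * θ t ≤ G y := by
  obtain ⟨H, hH, hHL, hup, hlow⟩ := hV.exists_layer_bounds hD hν hμ hν₀ hUF hθ hpos h0 h
  have hH_bv : IsBV H := hH.isBV fun y hy => abs_le_max_abs_abs (hlow y hy) (hup y hy)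
  have hGH : EqOn G H (Ioi 0) := fun y hy => hGL.eq hHL hG hH_bv hy
  have hH_anti : AntitoneOn H (Ioi 0) := by
    simpa only [zero_mul, sub_zero] using hH.antitoneOn
  exact ⟨hH_anti.congr hGH.symm, fun y hy => (hGH hy).trans_le (hup y hy),
    fun y hy => (hlow y hy).trans_eq (hGH hy).symm⟩

end ViscousFamily

end LayerFlux

section BoundaryTrace

variable {N : ℕ} {𝒰 K : Set (State N)} {f : State N → State N} {ε : ℕ → ℝ}
  {uIε uBε : ℕ → ℝ → State N} {uB : ℝ → State N} {u : ℕ → ℝ → ℝ → State N}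
  {U F : State N → ℝ} {ν μ : Kernel (ℝ × ℝ) (State N)} {μ₀ : Kernel ℝ (State N)}

theorem ae_eq_of_forall_intervalIntegral_eq {p q : ℝ → ℝ}
    (hp : ∀ T, 0 < T → IntervalIntegrable p volume 0 T)
    (hq : ∀ T, 0 < T → IntervalIntegrable q volume 0 T)
    (h : ∀ T, 0 < T → ∫ t in 0..T, p t = ∫ t in 0..T, q t) : p =ᵐ[volHalf] q := by
  have hderiv : ∀ {r : ℝ → ℝ}, (∀ T, 0 < T → IntervalIntegrable r volume 0 T) →
      ∀ᵐ x ∂volHalf, HasDerivAt (fun T => ∫ t in 0..T, r t) (r x) x := fun hr => by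
    have hae := ae_all_iff.2 fun n : ℕ => (hr (n + 1) n.cast_add_one_pos).ae_hasDerivAt_integral
    filter_upwards [ae_restrict_of_ae hae, ae_restrict_mem measurableSet_Ioi] with x hx hx0
    obtain ⟨n, hn⟩ := exists_nat_ge x
    exact hx n (mem_uIcc_of_le (le_of_lt hx0) (hn.trans (by linarith))) 0 left_mem_uIcc
  filter_upwards [hderiv hp, hderiv hq, ae_restrict_mem measurableSet_Ioi] with x hpx hqx hx
  exact (hpx.congr_of_eventuallyEq
    (eventually_of_mem (Ioi_mem_nhds hx) fun T hT => (h T hT).symm)).unique hqx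

namespace ViscousFamily

theorem exists_measurable_boundary (hV : ViscousFamily 𝒰 K f ε uIε uBε u)
    (hD : BoundaryData uBε uB) :
    ∃ v : ℝ → State N, Measurable v ∧ (∀ t, v t ∈ K) ∧ v =ᵐ[volHalf] uB := by
  classical
  have hm : AEMeasurable uB volHalf := aemeasurable_of_tendsto_metrizable_ae atTop
    (fun n => (hV.continuousOn_boundary n).aemeasurable measurableSet_Ioi) hD.lim
  obtain ⟨k, hk⟩ := hV.nonempty
  refine ⟨fun t => if hm.mk uB t ∈ K then hm.mk uB t else k,
    Measurable.ite (hm.measurable_mk hV.compact.measurableSet) hm.measurable_mk measurable_const,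
    fun t => ?_, ?_⟩
  · beta_reduce
    split_ifs with h
    exacts [h, hk]
  · filter_upwards [hm.ae_eq_mk, ae_restrict_mem measurableSet_Ioi] with t ht ht0
    rw [← ht, if_pos (hV.boundary_limit_mem hD ht0)]

theorem exists_entropyTrace (hV : ViscousFamily 𝒰 K f ε uIε uBε u) (hD : BoundaryData uBε uB)
    (hν : IsYoungMeasure 𝒰 (fun n p => u n p.1 p.2) ν)
    (hμ : IsYoungMeasure 𝒰 (fun n p => u n (ε n * p.1) p.2) μ) :
    ∃ μ₀ : Kernel ℝ (State N), IsEntropyTrace 𝒰 f μ μ₀ := by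
  obtain ⟨v, hv, hvK, hv_ae⟩ := hV.exists_measurable_boundary hD
  refine ⟨Kernel.deterministic v hv, ⟨inferInstance, K, hV.compact, hV.subset, fun t _ => ?_⟩,
    fun U F hUF θ hθ T₁ T₂ h0 h => ?_⟩
  · rw [Kernel.deterministic_apply, Measure.dirac_apply' _ hV.compact.measurableSet.compl,
      indicator_of_notMem (not_not.2 (hvK t))]
  · rw [HasTraceOn]
    convert hV.tendsto_entropy hD hν hμ hUF hθ h0 h using 2
    refine intervalIntegral.integral_congr_ae ?_
    rw [EventuallyEq, ae_restrict_iff' measurableSet_Ioi] at hv_ae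
    filter_upwards [hv_ae] with t ht htT
    rw [uIoc_of_le h.le] at htT
    rw [Kernel.deterministic_apply, integral_dirac, ht (h0.trans_lt htT.1)]

theorem integral_entropyTrace (hV : ViscousFamily 𝒰 K f ε uIε uBε u) (hD : BoundaryData uBε uB)
    (hν : IsYoungMeasure 𝒰 (fun n p => u n p.1 p.2) ν)
    (hμ : IsYoungMeasure 𝒰 (fun n p => u n (ε n * p.1) p.2) μ) (hμ₀ : IsEntropyTrace 𝒰 f μ μ₀)
    (hUF : IsConvexEntropyPair 𝒰 f U F) :
    (fun t => ∫ w, U w ∂(μ₀ t)) =ᵐ[volHalf] fun t => U (uB t) := by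
  have hUc := hUF.contDiffOn_entropy.continuousOn
  have hone : IsBV fun _ : ℝ => (1 : ℝ) := isBV_const 1
  refine ae_eq_of_forall_intervalIntegral_eq (fun T hT => ?_) (fun T hT => ?_) fun T hT => ?_
  · simpa only [mul_one] using hμ₀.toIsBoundaryYoungMeasure.intervalIntegrable hUc le_rfl hT.le
      (hone.integrableOn le_rfl)
  · simpa only [mul_one] using hV.intervalIntegrable_boundary hD hUc le_rfl hT.le
      (hone.integrableOn le_rfl)
  · simpa only [mul_one] using tendsto_nhds_unique (hμ₀.trace U F hUF _ hone 0 T le_rfl hT)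
      (hV.tendsto_entropy hD hν hμ hUF hone le_rfl hT)

end ViscousFamily

end BoundaryTrace

section DiracMass

variable {E : Type*} [NormedAddCommGroup E] [NormedSpace ℝ E] {s : Set E} {g : E → ℝ}

theorem hasDerivAt_comp_lineMap {G : Type*} [NormedAddCommGroup G] [NormedSpace ℝ G] {h : E → G}
    {x y : E} {r : ℝ} (hh : DifferentiableAt ℝ h (AffineMap.lineMap x y r)) :
    HasDerivAt (fun r => h (AffineMap.lineMap x y r))
      (fderiv ℝ h (AffineMap.lineMap x y r) (y - x)) r :=
  hh.hasFDerivAt.comp_hasDerivAt r AffineMap.hasDerivAt_lineMap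

theorem strictConvexOn_of_hessian_pos (hs : IsOpen s) (hsc : Convex ℝ s) (hg : ContDiffOn ℝ 2 g s)
    (hpos : ∀ z ∈ s, ∀ w, w ≠ 0 → 0 < fderiv ℝ (fderiv ℝ g) z w w) : StrictConvexOn ℝ s g := by
  refine ⟨hsc, fun x hx y hy hxy a b ha hb hab => ?_⟩
  have hmem : ∀ r ∈ Icc (0 : ℝ) 1, AffineMap.lineMap x y r ∈ s := fun r hr =>
    hsc.lineMap_mem hx hy hr
  have hderiv : ∀ r ∈ Icc (0 : ℝ) 1, HasDerivAt (fun r => g (AffineMap.lineMap x y r))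
      (fderiv ℝ g (AffineMap.lineMap x y r) (y - x)) r := fun r hr =>
    hasDerivAt_comp_lineMap
      ((hg.differentiableOn two_ne_zero).differentiableAt (hs.mem_nhds (hmem r hr)))
  have hderiv2 : ∀ r ∈ Icc (0 : ℝ) 1, HasDerivAt
      (fun r => fderiv ℝ g (AffineMap.lineMap x y r) (y - x))
      (fderiv ℝ (fderiv ℝ g) (AffineMap.lineMap x y r) (y - x) (y - x)) r := fun r hr => by
    simpa using (hasDerivAt_comp_lineMap (((hg.fderiv_of_isOpen (m := 1) hs (by norm_num)
      ).differentiableOn one_ne_zero).differentiableAt (hs.mem_nhds (hmem r hr)))).clm_apply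
      (hasDerivAt_const r (y - x))
  have hline : StrictConvexOn ℝ (Icc 0 1) fun r : ℝ => g (AffineMap.lineMap x y r) := by
    refine strictConvexOn_of_deriv2_pos (convex_Icc 0 1)
      (fun r hr => (hderiv r hr).continuousAt.continuousWithinAt) fun r hr => ?_
    rw [interior_Icc] at hr
    have heq : deriv (fun r => g (AffineMap.lineMap x y r)) =ᶠ[𝓝 r]
        fun r => fderiv ℝ g (AffineMap.lineMap x y r) (y - x) :=
      eventually_of_mem (Icc_mem_nhds hr.1 hr.2) fun r hr => (hderiv r hr).deriv
    rw [Function.iterate_succ_apply, Function.iterate_one, heq.deriv_eq,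
      (hderiv2 r (Ioo_subset_Icc_self hr)).deriv]
    exact hpos _ (hmem r (Ioo_subset_Icc_self hr)) _ (sub_ne_zero.2 hxy.symm)
  have hlt := hline.2 (left_mem_Icc.2 zero_le_one) (right_mem_Icc.2 zero_le_one) zero_ne_one
    ha hb hab
  have hb1 : 1 - b = a := by linarith
  simpa [AffineMap.lineMap_apply_module, hb1] using hlt

theorem eq_dirac_of_strictConvexOn [CompleteSpace E] [MeasurableSpace E] (hg : StrictConvexOn ℝ s g)
    (hgc : ContinuousOn g s) (hsc : IsClosed s) {m : Measure E} [IsProbabilityMeasure m]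
    (hm : ∀ᵐ z ∂m, z ∈ s) (hid : Integrable (fun z => z) m) (hgi : Integrable g m)
    (hmean : ∫ z, g z ∂m = g (∫ z, z ∂m)) : m = Measure.dirac (∫ z, z ∂m) := by
  rcases hg.ae_eq_const_or_map_average_lt hgc hsc hm hid hgi with hae | hlt
  · rw [average_eq_integral] at hae
    have hmap : m.map id = m.map fun _ => ∫ z, z ∂m := Measure.map_congr hae
    rwa [Measure.map_id, Measure.map_const, measure_univ, one_smul] at hmap
  · rw [average_eq_integral, average_eq_integral, hmean] at hlt
    exact (lt_irrefl _ hlt).elim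

end DiracMass

section TraceIsDirac

variable {N : ℕ} {𝒰 K : Set (State N)} {f : State N → State N} {ε : ℕ → ℝ}
  {uIε uBε : ℕ → ℝ → State N} {uB : ℝ → State N} {u : ℕ → ℝ → ℝ → State N}
  {U F : State N → ℝ} {ν μ : Kernel (ℝ × ℝ) (State N)} {μ₀ : Kernel ℝ (State N)}

theorem IsStrictlyConvexEntropyPair.toIsConvexEntropyPair
    (h : IsStrictlyConvexEntropyPair 𝒰 f U F) : IsConvexEntropyPair 𝒰 f U F where
  toIsEntropyPair := h.toIsEntropyPair
  hessian_nonneg z hz w := by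
    rcases eq_or_ne w 0 with rfl | hw
    · simp
    · exact (h.hessian_pos z hz w hw).le

theorem ViscousFamily.entropyTrace_eq_dirac (hV : ViscousFamily 𝒰 K f ε uIε uBε u)
    (h𝒰c : Convex ℝ 𝒰) (hUF : IsStrictlyConvexEntropyPair 𝒰 f U F) (hD : BoundaryData uBε uB)
    (hν : IsYoungMeasure 𝒰 (fun n p => u n p.1 p.2) ν)
    (hμ : IsYoungMeasure 𝒰 (fun n p => u n (ε n * p.1) p.2) μ)
    (hμ₀ : IsEntropyTrace 𝒰 f μ μ₀) : ∀ᵐ t ∂volHalf, μ₀ t = Measure.dirac (uB t) := by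
  have hb := hμ₀.toIsBoundaryYoungMeasure
  have := hb.markov
  have hUc := hUF.contDiffOn_entropy.continuousOn
  obtain ⟨S, hS, hS𝒰, hsupp⟩ := hb.support
  obtain ⟨L, hL, hLc, hSL, hL𝒰⟩ := exists_isCompact_convex_superset hV.isOpen h𝒰c hS hS𝒰
  have hUL : StrictConvexOn ℝ L U :=
    (strictConvexOn_of_hessian_pos hV.isOpen h𝒰c hUF.contDiffOn_entropy hUF.hessian_pos).subset
      hL𝒰 hLc
  have hcoord : ∀ᵐ t ∂volHalf, ∀ j, ∫ w, w j ∂(μ₀ t) = uB t j := ae_all_iff.2 fun j =>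
    hV.integral_entropyTrace hD hν hμ hμ₀ (isConvexEntropyPair_coord hV.isOpen hV.smooth j)
  filter_upwards [hcoord, hV.integral_entropyTrace hD hν hμ hμ₀ hUF.toIsConvexEntropyPair,
    ae_restrict_mem measurableSet_Ioi] with t hcoord hU ht
  have hid : Integrable (fun z => z) (μ₀ t) := hb.integrable continuousOn_id ht
  have hmean : ∫ z, z ∂(μ₀ t) = uB t := by
    ext j
    exact ((EuclideanSpace.proj (𝕜 := ℝ) j).integral_comp_comm hid).symm.trans (hcoord j)
  have hmem : ∀ᵐ z ∂(μ₀ t), z ∈ L := by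
    filter_upwards [measure_eq_zero_iff_ae_notMem.1 (hsupp t ht)] with z hz
      using hSL (not_not.1 hz)
  rw [← hmean] at hU ⊢
  exact eq_dirac_of_strictConvexOn hUL (hUc.mono hL𝒰) hL.isClosed hmem hid (hb.integrable hUc ht) hU

end TraceIsDirac

end BoundaryLayer

theorem theorem2p1_general {N : ℕ} (𝒰 : Set (BoundaryLayer.State N)) (h𝒰_open : IsOpen 𝒰)
    (h𝒰_convex : Convex ℝ 𝒰)
    (f : BoundaryLayer.State N → BoundaryLayer.State N) (hf : ContDiffOn ℝ 2 f 𝒰)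
    (h_strict : ∃ U F : BoundaryLayer.State N → ℝ,
      BoundaryLayer.IsStrictlyConvexEntropyPair 𝒰 f U F)
    (uB : ℝ → BoundaryLayer.State N) (huB : BoundaryLayer.IsBV uB)
    (ε : ℕ → ℝ) (hε_pos : ∀ n, 0 < ε n) (hε : Tendsto ε atTop (𝓝 0))
    (uIε uBε : ℕ → ℝ → BoundaryLayer.State N)
    (huBε_var : ∀ T : ℝ, ∃ C : NNReal, ∀ n, eVariationOn (uBε n) (Ioo 0 T) ≤ C)
    (huBε_lim : ∀ᵐ t ∂BoundaryLayer.volHalf, Tendsto (fun n => uBε n t) atTop (𝓝 (uB t)))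
    (u : ℕ → ℝ → ℝ → BoundaryLayer.State N)
    (hu : ∀ n, BoundaryLayer.IsViscousSolution 𝒰 f (ε n) (uIε n) (uBε n) (u n))
    (hu_bdd : ∃ C : ℝ, ∀ n x t, 0 ≤ x → 0 ≤ t → ‖u n x t‖ ≤ C)
    (ν μ : Kernel (ℝ × ℝ) (BoundaryLayer.State N))
    (hν : BoundaryLayer.IsYoungMeasure 𝒰 (fun n p => u n p.1 p.2) ν)
    (hμ : BoundaryLayer.IsYoungMeasure 𝒰 (fun n p => u n (ε n * p.1) p.2) μ) :
    (∀ U F : BoundaryLayer.State N → ℝ, BoundaryLayer.IsConvexEntropyPair 𝒰 f U F →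
      ∀ θ : ℝ → ℝ, BoundaryLayer.IsBV θ → ∀ T₁ T₂ : ℝ, 0 ≤ T₁ → T₁ < T₂ →
      (∃ G : ℝ → ℝ, BoundaryLayer.IsBV G ∧ BoundaryLayer.IsLayerFlux μ U F θ T₁ T₂ G) ∧
      (∃ g : ℝ → ℝ, BoundaryLayer.IsBV g ∧
        BoundaryLayer.timeAvg ν F θ T₁ T₂ =ᵐ[BoundaryLayer.volHalf] g)) ∧
    (∃ μ₀ : Kernel ℝ (BoundaryLayer.State N), BoundaryLayer.IsEntropyTrace 𝒰 f μ μ₀) ∧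
    (∃ ν₀ : Kernel ℝ (BoundaryLayer.State N), BoundaryLayer.IsFluxTrace 𝒰 f ν ν₀) ∧
    (∀ ν₀ : Kernel ℝ (BoundaryLayer.State N), BoundaryLayer.IsFluxTrace 𝒰 f ν ν₀ →
      ∀ U F : BoundaryLayer.State N → ℝ, BoundaryLayer.IsConvexEntropyPair 𝒰 f U F →
      ∀ θ : ℝ → ℝ, BoundaryLayer.IsBV θ → (∀ t, 0 < t → 0 ≤ θ t) →
      ∀ T₁ T₂ : ℝ, 0 ≤ T₁ → T₁ < T₂ →
      ∀ G : ℝ → ℝ, BoundaryLayer.IsBV G → BoundaryLayer.IsLayerFlux μ U F θ T₁ T₂ G →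
      ∀ y₁ y₂ : ℝ, 0 < y₁ → y₁ < y₂ →
        G y₁ ≤ ∫ t in T₁..T₂,
          (F (uB t) + fderiv ℝ U (uB t) ((∫ w, f w ∂(ν₀ t)) - f (uB t))) * θ t ∧
        G y₂ ≤ G y₁ ∧
        ∫ t in T₁..T₂, (∫ w, F w ∂(ν₀ t)) * θ t ≤ G y₂) ∧
    (∀ μ₀ : Kernel ℝ (BoundaryLayer.State N), BoundaryLayer.IsEntropyTrace 𝒰 f μ μ₀ →
      ∀ᵐ t ∂BoundaryLayer.volHalf, μ₀ t = Measure.dirac (uB t)) ∧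
    (∀ ν₀ : Kernel ℝ (BoundaryLayer.State N), BoundaryLayer.IsFluxTrace 𝒰 f ν ν₀ →
      ∀ U F : BoundaryLayer.State N → ℝ, BoundaryLayer.IsConvexEntropyPair 𝒰 f U F →
      ∀ θ : ℝ → ℝ, BoundaryLayer.IsBV θ → (∀ t, 0 < t → 0 ≤ θ t) →
      ∀ T₁ T₂ : ℝ, 0 ≤ T₁ → T₁ < T₂ →
      ∀ G : ℝ → ℝ, BoundaryLayer.IsBV G → BoundaryLayer.IsLayerFlux μ U F θ T₁ T₂ G →
        ∃ L : ℝ, Tendsto G atTop (𝓝 L) ∧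
          ∫ t in T₁..T₂, (∫ w, F w ∂(ν₀ t)) * θ t ≤ L) := by
  obtain ⟨C, hC⟩ := hu_bdd
  obtain ⟨K, hK, hKc, hK𝒰, hmem⟩ := hν.exists_compact_range h𝒰_open h𝒰_convex
    (fun n => (hu n).continuousOn) (fun n p hp => (hu n).mem p.1 p.2 hp.1 hp.2)
    (fun n p hp => hC n p.1 p.2 hp.1 hp.2)
  have hV : BoundaryLayer.ViscousFamily 𝒰 K f ε uIε uBε u :=
    ⟨h𝒰_open, hK, hKc, hK𝒰, hf, hε_pos, hε, hu, fun n x t hx ht => @hmem n (x, t) ⟨hx, ht⟩⟩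
  have hD : BoundaryLayer.BoundaryData uBε uB := ⟨huB, huBε_var, huBε_lim⟩
  refine ⟨fun U F hUF θ hθ T₁ T₂ h0 h => ⟨hV.exists_layer_isBV hD hν hμ hUF hθ h0 h, ?_⟩,
    hV.exists_entropyTrace hD hν hμ, hV.exists_fluxTrace hν, ?_, ?_, ?_⟩
  · obtain ⟨g, hg, hae, -⟩ := hV.exists_interior_isBV hν hUF hθ h0 h
    exact ⟨g, hg, hae⟩
  · intro ν₀ hν₀ U F hUF θ hθ hpos T₁ T₂ h0 h G hG hGL y₁ y₂ hy₁ hy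
    obtain ⟨hanti, hup, hlow⟩ := hV.layer_bounds hD hν hμ hν₀ hUF hθ hpos h0 h hG hGL
    exact ⟨hup y₁ hy₁, hanti hy₁ (hy₁.trans hy) hy.le, hlow y₂ (hy₁.trans hy)⟩
  · obtain ⟨U, F, hUF⟩ := h_strict
    exact fun μ₀ hμ₀ => hV.entropyTrace_eq_dirac h𝒰_convex hUF hD hν hμ hμ₀
  · intro ν₀ hν₀ U F hUF θ hθ hpos T₁ T₂ h0 h G hG hGL
    obtain ⟨hanti, -, hlow⟩ := hV.layer_bounds hD hν hμ hν₀ hUF hθ hpos h0 h hG hGL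
    exact BoundaryLayer.exists_tendsto_atTop_of_antitoneOn hanti hlow

theorem theorem2p1 {N : ℕ} (𝒰 : Set (BoundaryLayer.State N)) (h𝒰_open : IsOpen 𝒰)
    (h𝒰_convex : Convex ℝ 𝒰)
    (f : BoundaryLayer.State N → BoundaryLayer.State N) (hf : ContDiffOn ℝ ∞ f 𝒰)
    -- existence of a strictly convex entropy pair
    (h_strict : ∃ U F : BoundaryLayer.State N → ℝ,
      BoundaryLayer.IsStrictlyConvexEntropyPair 𝒰 f U F)
    -- initial and boundary data
    (uI uB : ℝ → BoundaryLayer.State N)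
    (huI : MemLp uI ⊤ BoundaryLayer.volHalf) (huI_mem : ∀ᵐ x ∂BoundaryLayer.volHalf, uI x ∈ 𝒰)
    (huB : BoundaryLayer.IsBV uB) (huB_mem : ∀ t, 0 < t → uB t ∈ 𝒰)
    -- viscosity parameters and approximate data, uniformly bounded in `L^∞` resp. `BV`
    (ε : ℕ → ℝ) (hε_pos : ∀ n, 0 < ε n) (hε : Tendsto ε atTop (𝓝 0))
    (uIε uBε : ℕ → ℝ → BoundaryLayer.State N)
    (huIε_bdd : ∃ C : ℝ, ∀ n x, 0 < x → ‖uIε n x‖ ≤ C)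
    (huIε_lim : ∀ᵐ x ∂BoundaryLayer.volHalf, Tendsto (fun n => uIε n x) atTop (𝓝 (uI x)))
    (huBε_bdd : ∃ C : ℝ, ∀ n t, 0 < t → ‖uBε n t‖ ≤ C)
    (huBε_var : ∀ T : ℝ, ∃ C : NNReal, ∀ n, eVariationOn (uBε n) (Ioo 0 T) ≤ C)
    (huBε_lim : ∀ᵐ t ∂BoundaryLayer.volHalf, Tendsto (fun n => uBε n t) atTop (𝓝 (uB t)))
    -- uniformly bounded viscous approximations
    (u : ℕ → ℝ → ℝ → BoundaryLayer.State N)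
    (hu : ∀ n, BoundaryLayer.IsViscousSolution 𝒰 f (ε n) (uIε n) (uBε n) (u n))
    (hu_bdd : ∃ C : ℝ, ∀ n x t, 0 ≤ x → 0 ≤ t → ‖u n x t‖ ≤ C)
    -- Young measures of `u^ε(x, t)` and of `v^ε(y, t) = u^ε(ε y, t)`
    (ν μ : Kernel (ℝ × ℝ) (BoundaryLayer.State N))
    (hν : BoundaryLayer.IsYoungMeasure 𝒰 (fun n p => u n p.1 p.2) ν)
    (hμ : BoundaryLayer.IsYoungMeasure 𝒰 (fun n p => u n (ε n * p.1) p.2) μ) :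
    -- 1) bounded variation of the time averages, and existence of the traces
    (∀ U F : BoundaryLayer.State N → ℝ, BoundaryLayer.IsConvexEntropyPair 𝒰 f U F →
      ∀ θ : ℝ → ℝ, BoundaryLayer.IsBV θ → ∀ T₁ T₂ : ℝ, 0 ≤ T₁ → T₁ < T₂ →
      ((∀ t, 0 < t → 0 ≤ θ t) ∨
        ∃ j : Fin N, EqOn U (fun w => w j) 𝒰 ∧ EqOn F (fun w => f w j) 𝒰) →
      (∃ G : ℝ → ℝ, BoundaryLayer.IsBV G ∧ BoundaryLayer.IsLayerFlux μ U F θ T₁ T₂ G) ∧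
      (∃ g : ℝ → ℝ, BoundaryLayer.IsBV g ∧
        BoundaryLayer.timeAvg ν F θ T₁ T₂ =ᵐ[BoundaryLayer.volHalf] g)) ∧
    (∃ μ₀ : Kernel ℝ (BoundaryLayer.State N), BoundaryLayer.IsEntropyTrace 𝒰 f μ μ₀) ∧
    (∃ ν₀ : Kernel ℝ (BoundaryLayer.State N), BoundaryLayer.IsFluxTrace 𝒰 f ν ν₀) ∧
    -- 2) the boundary entropy inequalities
    (∀ ν₀ : Kernel ℝ (BoundaryLayer.State N), BoundaryLayer.IsFluxTrace 𝒰 f ν ν₀ →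
      ∀ U F : BoundaryLayer.State N → ℝ, BoundaryLayer.IsConvexEntropyPair 𝒰 f U F →
      ∀ θ : ℝ → ℝ, BoundaryLayer.IsBV θ → (∀ t, 0 < t → 0 ≤ θ t) →
      ∀ T₁ T₂ : ℝ, 0 ≤ T₁ → T₁ < T₂ →
      ∀ G : ℝ → ℝ, BoundaryLayer.IsBV G → BoundaryLayer.IsLayerFlux μ U F θ T₁ T₂ G →
      ∀ y₁ y₂ : ℝ, 0 < y₁ → y₁ < y₂ →
        G y₁ ≤ ∫ t in T₁..T₂,
          (F (uB t) + fderiv ℝ U (uB t) ((∫ w, f w ∂(ν₀ t)) - f (uB t))) * θ t ∧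
        G y₂ ≤ G y₁ ∧
        ∫ t in T₁..T₂, (∫ w, F w ∂(ν₀ t)) * θ t ≤ G y₂) ∧
    -- 3) the trace of `μ` is the Dirac mass at the boundary datum
    (∀ μ₀ : Kernel ℝ (BoundaryLayer.State N), BoundaryLayer.IsEntropyTrace 𝒰 f μ μ₀ →
      ∀ᵐ t ∂BoundaryLayer.volHalf, μ₀ t = Measure.dirac (uB t)) ∧
    -- and the limit `y → ∞`
    (∀ ν₀ : Kernel ℝ (BoundaryLayer.State N), BoundaryLayer.IsFluxTrace 𝒰 f ν ν₀ →
      ∀ U F : BoundaryLayer.State N → ℝ, BoundaryLayer.IsConvexEntropyPair 𝒰 f U F →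
      ∀ θ : ℝ → ℝ, BoundaryLayer.IsBV θ → (∀ t, 0 < t → 0 ≤ θ t) →
      ∀ T₁ T₂ : ℝ, 0 ≤ T₁ → T₁ < T₂ →
      ∀ G : ℝ → ℝ, BoundaryLayer.IsBV G → BoundaryLayer.IsLayerFlux μ U F θ T₁ T₂ G →
        ∃ L : ℝ, Tendsto G atTop (𝓝 L) ∧
          ∫ t in T₁..T₂, (∫ w, F w ∂(ν₀ t)) * θ t ≤ L) := by
  have hgen := theorem2p1_general 𝒰 h𝒰_open h𝒰_convex f (hf.of_le (by norm_cast))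
    h_strict uB huB ε hε_pos hε uIε uBε huBε_var huBε_lim u hu hu_bdd ν μ hν hμ
  exact ⟨fun U F hUF θ hθ T₁ T₂ h0 h _ => hgen.1 U F hUF θ hθ T₁ T₂ h0 h, hgen.2⟩
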